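/- Let $n\ge 1$ and let $\Sigma=\{(z,w)\in\mathbb C^n\times\mathbb C:\operatorname{Im}w>|z|^2\}\subset\mathbb C^{n+1}$ be the Siegel upper half space. A $C^m$ defining function for an open set $\Omega\subset\mathbb C^N$ is a real $C^m$ function $\rho$ on an open neighbourhood $U$ of $b\Omega$ with $\Omega\cap U=\{x\in U:\rho(x)<0\}$ and $d\rho\ne0$ on $b\Omega$; it is normalized if $|d\rho|=1$ on $b\Omega$. It is uniformly $C^m$ if moreover $\operatorname{dist}(b\Omega,bU)>0$, $\|\rho\|_{C^m(U)}<\infty$ and $\inf_U|\nabla\rho|>0$, and uniformly $C^\infty$ if this holds, with the same $U$, for every $m$. The Levi form at $p\in b\Omega$ is the restriction of the complex Hessian $(\rho_{j\bar k}(p))$ to $T^{1,0}_p(b\Omega)=\{L=\sum_jL_j\,\partial/\partial z_j:\partial\rho(L)=0\}$; its eigenvalues are taken in the Hermitian metric in which the $\partial/\partial z_j$ are orthonormal; the Levi form of a normalized $C^2$ defining function is the normalized Levi form. $\Omega$ is strictly pseudoconvex if for some $C^2$ defining function all Levi eigenvalues are positive at every boundary point, and uniformly strictly pseudoconvex if for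 some $\lambda>0$ all eigenvalues of the normalized Levi form are greater than $\lambda$ at every boundary point. For $t\ge0$ let $\bar\partial$ be the maximal (distributional) Cauchy–Riemann operator between the spaces $L^2_{0,q}(\Omega,e^{-t|x|^2}dV)$, let $\bar\partial^*_t$ be its Hilbert space adjoint, $\|\cdot\|_t$ the norm, and $\sigma$ the surface measure on $b\Omega$. The Folland–Kohn basic estimate on $(0,q)$-forms with parameter $t$ asserts that there is $C>0$ with $$\int_{b\Omega}|f|^2e^{-t|x|^2}\,d\sigma\le C\big(\|\bar\partial f\|_t^2+\|\bar\partial^*_tf\|_t^2\big)$$ for all $(0,q)$-forms $f\in\operatorname{Dom}(\bar\partial)\cap\operatorname{Dom}(\bar\partial_t^*)$ that are continuous up to the boundary (so that the left-hand side is defined). Then: 1. $\Sigma$ is a domain that has a normalized, uniformly $C^\infty$ defining function. 2. $\Sigma$ is strictly pseudoconvex. 3. $\Sigma$ is not uniformly strictly pseudoconvex. More precisely, for every normalized $C^2$ defining function, the eigenvalues of the normalized Levi form at $(z,w)\in b\Sigma$ are $(1+4|z|^2)^{-3/2}$ and, if $n\ge2$, also $(1+4|z|^2)^{-1/2}$;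 so the smallest eigenvalue is $(1+4|z|^2)^{-3/2}$ (the only one if $n=1$), and it tends to $0$ as $|z|\to\infty$ along $b\Sigma$. 4. For every $1\le q\le n$ and every $t\ge0$ the Folland–Kohn basic estimate on $(0,q)$-forms fails on $\Sigma$. It fails even if only those $f\in\operatorname{Dom}(\bar\partial)\cap\operatorname{Dom}(\bar\partial^*_t)$ are considered that are restrictions of smooth compactly supported forms on $\mathbb C^{n+1}$. -/

import Mathlib

open MeasureTheory Filter Topology
open scoped ContDiff ENNReal ComplexConjugate

noncomputable section

/-- `ℂ^N` with its Hermitian (equivalently, real Euclidean) norm. -/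
abbrev CSpace (N : ℕ) : Type := EuclideanSpace ℂ (Fin N)

section Derivatives

variable {N : ℕ}

/-- `∂f/∂z_j = (1/2)(∂/∂x_j - i ∂/∂y_j) f`. -/
def dz (j : Fin N) (f : CSpace N → ℂ) (p : CSpace N) : ℂ :=
  (1 / 2) * (fderiv ℝ f p (EuclideanSpace.single j 1)
    - Complex.I * fderiv ℝ f p (EuclideanSpace.single j Complex.I))

/-- `∂f/∂z̄_j = (1/2)(∂/∂x_j + i ∂/∂y_j) f`. -/
def dzbar (j : Fin N) (f : CSpace N → ℂ) (p : CSpace N) : ℂ :=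
  (1 / 2) * (fderiv ℝ f p (EuclideanSpace.single j 1)
    + Complex.I * fderiv ℝ f p (EuclideanSpace.single j Complex.I))

end Derivatives

section DefiningFunctions

variable {N : ℕ}

/-- `ρ` is a `C^m` defining function for `Ω` on the open neighbourhood `U` of the boundary. -/
structure IsDefiningFunction (m : WithTop ℕ∞) (Ω U : Set (CSpace N)) (ρ : CSpace N → ℝ) :
    Prop where
  isOpen : IsOpen U
  frontier_subset : frontier Ω ⊆ U
  contDiffOn : ContDiffOn ℝ m ρ U
  mem_iff : ∀ x ∈ U, x ∈ Ω ↔ ρ x < 0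
  fderiv_ne_zero : ∀ p ∈ frontier Ω, fderiv ℝ ρ p ≠ 0

/-- `|dρ| = 1` on the boundary. -/
def IsNormalizedOn (Ω : Set (CSpace N)) (ρ : CSpace N → ℝ) : Prop :=
  ∀ p ∈ frontier Ω, ‖fderiv ℝ ρ p‖ = 1

/-- `ρ` is a uniformly `C^m` defining function for `Ω` on `U`: the distance from `bΩ` to `bU` is
positive, the `C^m(U)` norm of `ρ` is finite and `|∇ρ|` is bounded below on `U`. -/
structure IsUniformDefiningFunction (m : ℕ) (Ω U : Set (CSpace N)) (ρ : CSpace N → ℝ) :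
    Prop extends IsDefiningFunction m Ω U ρ where
  dist_pos : ∃ δ > 0, ∀ p ∈ frontier Ω, ∀ x ∈ frontier U, δ ≤ dist p x
  bounded : ∀ k ≤ m, ∃ C : ℝ, ∀ x ∈ U, ‖iteratedFDeriv ℝ k ρ x‖ ≤ C
  grad_bounded_below : ∃ c > 0, ∀ x ∈ U, c ≤ ‖fderiv ℝ ρ x‖

/-- Uniformly `C^∞`: uniformly `C^m` on the same `U` for all `m`. -/
def IsUniformlySmoothDefiningFunction (Ω U : Set (CSpace N)) (ρ : CSpace N → ℝ) : Prop :=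
  ∀ m : ℕ, IsUniformDefiningFunction m Ω U ρ

end DefiningFunctions

section Levi

variable {N : ℕ}

/-- The space `T^{1,0}_p(bΩ)`, for `bΩ = {ρ = 0}`: the vectors `L = ∑ L_j ∂/∂z_j` with
`∂ρ(L) = 0`. -/
def tangent10 (ρ : CSpace N → ℝ) (p : CSpace N) : Set (CSpace N) :=
  {L | ∑ j, dz j (fun x => (ρ x : ℂ)) p * L j = 0}

/-- The complex Hessian `∑ ρ_{j k̄} L_j conj(M_k)`. -/
def leviForm (ρ : CSpace N → ℝ) (p L M : CSpace N) : ℂ :=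
  ∑ j, ∑ k, dz j (dzbar k (fun x => (ρ x : ℂ))) p * L j * conj (M k)

/-- The eigenvalues at `p` of the Levi form of `ρ`, i.e. of the restriction of the complex Hessian
to `T^{1,0}_p`, with respect to the Hermitian metric in which the `∂/∂z_j` are orthonormal. -/
def leviEigenvalues (ρ : CSpace N → ℝ) (p : CSpace N) : Set ℝ :=
  {μ | ∃ L ∈ tangent10 ρ p, L ≠ 0 ∧
    ∀ M ∈ tangent10 ρ p, leviForm ρ p L M = (μ : ℂ) * inner ℂ M L}

/-- All eigenvalues of the Levi form are positive at every boundary point. -/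
def StrictlyPseudoconvex (Ω : Set (CSpace N)) : Prop :=
  ∃ U ρ, IsDefiningFunction 2 Ω U ρ ∧ ∀ p ∈ frontier Ω, ∀ μ ∈ leviEigenvalues ρ p, 0 < μ

/-- All eigenvalues of the normalized Levi form exceed some `lam > 0` independent of the boundary
point. -/
def UniformlyStrictlyPseudoconvex (Ω : Set (CSpace N)) : Prop :=
  ∃ U ρ, IsDefiningFunction 2 Ω U ρ ∧ IsNormalizedOn Ω ρ ∧
    ∃ lam > 0, ∀ p ∈ frontier Ω, ∀ μ ∈ leviEigenvalues ρ p, lam < μ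

end Levi

section Dbar

/-- The fibre `Λ^{0,q}` of the `(0,q)`-forms on `ℂ^N`; the `dz̄_J`, `J` a `q`-element (increasing)
multi-index, form an orthonormal basis. -/
abbrev Forms (N q : ℕ) : Type := EuclideanSpace ℂ {J : Finset (Fin N) // J.card = q}

variable {N : ℕ}

/-- The coefficient of `dz̄_K` in `dz̄_k ∧ dz̄_J`. -/
def wedgeSign (k : Fin N) (J K : Finset (Fin N)) : ℂ :=
  if k ∉ J ∧ insert k J = K then (-1) ^ (J.filter (· < k)).card else 0

/-- The measure `e^{-t|z|^2} dV` on `Ω`. -/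
def weightedVolume (Ω : Set (CSpace N)) (t : ℝ) : Measure (CSpace N) :=
  (volume.restrict Ω).withDensity fun x => ENNReal.ofReal (Real.exp (-t * ‖x‖ ^ 2))

/-- The measure `e^{-t|z|^2} dσ` on `bΩ`, with `dσ` the `(2N-1)`-dimensional surface area. -/
def weightedSurface (Ω : Set (CSpace N)) (t : ℝ) : Measure (CSpace N) :=
  ((Measure.euclideanHausdorffMeasure (2 * N - 1)).restrict (frontier Ω)).withDensity
    fun x => ENNReal.ofReal (Real.exp (-t * ‖x‖ ^ 2))

/-- `f` lies in the domain of the maximal (distributional) extension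
`∂̄ : L²_{0,p}(Ω, e^{-t|z|²}) → L²_{0,q}(Ω, e^{-t|z|²})` (`q = p + 1`) and `∂̄ f = u`. Here
`(∂̄f)_K = ∑_{J,k} ε^K_{kJ} ∂f_J/∂z̄_k`, tested against `φ ∈ C_c^∞(Ω)`. -/
def IsDbar {p q : ℕ} (Ω : Set (CSpace N)) (t : ℝ) (f : CSpace N → Forms N p)
    (u : CSpace N → Forms N q) : Prop :=
  MemLp f 2 (weightedVolume Ω t) ∧ MemLp u 2 (weightedVolume Ω t) ∧
    ∀ (φ : CSpace N → ℂ), ContDiff ℝ ∞ φ → HasCompactSupport φ → tsupport φ ⊆ Ω →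
      ∀ K : {K : Finset (Fin N) // K.card = q},
        ∫ x in Ω, u x K * φ x =
          -∫ x in Ω, ∑ J : {J : Finset (Fin N) // J.card = p}, ∑ k : Fin N,
            wedgeSign k J.1 K.1 * f x J * dzbar k φ x

/-- `f` lies in the domain of the Hilbert space adjoint
`∂̄*_t : L²_{0,q}(Ω, e^{-t|z|²}) → L²_{0,p}(Ω, e^{-t|z|²})` (`q = p + 1`) of `∂̄`, and
`∂̄*_t f = v`. -/
def IsDbarStar {p q : ℕ} (Ω : Set (CSpace N)) (t : ℝ) (f : CSpace N → Forms N q)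
    (v : CSpace N → Forms N p) : Prop :=
  MemLp f 2 (weightedVolume Ω t) ∧ MemLp v 2 (weightedVolume Ω t) ∧
    ∀ (g : CSpace N → Forms N p) (u : CSpace N → Forms N q), IsDbar Ω t g u →
      ∫ x, inner ℂ (f x) (u x) ∂weightedVolume Ω t =
        ∫ x, inner ℂ (v x) (g x) ∂weightedVolume Ω t

/-- The basic estimate
`∫_{bΩ} |f|² e^{-t|z|²} dσ ≤ C (‖∂̄f‖_t² + ‖∂̄*_t f‖_t²)` for the `(0,q)`-forms `f` of the class
`S` in `Dom(∂̄) ∩ Dom(∂̄*_t)`, where `q ≥ 1`. -/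
def BasicEstimateOn {q : ℕ} (S : Set (CSpace N → Forms N q)) (Ω : Set (CSpace N)) (t : ℝ) : Prop :=
  ∃ C : ℝ, 0 < C ∧ ∀ f ∈ S, ∀ (u : CSpace N → Forms N (q + 1)) (v : CSpace N → Forms N (q - 1)),
    IsDbar Ω t f u → IsDbarStar Ω t f v →
      ∫⁻ x, ‖f x‖ₑ ^ 2 ∂weightedSurface Ω t ≤
        ENNReal.ofReal C * (∫⁻ x, ‖u x‖ₑ ^ 2 ∂weightedVolume Ω t
          + ∫⁻ x, ‖v x‖ₑ ^ 2 ∂weightedVolume Ω t)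

/-- The Folland-Kohn basic estimate on `(0,q)`-forms with weight parameter `t`, for all
`f ∈ Dom(∂̄) ∩ Dom(∂̄*_t)` whose boundary values exist classically. -/
def FollandKohnBasicEstimate (q : ℕ) (Ω : Set (CSpace N)) (t : ℝ) : Prop :=
  BasicEstimateOn {f : CSpace N → Forms N q | ContinuousOn f (closure Ω)} Ω t

end Dbar

section Siegel

/-- `|z|²` for `p = (z, w) ∈ ℂ^n × ℂ`. -/
def zNormSq {n : ℕ} (p : CSpace (n + 1)) : ℝ := ∑ i : Fin n, ‖p i.castSucc‖ ^ 2

/-- The Siegel upper half space `{(z, w) ∈ ℂ^n × ℂ : Im w > |z|²}`. -/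
def siegel (n : ℕ) : Set (CSpace (n + 1)) := {p | zNormSq p < (p (Fin.last n)).im}

end Siegel

end

/-! Write r = |z|² - Im w and s = (1 + 4|z|²)^(-1/2), so that |dr| = 1/s.

Regularity. The function ρ = s r is normalized. The triple Y = (s, s z, ρ) solves a closed total
differential equation DY = P(Y) with P polynomial (`hasFDerivAt_siegelJet`), and Y stays in the unit
ball where |ρ| < 1/4. Differentiating the equation repeatedly bounds all derivatives of ρ there
(`exists_bound_iteratedFDeriv_comp`).

Levi form. An arbitrary normalized C² function ρ is controlled by differentiating ρ = 0 along
explicit parabolas lying in the boundary (`fderiv_fderiv_tangent`). On the boundary this gives dρ =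
s dr, and on tangent vectors the Hessian of ρ is s times that of r. A vector of T^{1,0} is
determined by its z-components a. In these coordinates the Levi form is s·Id, while the ambient
metric becomes Id + 4zz*. So the eigenvalues solve s a = μ(a + 4⟨a,z⟩z): μ = s for a orthogonal to
z, and μ = s/(1 + 4|z|²) = s³ for a parallel to z.

Failure of the estimate. Let R be large and consider the boundary point (R e, iR²). The test form is
f = g · ι_{∂r} dz̄_{K₀} with |K₀| = q + 1. Since ι_{∂r} squares to zero, f is tangential at every
point, so it lies in the domain of the adjoint (`isDbarStar_dbarStarForm`). The coefficients of
ι_{∂r} dz̄_{K₀} are antiholomorphic, so ∂̄* differentiates only g, and tangentiality leaves only the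
fields ∂_{z_l} + 2i z̄_l ∂_w, which annihilate r.

Take g = χ(z'/ε, w') exp(iw'/ε²), where (z', w') is the Heisenberg translate sending the chosen
point to the origin. The exponential is holomorphic, and the tangential fields multiply it by -2
z̄'_l/ε² = O(1/ε). Hence ∂̄f and ∂̄*f are O(R/ε) times the peak (`exists_bound_heisTest`). The
squared peak has integral O(ε^(2n+2)) over the domain (`exists_lintegral_heisPeak_le`), so without
the weight the right-hand side is O(R² ε^(2n)). On the boundary near the point |f| is at least a
constant times R, and the relevant patch has area at least c R ε^(2n), because the hypersurface is
steep there (`exists_surface_lower_bound`). So the left-hand side is at least a constant times R³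
ε^(2n). With R³ε small, the bounds used for |x|² differ by at most 6, so the weight costs only a
factor e^(6t). Large R contradicts any constant. -/

noncomputable section

/-! ### The quadratic defining function and the geometry of the domain -/

section SiegelGeometry

variable {n : ℕ}

/-- The real-linear projection `(z, w) ↦ (z, 0)`. -/
def zPart (n : ℕ) : CSpace (n + 1) →L[ℝ] CSpace (n + 1) :=
  LinearMap.toContinuousLinearMap
    { toFun := fun p => WithLp.toLp 2 fun i => if i = Fin.last n then 0 else p i
      map_add' := by intro p q; ext i; by_cases hi : i = Fin.last n <;> simp [hi]
      map_smul' := by intro c p; ext i; by_cases hi : i = Fin.last n <;> simp [hi] }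

theorem zPart_apply (p : CSpace (n + 1)) (i : Fin (n + 1)) :
    zPart n p i = if i = Fin.last n then 0 else p i := rfl

@[simp] theorem zPart_castSucc (p : CSpace (n + 1)) (i : Fin n) :
    zPart n p i.castSucc = p i.castSucc := by
  simp [zPart_apply, (Fin.castSucc_lt_last i).ne]

@[simp] theorem zPart_last (p : CSpace (n + 1)) : zPart n p (Fin.last n) = 0 := by
  simp [zPart_apply]

theorem norm_zPart_sq (p : CSpace (n + 1)) : ‖zPart n p‖ ^ 2 = zNormSq p := by
  rw [EuclideanSpace.norm_sq_eq, Fin.sum_univ_castSucc]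
  simp [zNormSq]

theorem zNormSq_nonneg (p : CSpace (n + 1)) : 0 ≤ zNormSq p :=
  Finset.sum_nonneg fun _ _ => by positivity

theorem inner_zPart_left (p v : CSpace (n + 1)) :
    inner ℝ (zPart n p) v = ∑ i : Fin n, inner ℝ (p i.castSucc) (v i.castSucc) := by
  rw [PiLp.inner_apply, Fin.sum_univ_castSucc]
  simp

theorem inner_zPart_zPart (p v : CSpace (n + 1)) :
    inner ℝ (zPart n p) (zPart n v) = inner ℝ (zPart n p) v := by
  rw [inner_zPart_left, inner_zPart_left]
  simp

/-- The unit vector in the direction of `Im w`. -/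
def imVec (n : ℕ) : CSpace (n + 1) := EuclideanSpace.single (Fin.last n) Complex.I

theorem inner_imVec (v : CSpace (n + 1)) : inner ℝ (imVec n) v = (v (Fin.last n)).im := by
  rw [PiLp.inner_apply, Fin.sum_univ_castSucc]
  simp [imVec, (Fin.castSucc_lt_last _).ne, Complex.inner]

@[simp] theorem imVec_castSucc (i : Fin n) : imVec n i.castSucc = 0 := by
  simp [imVec, (Fin.castSucc_lt_last _).ne]

@[simp] theorem imVec_last : imVec n (Fin.last n) = Complex.I := by
  simp [imVec]

theorem norm_imVec : ‖imVec n‖ = 1 := by simp [imVec]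

theorem hasFDerivAt_zNormSq (p : CSpace (n + 1)) :
    HasFDerivAt zNormSq (2 • innerSL ℝ (zPart n p)) p := by
  have h : HasFDerivAt (fun p : CSpace (n + 1) => ‖zPart n p‖ ^ 2) _ p :=
    (zPart n).hasFDerivAt.norm_sq
  have e : (fun p : CSpace (n + 1) => ‖zPart n p‖ ^ 2) = zNormSq := funext norm_zPart_sq
  rw [e] at h
  convert h using 1
  ext v
  simp [inner_zPart_zPart]

/-- The standard defining function `|z|² - Im w` of the Siegel upper half space. -/
def siegelFun (p : CSpace (n + 1)) : ℝ := zNormSq p - (p (Fin.last n)).im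

theorem mem_siegel_iff (p : CSpace (n + 1)) : p ∈ siegel n ↔ siegelFun p < 0 := by
  simp [siegel, siegelFun]

theorem hasFDerivAt_siegelFun (p : CSpace (n + 1)) :
    HasFDerivAt siegelFun (2 • innerSL ℝ (zPart n p) - innerSL ℝ (imVec n)) p := by
  have h2 : HasFDerivAt (fun p : CSpace (n + 1) => (p (Fin.last n)).im) (innerSL ℝ (imVec n)) p := by
    convert (innerSL ℝ (imVec n)).hasFDerivAt using 1
    ext v
    simp [inner_imVec]
  exact (hasFDerivAt_zNormSq p).sub h2

theorem contDiff_siegelFun : ContDiff ℝ ∞ (siegelFun (n := n)) := by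
  have e : (siegelFun (n := n)) = fun p => ‖zPart n p‖ ^ 2 - innerSL ℝ (imVec n) p := by
    ext p
    simp [siegelFun, norm_zPart_sq, inner_imVec]
  rw [e]
  exact ((zPart n).contDiff.norm_sq ℝ).sub (innerSL ℝ (imVec n)).contDiff

theorem isOpen_siegel : IsOpen (siegel n) := by
  have : siegel n = siegelFun ⁻¹' Set.Iio 0 := by ext p; exact mem_siegel_iff p
  rw [this]
  exact isOpen_Iio.preimage contDiff_siegelFun.continuous

theorem siegelFun_add_smul_imVec (p : CSpace (n + 1)) (s : ℝ) :
    siegelFun (p + s • imVec n) = siegelFun p - s := by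
  simp [siegelFun, zNormSq]
  ring

/-- Moving along `imVec` lowers `siegelFun` at unit rate, so each of its zeros is a limit of
interior points. The other inclusion is continuity. -/
theorem frontier_siegel : frontier (siegel n) = {p | siegelFun p = 0} := by
  have hc := (contDiff_siegelFun (n := n)).continuous
  rw [isOpen_siegel.frontier_eq]
  ext p
  constructor
  · rintro ⟨h1, h2⟩
    rw [mem_siegel_iff] at h2
    have : p ∈ {p | siegelFun (n := n) p ≤ 0} :=
      closure_minimal (fun x hx => ((mem_siegel_iff x).1 hx).le) (isClosed_le hc continuous_const) h1
    exact le_antisymm this (not_lt.1 h2)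
  · intro hp
    simp only [Set.mem_ofPred_eq] at hp
    refine ⟨?_, by rw [mem_siegel_iff, hp]; simp⟩
    have ht : Tendsto (fun s : ℝ => p + s • imVec n) (𝓝[>] 0) (𝓝 p) := by
      have : Tendsto (fun s : ℝ => p + s • imVec n) (𝓝 0) (𝓝 (p + (0 : ℝ) • imVec n)) :=
        Continuous.tendsto (by fun_prop) 0
      simpa using this.mono_left nhdsWithin_le_nhds
    refine mem_closure_of_tendsto ht ?_
    filter_upwards [self_mem_nhdsWithin] with s hs
    rw [mem_siegel_iff, siegelFun_add_smul_imVec, hp]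
    simpa using hs

/-- The domain is a strict sublevel set of a convex function: |z|² minus a linear form. -/
theorem isConnected_siegel : IsConnected (siegel n) := by
  have hconv : Convex ℝ (siegel n) := by
    have h1 : ConvexOn ℝ Set.univ (siegelFun (n := n)) := by
      have e : (siegelFun (n := n)) = fun p => ‖zPart n p‖ ^ 2 - innerSL ℝ (imVec n) p := by
        ext p
        simp [siegelFun, norm_zPart_sq, inner_imVec]
      rw [e]
      refine ConvexOn.sub ?_ ((innerSL ℝ (imVec n)).toLinearMap.concaveOn convex_univ)
      exact ((convexOn_univ_norm (E := CSpace (n + 1))).comp_linearMap (zPart n).toLinearMap).pow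
        (fun _ _ => norm_nonneg _) 2
    have e : siegel n = {p | p ∈ Set.univ ∧ siegelFun p < 0} := by
      ext p
      simp [mem_siegel_iff p]
    rw [e]
    exact h1.convex_lt 0
  refine ⟨⟨imVec n, ?_⟩, hconv.isPreconnected⟩
  have := siegelFun_add_smul_imVec (n := n) 0 1
  rw [mem_siegel_iff]
  simp only [zero_add, one_smul] at this
  rw [this]
  simp [siegelFun, zNormSq]

end SiegelGeometry

/-! ### Derivative bounds from a closed differential system -/

section BoundedDerivatives

universe u

variable {E : Type u} {F : Type*} [NormedAddCommGroup E] [NormedSpace ℝ E]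
  [NormedAddCommGroup F] [NormedSpace ℝ F]

/-- If `Y` solves a smooth autonomous total differential equation `DY = P(Y)` on an open set and
takes values in a compact set, then all derivatives of `Q ∘ Y`, `Q` smooth, are bounded. -/
theorem exists_bound_iteratedFDeriv_comp {U : Set E} (hU : IsOpen U) {Y : E → F} {K : Set F}
    (hK : IsCompact K) (hY : ∀ x ∈ U, Y x ∈ K) {P : F → E →L[ℝ] F} (hP : ContDiff ℝ ∞ P)
    (hD : ∀ x ∈ U, HasFDerivAt Y (P (Y x)) x) (k : ℕ) :
    ∀ {G : Type u} [NormedAddCommGroup G] [NormedSpace ℝ G] (Q : F → G), ContDiff ℝ ∞ Q →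
      ∃ C : ℝ, ∀ x ∈ U, ‖iteratedFDeriv ℝ k (Q ∘ Y) x‖ ≤ C := by
  induction k with
  | zero =>
    intro G _ _ Q hQ
    obtain ⟨C, hC⟩ := hK.exists_bound_of_continuousOn hQ.continuous.continuousOn
    exact ⟨C, fun x hx => by simpa using hC _ (hY x hx)⟩
  | succ k ih =>
    intro G _ _ Q hQ
    -- By the chain rule D(Q ∘ Y) = (DQ · P) ∘ Y, again a smooth function of Y. The induction
    -- therefore has to run over all Q and all target spaces.
    obtain ⟨C, hC⟩ := ih (fun y => (fderiv ℝ Q y).comp (P y))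
      ((hQ.fderiv_right (m := ∞) (by simp)).clm_comp hP)
    refine ⟨C, fun x hx => ?_⟩
    rw [← norm_iteratedFDeriv_fderiv]
    have he : fderiv ℝ (Q ∘ Y) =ᶠ[𝓝 x] (fun y => (fderiv ℝ Q y).comp (P y)) ∘ Y := by
      filter_upwards [hU.mem_nhds hx] with y hy
      exact (((hQ.differentiable (by simp)) (Y y)).hasFDerivAt.comp y (hD y hy)).fderiv
    rw [(he.iteratedFDeriv ℝ k).eq_of_nhds]
    exact hC x hx

end BoundedDerivatives

/-! ### A normalized, uniformly smooth defining function -/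

section NormalizedDefiningFunction

variable {n : ℕ}

/-- `(1 + 4|z|²)^{-1/2}`. -/
def siegelScale (p : CSpace (n + 1)) : ℝ := (√(1 + 4 * zNormSq p))⁻¹

theorem siegelScale_pos (p : CSpace (n + 1)) : 0 < siegelScale p := by
  have := zNormSq_nonneg p
  unfold siegelScale
  positivity

theorem siegelScale_sq_mul (p : CSpace (n + 1)) : siegelScale p ^ 2 * (1 + 4 * zNormSq p) = 1 := by
  have := zNormSq_nonneg p
  rw [siegelScale, inv_pow, Real.sq_sqrt (by positivity), inv_mul_cancel₀ (by positivity)]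

theorem siegelScale_le_one (p : CSpace (n + 1)) : siegelScale p ≤ 1 := by
  have := zNormSq_nonneg p
  have := siegelScale_sq_mul p
  have := siegelScale_pos p
  nlinarith [mul_nonneg (sq_nonneg (siegelScale p)) (zNormSq_nonneg p)]

theorem hasFDerivAt_siegelScale (p : CSpace (n + 1)) :
    HasFDerivAt siegelScale ((-4 * siegelScale p ^ 3) • innerSL ℝ (zPart n p)) p := by
  have hz := zNormSq_nonneg p
  have h1 : HasDerivAt (fun s : ℝ => (√(1 + 4 * s))⁻¹)
      (-2 * siegelScale p ^ 3) (zNormSq p) := by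
    have h0 : HasDerivAt (fun s : ℝ => 1 + 4 * s) 4 (zNormSq p) := by
      simpa using ((hasDerivAt_id (zNormSq p)).const_mul 4).const_add 1
    have hne : 1 + 4 * zNormSq p ≠ 0 := by positivity
    have hs : √(1 + 4 * zNormSq p) ≠ 0 := by positivity
    refine (h0.sqrt hne).inv hs |>.congr_deriv ?_
    unfold siegelScale
    field_simp
    ring
  refine (h1.comp_hasFDerivAt p (hasFDerivAt_zNormSq p)).congr_fderiv ?_
  ext v
  simp
  ring

/-- A normalized defining function of the Siegel upper half space. -/
def siegelNormalized (p : CSpace (n + 1)) : ℝ := siegelFun p * siegelScale p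

/-- The gradient of `siegelNormalized`. -/
def siegelGrad (p : CSpace (n + 1)) : CSpace (n + 1) :=
  (2 * siegelScale p * (1 - 2 * siegelNormalized p * siegelScale p)) • zPart n p
    - siegelScale p • imVec n

theorem hasFDerivAt_siegelNormalized (p : CSpace (n + 1)) :
    HasFDerivAt siegelNormalized (innerSL ℝ (siegelGrad p)) p := by
  refine ((hasFDerivAt_siegelFun p).mul (hasFDerivAt_siegelScale p)).congr_fderiv ?_
  ext v
  simp [siegelGrad, siegelNormalized]
  ring

theorem norm_siegelGrad_sq (p : CSpace (n + 1)) :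
    ‖siegelGrad p‖ ^ 2 = (2 * siegelScale p * (1 - 2 * siegelNormalized p * siegelScale p)) ^ 2 *
      zNormSq p + siegelScale p ^ 2 := by
  rw [siegelGrad, norm_sub_sq_real, norm_smul, norm_smul, norm_imVec, mul_pow, norm_zPart_sq,
    inner_smul_left, inner_smul_right, real_inner_comm, inner_imVec, Real.norm_eq_abs, sq_abs,
    Real.norm_eq_abs, mul_one, sq_abs]
  simp

theorem continuous_siegelNormalized : Continuous (siegelNormalized (n := n)) :=
  continuous_iff_continuousAt.2 fun p => (hasFDerivAt_siegelNormalized p).continuousAt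

/-- The bounded quantities in terms of which the derivatives of `siegelNormalized` are
polynomial. -/
def siegelJet (p : CSpace (n + 1)) : ℝ × CSpace (n + 1) × ℝ :=
  (siegelScale p, siegelScale p • zPart n p, siegelNormalized p)

/-- The vector field `P` with `D siegelJet = P ∘ siegelJet`. -/
def siegelJetField (y : ℝ × CSpace (n + 1) × ℝ) :
    CSpace (n + 1) →L[ℝ] ℝ × CSpace (n + 1) × ℝ :=
  ((-4 * y.1 ^ 2) • innerSL ℝ y.2.1).prod
    ((y.1 • zPart n - (4 * y.1) • (innerSL ℝ y.2.1).smulRight y.2.1).prod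
      ((2 - 4 * y.2.2 * y.1) • innerSL ℝ y.2.1 - y.1 • innerSL ℝ (imVec n)))

/-- The system closes because ds = -4s²⟨sz, ·⟩: the unbounded z occurs only through the bounded
product sz. -/
theorem hasFDerivAt_siegelJet (p : CSpace (n + 1)) :
    HasFDerivAt siegelJet (siegelJetField (siegelJet p)) p := by
  have h1 := hasFDerivAt_siegelScale p
  have h2 := h1.smul (zPart n).hasFDerivAt
  have h3 := hasFDerivAt_siegelNormalized p
  refine (h1.prodMk (h2.prodMk h3)).congr_fderiv ?_
  ext v : 1
  refine Prod.ext ?_ (Prod.ext ?_ ?_)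
  · simp [siegelJetField, siegelJet]
    ring
  · simp [siegelJetField, siegelJet, smul_smul]
    module
  · simp [siegelJetField, siegelJet, siegelGrad]
    ring

theorem contDiff_siegelJetField : ContDiff ℝ ∞ (siegelJetField (n := n)) := by
  have h1 : ContDiff ℝ ∞ fun y : ℝ × CSpace (n + 1) × ℝ => y.1 := contDiff_fst
  have h2 : ContDiff ℝ ∞ fun y : ℝ × CSpace (n + 1) × ℝ => y.2.1 := contDiff_fst.comp contDiff_snd
  have h3 : ContDiff ℝ ∞ fun y : ℝ × CSpace (n + 1) × ℝ => y.2.2 := contDiff_snd.comp contDiff_snd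
  rw [contDiff_clm_apply_iff]
  intro v
  simp only [siegelJetField, ContinuousLinearMap.prod_apply, smul_apply,
    sub_apply, ContinuousLinearMap.smulRight_apply, innerSL_apply_apply]
  have h4 : ContDiff ℝ ∞ fun y : ℝ × CSpace (n + 1) × ℝ => inner ℝ y.2.1 v :=
    h2.inner ℝ contDiff_const
  refine ContDiff.prodMk ?_ (ContDiff.prodMk ?_ ?_)
  · exact (contDiff_const.mul (h1.pow 2)).smul h4
  · exact (h1.smul contDiff_const).sub ((contDiff_const.mul h1).smul (h4.smul h2))
  · exact ((contDiff_const.sub ((contDiff_const.mul h3).mul h1)).smul h4).sub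
      (h1.smul contDiff_const)

/-- From s²(1 + 4|z|²) = 1 one reads off s ≤ 1 and |sz| ≤ 1/2. -/
theorem siegelJet_mem_closedBall {p : CSpace (n + 1)} (hp : |siegelNormalized p| < 1 / 4) :
    siegelJet p ∈ Metric.closedBall (0 : ℝ × CSpace (n + 1) × ℝ) 1 := by
  have h0 := siegelScale_pos p
  have h1 := siegelScale_le_one p
  have h2 := siegelScale_sq_mul p
  rw [mem_closedBall_zero_iff, Prod.norm_def, Prod.norm_def]
  refine max_le ?_ (max_le ?_ ?_)
  · simpa [siegelJet, abs_of_pos h0] using h1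
  · refine abs_le_one_iff_mul_self_le_one.2 ?_ |> (le_abs_self _).trans
    rw [← pow_two]
    simp only [siegelJet, norm_smul, mul_pow, norm_zPart_sq, Real.norm_eq_abs, sq_abs]
    nlinarith [sq_nonneg (siegelScale p), mul_nonneg (sq_nonneg (siegelScale p)) (zNormSq_nonneg p)]
  · simp only [siegelJet, Real.norm_eq_abs]
    linarith

theorem siegelNormalized_eq_comp : siegelNormalized (n := n) = (fun y => y.2.2) ∘ siegelJet := rfl

theorem siegelNormalized_eq_zero_iff (p : CSpace (n + 1)) :
    siegelNormalized p = 0 ↔ p ∈ frontier (siegel n) := by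
  rw [frontier_siegel]
  simp [siegelNormalized, (siegelScale_pos p).ne']

theorem contDiff_siegelNormalized : ContDiff ℝ ∞ (siegelNormalized (n := n)) := by
  refine contDiff_siegelFun.mul ?_
  have e : (siegelScale (n := n)) = fun p => (√(1 + 4 * ‖zPart n p‖ ^ 2))⁻¹ := by
    ext p
    rw [siegelScale, norm_zPart_sq]
  rw [e]
  have h : ContDiff ℝ ∞ fun p : CSpace (n + 1) => 1 + 4 * ‖zPart n p‖ ^ 2 :=
    contDiff_const.add (contDiff_const.mul ((zPart n).contDiff.norm_sq ℝ))
  exact (h.sqrt fun p => by positivity).inv fun p => by positivity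

/-- The quadratic polynomial r is expanded about x rather than about the boundary point p. The
linear term then has size 2|z(x)| |x - p|, and the factor s(x) of the same point absorbs its growth
because 2|z|s ≤ 1. -/
theorem abs_siegelNormalized_le {p x : CSpace (n + 1)} (hp : p ∈ frontier (siegel n)) :
    |siegelNormalized x| ≤ dist p x * (2 + dist p x) := by
  have hp' : siegelFun p = 0 := by rwa [frontier_siegel] at hp
  have h0 := siegelScale_pos x
  have h1 := siegelScale_le_one x
  set d := x - p with hd
  have hx : x = p + d := by simp [hd]
  have hdist : dist p x = ‖d‖ := by rw [dist_comm, dist_eq_norm]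
  have key : siegelFun x = 2 * inner ℝ (zPart n x) d - ‖zPart n d‖ ^ 2 - (d (Fin.last n)).im := by
    have e : siegelFun p = siegelFun (x - d) := by simp [hd]
    have e1 : inner ℝ (zPart n x) d = inner ℝ (zPart n x) (zPart n d) := (inner_zPart_zPart _ _).symm
    have e2 : siegelFun (x - d) = siegelFun x -
        (2 * inner ℝ (zPart n x) (zPart n d) - ‖zPart n d‖ ^ 2 - (d (Fin.last n)).im) := by
      simp only [siegelFun, ← norm_zPart_sq, map_sub, norm_sub_sq_real, PiLp.sub_apply,
        Complex.sub_im]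
      ring
    rw [e1]
    linarith
  have hz : ‖zPart n d‖ ≤ ‖d‖ := by
    refine le_of_sq_le_sq ?_ (norm_nonneg _)
    rw [norm_zPart_sq, EuclideanSpace.norm_sq_eq, Fin.sum_univ_castSucc, zNormSq]
    simp
  have him : |(d (Fin.last n)).im| ≤ ‖d‖ :=
    (Complex.abs_im_le_norm _).trans (PiLp.norm_apply_le d _)
  have hin : |inner ℝ (zPart n x) d| ≤ ‖zPart n x‖ * ‖d‖ := abs_real_inner_le_norm _ _
  have hzx : 2 * ‖zPart n x‖ * siegelScale x ≤ 1 := by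
    refine abs_le_one_iff_mul_self_le_one.2 ?_ |> (le_abs_self _).trans
    have := siegelScale_sq_mul x
    rw [← norm_zPart_sq] at this
    nlinarith [sq_nonneg (siegelScale x)]
  have hd0 := norm_nonneg d
  rw [hdist, siegelNormalized, abs_mul, abs_of_pos h0]
  have hr : |siegelFun x| ≤ 2 * (‖zPart n x‖ * ‖d‖) + ‖d‖ ^ 2 + ‖d‖ := by
    rw [key]
    have h2 : ‖zPart n d‖ ^ 2 ≤ ‖d‖ ^ 2 := by gcongr
    have h3 := abs_le.1 hin
    have h4 := abs_le.1 him
    have h5 := sq_nonneg ‖zPart n d‖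
    rw [abs_le]
    constructor <;> linarith
  calc |siegelFun x| * siegelScale x
      ≤ (2 * (‖zPart n x‖ * ‖d‖) + ‖d‖ ^ 2 + ‖d‖) * siegelScale x := by gcongr
    _ = (2 * ‖zPart n x‖ * siegelScale x) * ‖d‖ + (‖d‖ ^ 2 + ‖d‖) * siegelScale x := by ring
    _ ≤ 1 * ‖d‖ + (‖d‖ ^ 2 + ‖d‖) * 1 := by gcongr
    _ = ‖d‖ * (2 + ‖d‖) := by ring

theorem fderiv_siegelNormalized_norm (p : CSpace (n + 1)) :
    ‖fderiv ℝ siegelNormalized p‖ = ‖siegelGrad p‖ := by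
  rw [(hasFDerivAt_siegelNormalized p).fderiv, innerSL_apply_norm]

theorem isNormalizedOn_siegelNormalized : IsNormalizedOn (siegel n) siegelNormalized := by
  intro p hp
  have h := (siegelNormalized_eq_zero_iff p).2 hp
  have h2 := norm_siegelGrad_sq p
  rw [h] at h2
  rw [fderiv_siegelNormalized_norm, ← sq_eq_sq₀ (norm_nonneg _) zero_le_one, h2]
  have := siegelScale_sq_mul p
  linarith

/-- The z-part of the gradient is its boundary value times 1 - 2ρs, which is at least 1/2 here. So
|∇ρ|² ≥ (4s²|z|² + s²)/4 = 1/4. -/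
theorem half_le_norm_siegelGrad {p : CSpace (n + 1)} (hp : |siegelNormalized p| < 1 / 4) :
    1 / 2 ≤ ‖siegelGrad p‖ := by
  refine le_of_sq_le_sq ?_ (norm_nonneg _)
  rw [norm_siegelGrad_sq]
  have h0 := siegelScale_pos p
  have h1 := siegelScale_le_one p
  have h2 := siegelScale_sq_mul p
  have h3 := abs_lt.1 hp
  have h4 : 1 / 2 ≤ 1 - 2 * siegelNormalized p * siegelScale p := by nlinarith
  have h5 : 1 / 4 ≤ (1 - 2 * siegelNormalized p * siegelScale p) ^ 2 := by nlinarith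
  have h6 : 0 ≤ siegelScale p ^ 2 * zNormSq p := mul_nonneg (sq_nonneg _) (zNormSq_nonneg p)
  have h7 : (2 * siegelScale p * (1 - 2 * siegelNormalized p * siegelScale p)) ^ 2 * zNormSq p =
    4 * (siegelScale p ^ 2 * zNormSq p) * (1 - 2 * siegelNormalized p * siegelScale p) ^ 2 := by ring
  rw [h7]
  nlinarith [sq_nonneg (siegelScale p)]

theorem isUniformlySmoothDefiningFunction_siegelNormalized :
    IsUniformlySmoothDefiningFunction (siegel n) {p | |siegelNormalized p| < 1 / 4}
      siegelNormalized := by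
  have hU : IsOpen {p : CSpace (n + 1) | |siegelNormalized p| < 1 / 4} :=
    isOpen_lt continuous_siegelNormalized.abs continuous_const
  have hfr : frontier (siegel n) ⊆ {p : CSpace (n + 1) | |siegelNormalized p| < 1 / 4} := by
    intro p hp
    simp [(siegelNormalized_eq_zero_iff p).2 hp]
  intro m
  refine ⟨⟨hU, hfr, ?_, ?_, ?_⟩, ?_, ?_, ?_⟩
  · exact (contDiff_siegelNormalized.of_le (by exact_mod_cast le_top)).contDiffOn
  · intro x _
    rw [mem_siegel_iff, siegelNormalized]
    constructor
    · exact fun h => mul_neg_of_neg_of_pos h (siegelScale_pos x)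
    · intro h
      by_contra h'
      exact absurd h (not_lt.2 (mul_nonneg (not_lt.1 h') (siegelScale_pos x).le))
  · intro p hp h
    have := isNormalizedOn_siegelNormalized p hp
    rw [h] at this
    simp at this
  -- On the boundary of U one has |ρ| ≥ 1/4, whereas d(2 + d) < 1/4 for d < 1/10.
  · refine ⟨1 / 10, by norm_num, fun p hp x hx => ?_⟩
    rw [hU.frontier_eq] at hx
    have h1 : 1 / 4 ≤ |siegelNormalized x| := not_lt.1 hx.2
    have h2 := abs_siegelNormalized_le (x := x) hp
    by_contra h3
    have := dist_nonneg (x := p) (y := x)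
    nlinarith
  · intro k _
    rw [siegelNormalized_eq_comp]
    exact exists_bound_iteratedFDeriv_comp hU (isCompact_closedBall _ _)
      (fun x hx => siegelJet_mem_closedBall hx) contDiff_siegelJetField
      (fun x _ => hasFDerivAt_siegelJet x) k _ (contDiff_snd.comp contDiff_snd)
  · refine ⟨1 / 2, by norm_num, fun x hx => ?_⟩
    rw [fderiv_siegelNormalized_norm]
    exact half_le_norm_siegelGrad hx

end NormalizedDefiningFunction

/-! ### Complex Hessian and T^{1,0} in terms of real derivatives -/

section ComplexHessian

variable {N : ℕ}

theorem eq_sum_smul_single (L : CSpace N) :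
    L = ∑ j, L j • EuclideanSpace.single j (1 : ℂ) := by
  simpa using ((EuclideanSpace.basisFun (Fin N) ℂ).sum_repr L).symm

theorem I_smul_single (j : Fin N) :
    Complex.I • EuclideanSpace.single j (1 : ℂ) = EuclideanSpace.single j Complex.I := by
  ext i
  simp

theorem complex_smul_eq (c : ℂ) (L : CSpace N) : c • L = c.re • L + c.im • (Complex.I • L) := by
  ext i
  simp only [PiLp.smul_apply, PiLp.add_apply, smul_eq_mul, Complex.real_smul]
  conv_lhs => rw [← Complex.re_add_im c]
  ring

/-- The `ℂ`-linear functional `L ↦ (D L - i D(iL)) / 2` attached to a real-linear `D`. -/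
def complexPart (D : CSpace N →L[ℝ] ℝ) : CSpace N →ₗ[ℂ] ℂ where
  toFun L := (1 / 2) * ((D L : ℂ) - Complex.I * (D (Complex.I • L) : ℂ))
  map_add' L M := by
    simp only [smul_add, map_add]
    push_cast
    ring
  map_smul' c L := by
    rw [smul_comm Complex.I c L, complex_smul_eq c L, complex_smul_eq c (Complex.I • L), smul_smul,
      Complex.I_mul_I]
    simp only [map_add, map_smul, neg_smul, one_smul, map_neg, smul_eq_mul, RingHom.id_apply]
    push_cast
    conv_rhs => rw [← Complex.re_add_im c]
    ring_nf
    simp only [Complex.I_sq]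
    ring

/-- The sesquilinear form attached to a real-bilinear form `B`. -/
def sesquiPart (B : CSpace N →L[ℝ] CSpace N →L[ℝ] ℝ) : CSpace N →ₗ[ℂ] CSpace N →ₗ⋆[ℂ] ℂ :=
  LinearMap.mk₂'ₛₗ _ _
    (fun L M => (1 / 4) * ((B L M : ℂ) + (B (Complex.I • L) (Complex.I • M) : ℂ)
      + Complex.I * (B L (Complex.I • M) : ℂ) - Complex.I * (B (Complex.I • L) M : ℂ)))
    (fun L L' M => by
      simp only [smul_add, map_add, add_apply]
      push_cast
      ring)
    (fun c L M => by
      rw [smul_comm Complex.I c L, complex_smul_eq c L, complex_smul_eq c (Complex.I • L), smul_smul,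
        Complex.I_mul_I]
      simp only [map_add, map_smul, neg_smul, one_smul, map_neg, smul_eq_mul, RingHom.id_apply,
        add_apply, smul_apply, neg_apply]
      push_cast
      conv_rhs => rw [← Complex.re_add_im c]
      ring_nf
      simp only [Complex.I_sq]
      ring)
    (fun L M M' => by
      simp only [smul_add, map_add]
      push_cast
      ring)
    (fun c L M => by
      rw [smul_comm Complex.I c M, complex_smul_eq c M, complex_smul_eq c (Complex.I • M), smul_smul,
        Complex.I_mul_I]
      have hc : conj c = (c.re : ℂ) - c.im * Complex.I := by
        apply Complex.ext <;> simp
      simp only [map_add, map_smul, neg_smul, one_smul, map_neg, smul_eq_mul]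
      rw [hc]
      push_cast
      ring_nf
      simp only [Complex.I_sq]
      ring)

theorem sesquiPart_apply (B : CSpace N →L[ℝ] CSpace N →L[ℝ] ℝ) (L M : CSpace N) :
    sesquiPart B L M = (1 / 4) * ((B L M : ℂ) + (B (Complex.I • L) (Complex.I • M) : ℂ)
      + Complex.I * (B L (Complex.I • M) : ℂ) - Complex.I * (B (Complex.I • L) M : ℂ)) := rfl

theorem fderiv_ofReal_apply {ρ : CSpace N → ℝ} {p : CSpace N} (h : DifferentiableAt ℝ ρ p)
    (v : CSpace N) : fderiv ℝ (fun x => (ρ x : ℂ)) p v = (fderiv ℝ ρ p v : ℂ) := by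
  have : HasFDerivAt (fun x => (ρ x : ℂ)) (Complex.ofRealCLM.comp (fderiv ℝ ρ p)) p :=
    Complex.ofRealCLM.hasFDerivAt.comp p h.hasFDerivAt
  rw [this.fderiv]
  simp

/-- ∂ρ is the complex-linear part of dρ; its real and imaginary parts at L are dρ(L)/2 and
-dρ(iL)/2. So T^{1,0} is the maximal complex subspace of the real tangent space. -/
theorem mem_tangent10_iff {ρ : CSpace N → ℝ} {p : CSpace N} (h : DifferentiableAt ℝ ρ p)
    (L : CSpace N) :
    L ∈ tangent10 ρ p ↔ fderiv ℝ ρ p L = 0 ∧ fderiv ℝ ρ p (Complex.I • L) = 0 := by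
  have e : ∑ j, dz j (fun x => (ρ x : ℂ)) p * L j = complexPart (fderiv ℝ ρ p) L := by
    conv_rhs => rw [eq_sum_smul_single L]
    rw [map_sum]
    refine Finset.sum_congr rfl fun j _ => ?_
    rw [map_smul, smul_eq_mul, mul_comm]
    congr 1
    simp only [dz, fderiv_ofReal_apply h, complexPart, LinearMap.coe_mk, AddHom.coe_mk,
      I_smul_single]
  rw [tangent10, Set.mem_ofPred_eq, e]
  simp only [complexPart, LinearMap.coe_mk, AddHom.coe_mk]
  constructor
  · intro h0
    have h1 := congrArg Complex.re h0
    have h2 := congrArg Complex.im h0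
    simp at h1 h2
    exact ⟨h1, h2⟩
  · rintro ⟨h1, h2⟩
    simp [h1, h2]

/-- Both sides are sesquilinear, so it suffices to compare them on coordinate vectors. -/
theorem leviForm_eq {ρ : CSpace N → ℝ} {p : CSpace N} (h : ContDiffAt ℝ 2 ρ p) (L M : CSpace N) :
    leviForm ρ p L M = sesquiPart (fderiv ℝ (fderiv ℝ ρ) p) L M := by
  have hd : DifferentiableAt ℝ (fderiv ℝ ρ) p :=
    (h.fderiv_right (m := 1) (by norm_num)).differentiableAt (by norm_num)
  have key : ∀ j k, dz j (dzbar k (fun x => (ρ x : ℂ))) p =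
      sesquiPart (fderiv ℝ (fderiv ℝ ρ) p) (EuclideanSpace.single j 1)
        (EuclideanSpace.single k 1) := by
    intro j k
    have he : dzbar k (fun x => (ρ x : ℂ)) =ᶠ[𝓝 p] fun x => (1 / 2) *
        ((fderiv ℝ ρ x (EuclideanSpace.single k 1) : ℂ)
          + Complex.I * (fderiv ℝ ρ x (EuclideanSpace.single k Complex.I) : ℂ)) := by
      filter_upwards [h.eventually (by simp)] with x hx
      have hx' : DifferentiableAt ℝ ρ x := hx.differentiableAt (by norm_num)
      simp only [dzbar, fderiv_ofReal_apply hx']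
    have hv : ∀ v : CSpace N, HasFDerivAt (fun x => (fderiv ℝ ρ x v : ℂ))
        (Complex.ofRealCLM.comp ((fderiv ℝ (fderiv ℝ ρ) p).flip v)) p := by
      intro v
      refine Complex.ofRealCLM.hasFDerivAt.comp p ?_
      refine (hd.hasFDerivAt.clm_apply (hasFDerivAt_const v p)).congr_fderiv ?_
      ext w
      simp
    have hD := ((hv (EuclideanSpace.single k 1)).add
      ((hv (EuclideanSpace.single k Complex.I)).const_mul Complex.I)).const_mul (1 / 2 : ℂ)
    have hD' := hD.congr_of_eventuallyEq he
    simp only [dz, hD'.fderiv, sesquiPart_apply, I_smul_single]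
    simp
    ring_nf
    simp only [Complex.I_sq]
    ring
  simp only [leviForm, key]
  conv_rhs => rw [eq_sum_smul_single L, eq_sum_smul_single M]
  simp only [map_sum, LinearMap.sum_apply, map_smul, LinearMap.smul_apply, LinearMap.map_smulₛₗ,
    smul_eq_mul]
  rw [Finset.sum_comm]
  simp only [Finset.mul_sum]
  refine Finset.sum_congr rfl fun j _ => Finset.sum_congr rfl fun k _ => ?_
  ring

end ComplexHessian

/-! ### The Levi form of an arbitrary normalized C² defining function -/

section BoundaryJets

variable {n : ℕ} {U : Set (CSpace (n + 1))} {ρ : CSpace (n + 1) → ℝ}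

theorem IsDefiningFunction.contDiffAt {N : ℕ} {m : WithTop ℕ∞} {Ω U : Set (CSpace N)}
    {ρ : CSpace N → ℝ} (h : IsDefiningFunction m Ω U ρ) {p : CSpace N} (hp : p ∈ frontier Ω) :
    ContDiffAt ℝ m ρ p :=
  h.contDiffOn.contDiffAt (h.isOpen.mem_nhds (h.frontier_subset hp))

theorem IsDefiningFunction.eq_zero {N : ℕ} {m : WithTop ℕ∞} {Ω U : Set (CSpace N)}
    {ρ : CSpace N → ℝ} (h : IsDefiningFunction m Ω U ρ) (hΩ : IsOpen Ω) {p : CSpace N}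
    (hp : p ∈ frontier Ω) : ρ p = 0 := by
  have hpU := h.frontier_subset hp
  rw [hΩ.frontier_eq] at hp
  refine le_antisymm ?_ (not_lt.1 fun hlt => hp.2 ((h.mem_iff p hpU).2 hlt))
  have hc : ContinuousAt ρ p :=
    (h.contDiffOn.contDiffAt (h.isOpen.mem_nhds hpU)).continuousAt
  refine le_of_tendsto_of_frequently hc ?_
  have hfr : ∃ᶠ x in 𝓝 p, x ∈ Ω := mem_closure_iff_frequently.1 hp.1
  refine (hfr.and_eventually (h.isOpen.mem_nhds hpU)).mono ?_
  rintro x ⟨h1, h2⟩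
  exact ((h.mem_iff x h2).1 h1).le

/-- The differential of `siegelFun`. -/
def siegelDiff (p v : CSpace (n + 1)) : ℝ := 2 * inner ℝ (zPart n p) v - (v (Fin.last n)).im

theorem siegelFun_add (p v : CSpace (n + 1)) :
    siegelFun (p + v) = siegelFun p + siegelDiff p v + zNormSq v := by
  simp only [siegelFun, siegelDiff, ← norm_zPart_sq, map_add, norm_add_sq_real, PiLp.add_apply,
    Complex.add_im, inner_zPart_zPart]
  ring

theorem zNormSq_smul (s : ℝ) (v : CSpace (n + 1)) : zNormSq (s • v) = s ^ 2 * zNormSq v := by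
  rw [← norm_zPart_sq, ← norm_zPart_sq, map_smul, norm_smul, mul_pow, Real.norm_eq_abs, sq_abs]

theorem siegelDiff_smul (p v : CSpace (n + 1)) (s : ℝ) :
    siegelDiff p (s • v) = s * siegelDiff p v := by
  simp [siegelDiff, inner_smul_right]
  ring

theorem siegelDiff_add (p v w : CSpace (n + 1)) :
    siegelDiff p (v + w) = siegelDiff p v + siegelDiff p w := by
  simp [siegelDiff, inner_add_right]
  ring

theorem siegelDiff_imVec (p : CSpace (n + 1)) : siegelDiff p (imVec n) = -1 := by
  simp [siegelDiff, real_inner_comm, inner_imVec]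

/-- Evaluating dρ(γ'(s)) = 0 and its derivative at s = 0, along a curve γ in the boundary, gives
both claims. This uses only ρ = 0 on the boundary, so no factorization of ρ through r, whose
quotient need not be C², is required. -/
theorem fderiv_fderiv_tangent (h : IsDefiningFunction 2 (siegel n) U ρ) {p : CSpace (n + 1)}
    (hp : p ∈ frontier (siegel n)) {v : CSpace (n + 1)} (hv : siegelDiff p v = 0) :
    fderiv ℝ ρ p v = 0 ∧
      fderiv ℝ (fderiv ℝ ρ) p v v = -2 * zNormSq v * fderiv ℝ ρ p (imVec n) := by
  -- Since r is quadratic, raising Im w by s²|v_z|² cancels its second-order term exactly, so γ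
  -- never leaves the boundary.
  set γ : ℝ → CSpace (n + 1) := fun s => p + s • v + (s ^ 2 * zNormSq v) • imVec n with hγ
  have hp' : siegelFun p = 0 := by rwa [frontier_siegel] at hp
  have hmem : ∀ s, γ s ∈ frontier (siegel n) := by
    intro s
    rw [frontier_siegel, Set.mem_ofPred_eq, hγ]
    simp only
    rw [siegelFun_add_smul_imVec, siegelFun_add, hp', siegelDiff_smul, hv, zNormSq_smul]
    ring
  have hγ' : ∀ s, HasDerivAt γ (v + (2 * s * zNormSq v) • imVec n) s := by
    intro s
    have h1 : HasDerivAt (fun s : ℝ => p + s • v) v s := by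
      simpa using ((hasDerivAt_id s).smul_const v).const_add p
    have h2 : HasDerivAt (fun s : ℝ => s ^ 2 * zNormSq v) (2 * s * zNormSq v) s := by
      simpa using (hasDerivAt_pow 2 s).mul_const (zNormSq v)
    exact h1.add (h2.smul_const _)
  have hzero : ∀ s, fderiv ℝ ρ (γ s) (v + (2 * s * zNormSq v) • imVec n) = 0 := by
    intro s
    have h1 := ((h.contDiffAt (hmem s)).differentiableAt (by norm_num)).hasFDerivAt.comp_hasDerivAt
      s (hγ' s)
    have h2 : ρ ∘ γ = fun _ => 0 := funext fun s => h.eq_zero isOpen_siegel (hmem s)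
    rw [h2] at h1
    exact h1.unique (hasDerivAt_const s 0)
  have hγ0 : γ 0 = p := by simp [hγ]
  have h0 := hzero 0
  rw [hγ0] at h0
  simp only [mul_zero, zero_mul, zero_smul, add_zero] at h0
  refine ⟨h0, ?_⟩
  have hd : DifferentiableAt ℝ (fderiv ℝ ρ) (γ 0) := by
    rw [hγ0]
    exact ((h.contDiffAt hp).fderiv_right (m := 1) (by norm_num)).differentiableAt (by norm_num)
  have h3 := hd.hasFDerivAt.comp_hasDerivAt 0 (hγ' 0)
  have h4 : HasDerivAt (fun s : ℝ => v + (2 * s * zNormSq v) • imVec n)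
      ((2 * zNormSq v) • imVec n) 0 := by
    have : HasDerivAt (fun s : ℝ => 2 * s * zNormSq v) (2 * zNormSq v) 0 := by
      simpa using ((hasDerivAt_id (0 : ℝ)).const_mul 2).mul_const (zNormSq v)
    simpa using (this.smul_const (imVec n)).const_add v
  have h5 := h3.clm_apply h4
  have h6 : (fun s => (fderiv ℝ ρ ∘ γ) s (v + (2 * s * zNormSq v) • imVec n)) = fun _ => 0 :=
    funext hzero
  rw [h6] at h5
  have h7 := h5.unique (hasDerivAt_const 0 0)
  simp only [Function.comp, hγ0, mul_zero, zero_mul, zero_smul, add_zero, map_smul,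
    smul_eq_mul] at h7
  linarith

/-- dρ vanishes on the kernel of dr, hence is a multiple of it. Normalization fixes the modulus of
the factor, and negativity of ρ inside the domain fixes its sign. -/
theorem fderiv_eq_siegelScale_mul (h : IsDefiningFunction 2 (siegel n) U ρ)
    (hn : IsNormalizedOn (siegel n) ρ) {p : CSpace (n + 1)} (hp : p ∈ frontier (siegel n))
    (v : CSpace (n + 1)) : fderiv ℝ ρ p v = siegelScale p * siegelDiff p v := by
  have hp' : siegelFun p = 0 := by rwa [frontier_siegel] at hp
  set c := -fderiv ℝ ρ p (imVec n) with hc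
  have h1 : ∀ v, fderiv ℝ ρ p v = c * siegelDiff p v := by
    intro v
    -- Projection to the tangent space along `imVec`, on which dr equals -1.
    have ht : siegelDiff p (v + siegelDiff p v • imVec n) = 0 := by
      rw [siegelDiff_add, siegelDiff_smul, siegelDiff_imVec]
      ring
    have := (fderiv_fderiv_tangent h hp ht).1
    rw [map_add, map_smul, smul_eq_mul] at this
    rw [hc]
    linarith
  have hclm : fderiv ℝ ρ p = c • innerSL ℝ ((2 : ℝ) • zPart n p - imVec n) := by
    ext v
    rw [h1 v]
    simp [siegelDiff, inner_imVec]
  have hnorm : ‖(2 : ℝ) • zPart n p - imVec n‖ ^ 2 = 1 + 4 * zNormSq p := by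
    rw [norm_sub_sq_real, norm_smul, mul_pow, norm_zPart_sq, norm_imVec, inner_smul_left,
      real_inner_comm, inner_imVec]
    simp
    ring
  have hcn : |c| * ‖(2 : ℝ) • zPart n p - imVec n‖ = 1 := by
    have := hn p hp
    rwa [hclm, norm_smul, innerSL_apply_norm, Real.norm_eq_abs] at this
  have hc0 : 0 ≤ c := by
    have hder : HasDerivAt (fun s : ℝ => ρ (p + s • imVec n)) (fderiv ℝ ρ p (imVec n)) 0 := by
      have h2 : HasDerivAt (fun s : ℝ => p + s • imVec n) (imVec n) 0 := by
        simpa using ((hasDerivAt_id (0 : ℝ)).smul_const (imVec n)).const_add p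
      have h3 := ((h.contDiffAt hp).differentiableAt (by norm_num)).hasFDerivAt
      have h4 : p = p + (0 : ℝ) • imVec n := by simp
      rw [h4] at h3
      have h5 := h3.comp_hasDerivAt (0 : ℝ) h2
      rw [← h4] at h5
      exact h5
    have hU : ∀ᶠ s : ℝ in 𝓝 0, p + s • imVec n ∈ U := by
      have : ContinuousAt (fun s : ℝ => p + s • imVec n) 0 := by fun_prop
      refine this.eventually (h.isOpen.mem_nhds ?_)
      simpa using h.frontier_subset hp
    rw [hc, Left.nonneg_neg_iff]
    have htend := (hasDerivAt_iff_tendsto_slope.1 hder).mono_left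
      (nhdsWithin_mono 0 (fun s (hs : s ∈ Set.Ioi (0 : ℝ)) => hs.ne'))
    refine le_of_tendsto htend ?_
    filter_upwards [self_mem_nhdsWithin, nhdsWithin_le_nhds hU] with s hs hsU
    have hs0 : 0 < s := hs
    have hneg : ρ (p + s • imVec n) < 0 := by
      rw [← h.mem_iff _ hsU, mem_siegel_iff, siegelFun_add_smul_imVec, hp']
      linarith
    rw [slope_def_field]
    simp only [zero_smul, add_zero, sub_zero, h.eq_zero isOpen_siegel hp]
    exact div_nonpos_of_nonpos_of_nonneg hneg.le hs0.le
  have hfin : c = siegelScale p := by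
    rw [abs_of_nonneg hc0] at hcn
    rw [siegelScale, ← hnorm, Real.sqrt_sq (norm_nonneg _)]
    exact eq_inv_of_mul_eq_one_left hcn
  rw [h1, hfin]

/-- Polarization of the diagonal values; the mixed terms agree by symmetry of the second derivative.
-/
theorem fderiv_fderiv_eq (h : IsDefiningFunction 2 (siegel n) U ρ)
    (hn : IsNormalizedOn (siegel n) ρ) {p : CSpace (n + 1)} (hp : p ∈ frontier (siegel n))
    {v w : CSpace (n + 1)} (hv : siegelDiff p v = 0) (hw : siegelDiff p w = 0) :
    fderiv ℝ (fderiv ℝ ρ) p v w = 2 * siegelScale p * inner ℝ (zPart n v) w := by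
  have hsymm : fderiv ℝ (fderiv ℝ ρ) p v w = fderiv ℝ (fderiv ℝ ρ) p w v :=
    (h.contDiffAt hp).isSymmSndFDerivAt (by simp) v w
  have hvw : siegelDiff p (v + w) = 0 := by rw [siegelDiff_add, hv, hw, add_zero]
  have e1 := (fderiv_fderiv_tangent h hp hv).2
  have e2 := (fderiv_fderiv_tangent h hp hw).2
  have e3 := (fderiv_fderiv_tangent h hp hvw).2
  rw [fderiv_eq_siegelScale_mul h hn hp, siegelDiff_imVec] at e1 e2 e3
  simp only [map_add, add_apply] at e3
  rw [← norm_zPart_sq, map_add, norm_add_sq_real, inner_zPart_zPart] at e3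
  rw [← norm_zPart_sq] at e1 e2
  linarith

theorem leviForm_eq_siegelScale (h : IsDefiningFunction 2 (siegel n) U ρ)
    (hn : IsNormalizedOn (siegel n) ρ) {p : CSpace (n + 1)} (hp : p ∈ frontier (siegel n))
    {L M : CSpace (n + 1)} (hL : L ∈ tangent10 ρ p) (hM : M ∈ tangent10 ρ p) :
    leviForm ρ p L M = siegelScale p * ∑ i : Fin n, L i.castSucc * conj (M i.castSucc) := by
  have hd : DifferentiableAt ℝ ρ p := (h.contDiffAt hp).differentiableAt (by norm_num)
  have hs := (siegelScale_pos p).ne'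
  have ht : ∀ v, fderiv ℝ ρ p v = 0 ↔ siegelDiff p v = 0 := by
    intro v
    rw [fderiv_eq_siegelScale_mul h hn hp]
    simp [hs]
  rw [mem_tangent10_iff hd, ht, ht] at hL hM
  rw [leviForm_eq (h.contDiffAt hp), sesquiPart_apply, fderiv_fderiv_eq h hn hp hL.1 hM.1,
    fderiv_fderiv_eq h hn hp hL.1 hM.2, fderiv_fderiv_eq h hn hp hL.2 hM.1,
    fderiv_fderiv_eq h hn hp hL.2 hM.2]
  simp only [inner_zPart_left, Complex.ofReal_mul, Complex.ofReal_sum, Finset.mul_sum]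
  simp only [← Finset.sum_add_distrib, ← Finset.sum_sub_distrib, Finset.mul_sum]
  refine Finset.sum_congr rfl fun i _ => ?_
  apply Complex.ext <;> simp [Complex.inner] <;> ring

theorem mem_tangent10_siegel_iff (h : IsDefiningFunction 2 (siegel n) U ρ)
    (hn : IsNormalizedOn (siegel n) ρ) {p : CSpace (n + 1)} (hp : p ∈ frontier (siegel n))
    (L : CSpace (n + 1)) :
    L ∈ tangent10 ρ p ↔
      L (Fin.last n) = 2 * Complex.I * ∑ i : Fin n, conj (p i.castSucc) * L i.castSucc := by
  have hd : DifferentiableAt ℝ ρ p := (h.contDiffAt hp).differentiableAt (by norm_num)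
  have hs := (siegelScale_pos p).ne'
  rw [mem_tangent10_iff hd, fderiv_eq_siegelScale_mul h hn hp, fderiv_eq_siegelScale_mul h hn hp]
  have e1 : inner ℝ (zPart n p) L = (∑ i : Fin n, conj (p i.castSucc) * L i.castSucc).re := by
    rw [inner_zPart_left, Complex.re_sum]
    refine Finset.sum_congr rfl fun i _ => ?_
    simp [Complex.inner]
    ring
  have e2 : inner ℝ (zPart n p) (Complex.I • L) =
      -(∑ i : Fin n, conj (p i.castSucc) * L i.castSucc).im := by
    rw [inner_zPart_left, Complex.im_sum, ← Finset.sum_neg_distrib]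
    refine Finset.sum_congr rfl fun i _ => ?_
    simp [Complex.inner]
    ring
  simp only [siegelDiff, e1, e2, mul_eq_zero, hs, false_or]
  generalize (∑ i : Fin n, conj (p i.castSucc) * L i.castSucc) = σ
  rw [Complex.ext_iff]
  simp
  constructor
  · rintro ⟨h1, h2⟩
    constructor <;> linarith
  · rintro ⟨h1, h2⟩
    constructor <;> linarith

/-- T^{1,0} is parametrized by the z-components a, the last component being 2i⟨a,z⟩. Its
contribution to the inner product is the rank-one term 4⟨a,z⟩⟨z,b⟩, while the Levi form is s⟨a,b⟩.
-/
theorem mem_leviEigenvalues_siegel_iff (h : IsDefiningFunction 2 (siegel n) U ρ)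
    (hn : IsNormalizedOn (siegel n) ρ) {p : CSpace (n + 1)} (hp : p ∈ frontier (siegel n)) (μ : ℝ) :
    μ ∈ leviEigenvalues ρ p ↔ ∃ a : Fin n → ℂ, a ≠ 0 ∧ ∀ i, (siegelScale p : ℂ) * a i =
      μ * (a i + 4 * (∑ j : Fin n, conj (p j.castSucc) * a j) * p i.castSucc) := by
  have hT := mem_tangent10_siegel_iff h hn hp
  have hinner : ∀ L ∈ tangent10 ρ p, ∀ M ∈ tangent10 ρ p, inner ℂ M L =
      ∑ i : Fin n, (L i.castSucc + 4 * (∑ j : Fin n, conj (p j.castSucc) * L j.castSucc) *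
        p i.castSucc) * conj (M i.castSucc) := by
    intro L hL M hM
    rw [hT] at hL hM
    rw [PiLp.inner_apply, Fin.sum_univ_castSucc, hL, hM]
    simp only [RCLike.inner_apply, add_mul, Finset.sum_add_distrib]
    congr 1
    simp only [map_mul, map_sum, Complex.conj_I, Complex.conj_conj, map_ofNat]
    have : ∀ x y : ℂ, 2 * Complex.I * x * (2 * -Complex.I * y) = 4 * x * y := by
      intro x y
      ring_nf
      simp only [Complex.I_sq]
      ring
    rw [this, Finset.mul_sum]
    refine Finset.sum_congr rfl fun i _ => ?_
    ring
  constructor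
  · rintro ⟨L, hL, hL0, hLM⟩
    refine ⟨fun i => L i.castSucc, ?_, fun i => ?_⟩
    · intro h0
      apply hL0
      have h0' : ∀ i : Fin n, L i.castSucc = 0 := fun i => congrFun h0 i
      ext i
      refine Fin.lastCases ?_ (fun i => ?_) i
      · rw [(hT L).1 hL]
        simp [h0']
      · simp [h0']
    -- The tangent vector whose z-part is the i-th unit vector extracts the i-th equation.
    · set M : CSpace (n + 1) := WithLp.toLp 2 (Fin.snoc (α := fun _ => ℂ) (Pi.single i (1 : ℂ))
        (2 * Complex.I * ∑ j : Fin n, conj (p j.castSucc) * (Pi.single i (1 : ℂ) : Fin n → ℂ) j))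
        with hMdef
      have hMc : ∀ j : Fin n, M j.castSucc = (Pi.single i (1 : ℂ) : Fin n → ℂ) j := by
        intro j
        simp [hMdef]
      have hM : M ∈ tangent10 ρ p := by
        rw [hT]
        simp only [hMc]
        simp [hMdef]
      have := hLM M hM
      rw [leviForm_eq_siegelScale h hn hp hL hM, hinner L hL M hM] at this
      simp only [hMc, Pi.single_apply] at this
      simpa using this
  · rintro ⟨a, ha0, ha⟩
    set L : CSpace (n + 1) := WithLp.toLp 2 (Fin.snoc (α := fun _ => ℂ) a
        (2 * Complex.I * ∑ j : Fin n, conj (p j.castSucc) * a j)) with hLdef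
    have hLc : ∀ j : Fin n, L j.castSucc = a j := by
      intro j
      simp [hLdef]
    have hL : L ∈ tangent10 ρ p := by
      rw [hT]
      simp only [hLc]
      simp [hLdef]
    refine ⟨L, hL, ?_, fun M hM => ?_⟩
    · intro h0
      apply ha0
      funext i
      rw [← hLc, h0]
      simp
    · rw [leviForm_eq_siegelScale h hn hp hL hM, hinner L hL M hM, Finset.mul_sum, Finset.mul_sum]
      refine Finset.sum_congr rfl fun i _ => ?_
      simp only [hLc]
      rw [← mul_assoc, ha i, mul_assoc]

theorem siegelScale_eq_rpow (p : CSpace (n + 1)) :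
    (1 + 4 * zNormSq p) ^ (-(1 / 2) : ℝ) = siegelScale p := by
  have := zNormSq_nonneg p
  rw [Real.rpow_neg (by positivity), ← Real.sqrt_eq_rpow, siegelScale]

theorem siegelScale_cube_eq_rpow (p : CSpace (n + 1)) :
    (1 + 4 * zNormSq p) ^ (-(3 / 2) : ℝ) = siegelScale p ^ 3 := by
  have := zNormSq_nonneg p
  rw [← siegelScale_eq_rpow, ← Real.rpow_natCast, ← Real.rpow_mul (by positivity)]
  norm_num

/-- Spectrum of a rank-one perturbation of the identity: the hyperplane z^⊥ and the line of z. If n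
= 1, an eigenvector orthogonal to z exists only at z = 0, where s = s³ = 1. -/
theorem leviEigenvalues_siegel (hn1 : 1 ≤ n) (h : IsDefiningFunction 2 (siegel n) U ρ)
    (hn : IsNormalizedOn (siegel n) ρ) {p : CSpace (n + 1)} (hp : p ∈ frontier (siegel n)) :
    leviEigenvalues ρ p = {siegelScale p ^ 3} ∪ {μ | 2 ≤ n ∧ μ = siegelScale p} := by
  have hs := siegelScale_pos p
  have hsq := siegelScale_sq_mul p
  have hN : ∑ j : Fin n, conj (p j.castSucc) * p j.castSucc = (zNormSq p : ℂ) := by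
    rw [zNormSq, Complex.ofReal_sum]
    refine Finset.sum_congr rfl fun j _ => ?_
    rw [Complex.conj_mul']
    push_cast
    rfl
  have hsq' : (siegelScale p : ℂ) ^ 2 * (1 + 4 * zNormSq p) = 1 := by exact_mod_cast hsq
  have hs' : (siegelScale p : ℂ) ≠ 0 := by exact_mod_cast hs.ne'
  ext μ
  rw [mem_leviEigenvalues_siegel_iff h hn hp]
  simp only [Set.mem_union, Set.mem_singleton_iff, Set.mem_ofPred_eq]
  constructor
  · rintro ⟨a, ha0, ha⟩
    set σ := ∑ j : Fin n, conj (p j.castSucc) * a j with hσ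
    by_cases hσ0 : σ = 0
    · obtain ⟨i, hi⟩ := Function.ne_iff.1 ha0
      have h1 := ha i
      rw [hσ0] at h1
      simp only [mul_zero, zero_mul, add_zero] at h1
      have h2 : μ = siegelScale p := by
        have := mul_right_cancel₀ hi h1
        exact_mod_cast this.symm
      by_cases hn2 : 2 ≤ n
      · exact Or.inr ⟨hn2, h2⟩
      · left
        obtain rfl : n = 1 := by omega
        have hz : p (Fin.castSucc 0) = 0 := by
          have : σ = conj (p (Fin.castSucc 0)) * a 0 := by simp [hσ]
          rw [hσ0] at this
          have hi' : a 0 ≠ 0 := by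
            rw [Subsingleton.elim (0 : Fin 1) i]
            exact hi
          simpa [hi'] using this.symm
        have hz0 : zNormSq p = 0 := by simp [zNormSq] at hz ⊢; exact hz
        rw [hz0] at hsq
        have : siegelScale p = 1 := by nlinarith
        rw [h2, this]
        norm_num
    · left
      -- Pairing the vector equation with z leaves a scalar equation for σ = ⟨a,z⟩.
      have h1 : (siegelScale p : ℂ) * σ = μ * (1 + 4 * zNormSq p) * σ := by
        calc (siegelScale p : ℂ) * σ
            = ∑ j : Fin n, conj (p j.castSucc) * (siegelScale p * a j) := by
              rw [hσ, Finset.mul_sum]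
              exact Finset.sum_congr rfl fun j _ => by ring
          _ = ∑ j : Fin n, (μ * (conj (p j.castSucc) * a j) +
                μ * 4 * σ * (conj (p j.castSucc) * p j.castSucc)) := by
              refine Finset.sum_congr rfl fun j _ => ?_
              rw [ha j]
              ring
          _ = μ * (1 + 4 * zNormSq p) * σ := by
              rw [Finset.sum_add_distrib, ← Finset.mul_sum, ← Finset.mul_sum, hN, ← hσ]
              ring
      have h2 := mul_right_cancel₀ hσ0 h1
      have h3 : siegelScale p = μ * (1 + 4 * zNormSq p) := by exact_mod_cast h2
      calc μ = μ * (siegelScale p ^ 2 * (1 + 4 * zNormSq p)) := by rw [hsq, mul_one]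
        _ = (μ * (1 + 4 * zNormSq p)) * siegelScale p ^ 2 := by ring
        _ = siegelScale p ^ 3 := by rw [← h3]; ring
  · rintro (rfl | ⟨hn2, rfl⟩)
    · by_cases hz : (fun j : Fin n => p j.castSucc) = 0
      · have hz' : ∀ j : Fin n, p j.castSucc = 0 := fun j => congrFun hz j
        have hz0 : zNormSq p = 0 := by simp [zNormSq, hz']
        rw [hz0] at hsq
        have h1 : siegelScale p = 1 := by nlinarith
        refine ⟨fun _ => 1, ?_, fun i => ?_⟩
        · intro h0
          have := congrFun h0 ⟨0, hn1⟩
          simp at this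
        · simp [hz', h1]
      · refine ⟨fun j => p j.castSucc, hz, fun i => ?_⟩
        rw [hN]
        push_cast
        linear_combination (-(siegelScale p : ℂ) * p i.castSucc) * hsq'
    · set i₀ : Fin n := ⟨0, by omega⟩ with hi₀
      set i₁ : Fin n := ⟨1, by omega⟩ with hi₁
      have hne : i₀ ≠ i₁ := by simp [hi₀, hi₁]
      -- A nonzero vector orthogonal to z, supported on two coordinates; this is where n ≥ 2 enters.
      obtain ⟨a, ha0, ha⟩ : ∃ a : Fin n → ℂ, a ≠ 0 ∧ ∑ j : Fin n, conj (p j.castSucc) * a j = 0 := by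
        by_cases hz : p i₀.castSucc = 0
        · refine ⟨Pi.single i₀ 1, by simp, ?_⟩
          simp [Pi.single_apply, hz]
        · refine ⟨Pi.single i₀ (conj (p i₁.castSucc)) - Pi.single i₁ (conj (p i₀.castSucc)), ?_, ?_⟩
          · intro h0
            have := congrFun h0 i₁
            simp [hne.symm] at this
            exact hz this
          · simp [Pi.single_apply, mul_sub, Finset.sum_sub_distrib]
            ring
      refine ⟨a, ha0, fun i => ?_⟩
      rw [ha]
      simp

theorem isLeast_leviEigenvalues_siegel (hn1 : 1 ≤ n) (h : IsDefiningFunction 2 (siegel n) U ρ)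
    (hn : IsNormalizedOn (siegel n) ρ) {p : CSpace (n + 1)} (hp : p ∈ frontier (siegel n)) :
    IsLeast (leviEigenvalues ρ p) (siegelScale p ^ 3) := by
  rw [leviEigenvalues_siegel hn1 h hn hp]
  refine ⟨Or.inl rfl, ?_⟩
  rintro μ (rfl | ⟨-, rfl⟩)
  · exact le_rfl
  · have h0 := siegelScale_pos p
    have h1 := siegelScale_le_one p
    exact pow_le_of_le_one h0.le h1 (by norm_num)

theorem tendsto_rpow_neg_three_halves :
    Tendsto (fun x : ℝ => (1 + 4 * x) ^ (-(3 / 2) : ℝ)) atTop (𝓝 0) :=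
  (tendsto_rpow_neg_atTop (by norm_num)).comp
    (tendsto_atTop_add_const_left _ _ (tendsto_id.const_mul_atTop (by norm_num)))

theorem strictlyPseudoconvex_siegel (hn1 : 1 ≤ n) : StrictlyPseudoconvex (siegel n) := by
  have h := (isUniformlySmoothDefiningFunction_siegelNormalized (n := n) 2).toIsDefiningFunction
  refine ⟨_, _, h, fun p hp μ hμ => ?_⟩
  have := (isLeast_leviEigenvalues_siegel hn1 h isNormalizedOn_siegelNormalized hp).2 hμ
  exact (pow_pos (siegelScale_pos p) 3).trans_le this

/-- A boundary point with prescribed `|z|²`. -/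
theorem exists_mem_frontier_zNormSq (hn1 : 1 ≤ n) {s : ℝ} (hs : 0 ≤ s) :
    ∃ p ∈ frontier (siegel n), zNormSq p = s := by
  set i₀ : Fin n := ⟨0, hn1⟩
  have hz : zNormSq (EuclideanSpace.single i₀.castSucc (√s : ℂ) + s • imVec n) = s := by
    simp only [zNormSq, PiLp.add_apply, PiLp.smul_apply, imVec_castSucc, smul_zero, add_zero]
    rw [Finset.sum_eq_single i₀]
    · simp [Real.sq_sqrt hs]
    · intro j _ hj
      simp [hj]
    · simp
  refine ⟨EuclideanSpace.single i₀.castSucc (√s : ℂ) + s • imVec n, ?_, hz⟩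
  rw [frontier_siegel, Set.mem_ofPred_eq, siegelFun, hz]
  simp [(Fin.castSucc_lt_last i₀).ne']

theorem not_uniformlyStrictlyPseudoconvex_siegel (hn1 : 1 ≤ n) :
    ¬ UniformlyStrictlyPseudoconvex (siegel n) := by
  rintro ⟨U, ρ, h, hn, lam, hlam, hall⟩
  obtain ⟨s, hs, hs0⟩ := ((tendsto_rpow_neg_three_halves.eventually_lt_const hlam).and
    (eventually_ge_atTop 0)).exists
  obtain ⟨p, hp, hps⟩ := exists_mem_frontier_zNormSq hn1 hs0
  have h1 := hall p hp _ (isLeast_leviEigenvalues_siegel hn1 h hn hp).1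
  rw [← siegelScale_cube_eq_rpow, hps] at h1
  exact lt_asymm h1 hs

theorem tendsto_sInf_leviEigenvalues_siegel (hn1 : 1 ≤ n)
    (h : IsDefiningFunction 2 (siegel n) U ρ) (hn : IsNormalizedOn (siegel n) ρ) :
    Tendsto (fun p : frontier (siegel n) => sInf (leviEigenvalues ρ p.1))
      (comap (fun p : frontier (siegel n) => zNormSq p.1) atTop) (𝓝 0) := by
  have e : (fun p : frontier (siegel n) => sInf (leviEigenvalues ρ p.1)) =
      (fun x : ℝ => (1 + 4 * x) ^ (-(3 / 2) : ℝ)) ∘ fun p : frontier (siegel n) => zNormSq p.1 := by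
    funext p
    rw [(isLeast_leviEigenvalues_siegel hn1 h hn p.2).csInf_eq, Function.comp_apply,
      siegelScale_cube_eq_rpow]
  rw [e]
  exact tendsto_rpow_neg_three_halves.comp tendsto_comap

end BoundaryJets

/-! ### Wirtinger derivatives and integration by parts -/

section WirtingerCalculus

variable {N : ℕ}

theorem HasFDerivAt.dz_eq {f : CSpace N → ℂ} {f' : CSpace N →L[ℝ] ℂ} {p : CSpace N}
    (h : HasFDerivAt f f' p) (j : Fin N) :
    dz j f p = (1 / 2) * (f' (EuclideanSpace.single j 1)
      - Complex.I * f' (EuclideanSpace.single j Complex.I)) := by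
  rw [dz, h.fderiv]

theorem HasFDerivAt.dzbar_eq {f : CSpace N → ℂ} {f' : CSpace N →L[ℝ] ℂ} {p : CSpace N}
    (h : HasFDerivAt f f' p) (j : Fin N) :
    dzbar j f p = (1 / 2) * (f' (EuclideanSpace.single j 1)
      + Complex.I * f' (EuclideanSpace.single j Complex.I)) := by
  rw [dzbar, h.fderiv]

theorem dz_mul {f g : CSpace N → ℂ} {p : CSpace N} (hf : DifferentiableAt ℝ f p)
    (hg : DifferentiableAt ℝ g p) (j : Fin N) :
    dz j (fun x => f x * g x) p = dz j f p * g p + f p * dz j g p := by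
  rw [(hf.hasFDerivAt.fun_mul hg.hasFDerivAt).dz_eq, dz, dz]
  simp
  ring

theorem dzbar_mul {f g : CSpace N → ℂ} {p : CSpace N} (hf : DifferentiableAt ℝ f p)
    (hg : DifferentiableAt ℝ g p) (j : Fin N) :
    dzbar j (fun x => f x * g x) p = dzbar j f p * g p + f p * dzbar j g p := by
  rw [(hf.hasFDerivAt.fun_mul hg.hasFDerivAt).dzbar_eq, dzbar, dzbar]
  simp
  ring

theorem dzbar_conj {f : CSpace N → ℂ} {p : CSpace N} (hf : DifferentiableAt ℝ f p) (j : Fin N) :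
    dzbar j (fun x => conj (f x)) p = conj (dz j f p) := by
  have h : HasFDerivAt (fun x => conj (f x)) ((Complex.conjCLE : ℂ →L[ℝ] ℂ).comp (fderiv ℝ f p)) p :=
    (Complex.conjCLE : ℂ →L[ℝ] ℂ).hasFDerivAt.comp p hf.hasFDerivAt
  rw [h.dzbar_eq, dz]
  simp [Complex.conj_ofNat]

theorem dz_ofReal_comp {r : CSpace N → ℝ} {p : CSpace N} (hr : DifferentiableAt ℝ r p)
    {θ : ℝ → ℝ} (hθ : DifferentiableAt ℝ θ (r p)) (j : Fin N) :
    dz j (fun x => ((θ (r x) : ℝ) : ℂ)) p = ((deriv θ (r p) : ℝ) : ℂ) * dz j (fun x => (r x : ℂ)) p := by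
  have h1 : HasFDerivAt (fun x => θ (r x)) (deriv θ (r p) • fderiv ℝ r p) p :=
    hθ.hasDerivAt.comp_hasFDerivAt p hr.hasFDerivAt
  rw [dz, dz, fderiv_ofReal_apply h1.differentiableAt, fderiv_ofReal_apply h1.differentiableAt,
    fderiv_ofReal_apply hr, fderiv_ofReal_apply hr, h1.fderiv]
  simp
  ring

theorem dzbar_weight (t : ℝ) (k : Fin N) (p : CSpace N) :
    dzbar k (fun x => ((Real.exp (-t * ‖x‖ ^ 2) : ℝ) : ℂ)) p =
      -t * p k * (Real.exp (-t * ‖p‖ ^ 2) : ℝ) := by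
  have h1 : HasFDerivAt (fun x : CSpace N => Real.exp (-t * ‖x‖ ^ 2)) _ p :=
    (((hasFDerivAt_id p).norm_sq).const_mul (-t)).exp
  rw [dzbar, fderiv_ofReal_apply h1.differentiableAt, fderiv_ofReal_apply h1.differentiableAt,
    h1.fderiv]
  have e : ∀ c : ℂ, inner ℝ p (EuclideanSpace.single k c) = (conj (p k) * c).re := by
    intro c
    rw [PiLp.inner_apply, Finset.sum_eq_single k]
    · simp [Complex.inner]
      ring
    · intro j _ hj
      simp [hj]
    · simp
  simp [e]
  apply Complex.ext <;> simp <;> ring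

theorem contDiff_dz {f : CSpace N → ℂ} (hf : ContDiff ℝ ∞ f) (j : Fin N) :
    ContDiff ℝ ∞ (dz j f) := by
  have h := hf.fderiv_right (m := ∞) (by simp)
  exact contDiff_const.mul ((h.clm_apply contDiff_const).sub
    (contDiff_const.mul (h.clm_apply contDiff_const)))

theorem contDiff_dzbar {f : CSpace N → ℂ} (hf : ContDiff ℝ ∞ f) (j : Fin N) :
    ContDiff ℝ ∞ (dzbar j f) := by
  have h := hf.fderiv_right (m := ∞) (by simp)
  exact contDiff_const.mul ((h.clm_apply contDiff_const).add
    (contDiff_const.mul (h.clm_apply contDiff_const)))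

theorem fderiv_eq_zero_of_notMem_tsupport {f : CSpace N → ℂ} {x : CSpace N} (hx : x ∉ tsupport f) :
    fderiv ℝ f x = 0 :=
  Function.notMem_support.1 fun h => hx (support_fderiv_subset ℝ h)

theorem dz_eq_zero_of_notMem_tsupport {f : CSpace N → ℂ} {x : CSpace N} (hx : x ∉ tsupport f)
    (j : Fin N) : dz j f x = 0 := by
  simp [dz, fderiv_eq_zero_of_notMem_tsupport hx]

theorem dzbar_eq_zero_of_notMem_tsupport {f : CSpace N → ℂ} {x : CSpace N} (hx : x ∉ tsupport f)
    (j : Fin N) : dzbar j f x = 0 := by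
  simp [dzbar, fderiv_eq_zero_of_notMem_tsupport hx]

theorem integral_dzbar_mul {f φ : CSpace N → ℂ} (hf : ContDiff ℝ ∞ f) (hφ : ContDiff ℝ ∞ φ)
    (hc : HasCompactSupport φ) (k : Fin N) :
    ∫ x, dzbar k f x * φ x = -∫ x, f x * dzbar k φ x := by
  have hfc := hf.continuous
  have hφc := hφ.continuous
  have hf' : ∀ v, Continuous fun x => fderiv ℝ f x v := fun v =>
    ((hf.fderiv_right (m := ∞) (by simp)).clm_apply contDiff_const).continuous
  have hφ' : ∀ v, Continuous fun x => fderiv ℝ φ x v := fun v =>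
    ((hφ.fderiv_right (m := ∞) (by simp)).clm_apply contDiff_const).continuous
  have hcφ' : ∀ v, HasCompactSupport fun x => fderiv ℝ φ x v := fun v => hc.fderiv_apply ℝ v
  have i1 : ∀ v, Integrable fun x => fderiv ℝ f x v * φ x := fun v =>
    ((hf' v).mul hφc).integrable_of_hasCompactSupport hc.mul_left
  have i2 : ∀ v, Integrable fun x => f x * fderiv ℝ φ x v := fun v =>
    (hfc.mul (hφ' v)).integrable_of_hasCompactSupport (hcφ' v).mul_left
  have i3 : Integrable fun x => f x * φ x :=
    (hfc.mul hφc).integrable_of_hasCompactSupport hc.mul_left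
  have key : ∀ v, ∫ x, f x * fderiv ℝ φ x v = -∫ x, fderiv ℝ f x v * φ x := fun v =>
    integral_mul_fderiv_eq_neg_fderiv_mul_of_integrable (i1 v) (i2 v) i3
      (fun x _ => hf.differentiable (by simp) x) (fun x _ => hφ.differentiable (by simp) x)
  set e₁ : CSpace N := EuclideanSpace.single k 1
  set e₂ : CSpace N := EuclideanSpace.single k Complex.I
  have h1 : ∫ x, dzbar k f x * φ x = (1 / 2) * ((∫ x, fderiv ℝ f x e₁ * φ x)
      + Complex.I * ∫ x, fderiv ℝ f x e₂ * φ x) := by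
    rw [← integral_const_mul, ← integral_add (i1 _) ((i1 _).const_mul _), ← integral_const_mul]
    refine integral_congr_ae (Eventually.of_forall fun x => ?_)
    simp only [dzbar]
    ring
  have h2 : ∫ x, f x * dzbar k φ x = (1 / 2) * ((∫ x, f x * fderiv ℝ φ x e₁)
      + Complex.I * ∫ x, f x * fderiv ℝ φ x e₂) := by
    rw [← integral_const_mul, ← integral_add (i2 _) ((i2 _).const_mul _), ← integral_const_mul]
    refine integral_congr_ae (Eventually.of_forall fun x => ?_)
    simp only [dzbar]
    ring
  rw [h1, h2, key, key]
  ring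

end WirtingerCalculus

/-! ### Smooth forms in the domains of ∂̄ and of its adjoint -/

section SmoothForms

variable {N p q : ℕ}

/-- The pointwise `∂̄` of a smooth form. -/
def dbarForm (q : ℕ) (f : CSpace N → Forms N p) (x : CSpace N) : Forms N q :=
  WithLp.toLp 2 fun K => ∑ J : {J : Finset (Fin N) // J.card = p}, ∑ k : Fin N,
    wedgeSign k J.1 K.1 * dzbar k (fun y => f y J) x

/-- The formal adjoint of `∂̄` with respect to the weight `e^{-t|x|²}`. -/
def dbarStarForm (p : ℕ) (t : ℝ) (f : CSpace N → Forms N q) (x : CSpace N) : Forms N p :=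
  WithLp.toLp 2 fun J => -∑ K : {K : Finset (Fin N) // K.card = q}, ∑ k : Fin N,
    wedgeSign k J.1 K.1 * (dz k (fun y => f y K) x - t * conj (x k) * f x K)

/-- For t ≥ 0 the weight is at most 1, so square integrability can be checked with Lebesgue measure.
-/
theorem weightedVolume_le {Ω : Set (CSpace N)} {t : ℝ} (ht : 0 ≤ t) :
    weightedVolume Ω t ≤ volume := by
  refine le_trans ?_ (Measure.restrict_le_self (s := Ω))
  refine (withDensity_mono (g := 1) (Eventually.of_forall fun x => ?_)).trans_eq withDensity_one
  rw [Pi.one_apply, ENNReal.ofReal_le_one, Real.exp_le_one_iff]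
  nlinarith [sq_nonneg ‖x‖]

theorem measurable_weight (t : ℝ) :
    Measurable fun x : CSpace N => ENNReal.ofReal (Real.exp (-t * ‖x‖ ^ 2)) := by
  fun_prop

theorem integral_weightedVolume (Ω : Set (CSpace N)) (t : ℝ) (F : CSpace N → ℂ) :
    ∫ x, F x ∂weightedVolume Ω t = ∫ x in Ω, F x * (Real.exp (-t * ‖x‖ ^ 2) : ℝ) := by
  rw [weightedVolume, integral_withDensity_eq_integral_toReal_smul (measurable_weight t)
    (Eventually.of_forall fun x => ENNReal.ofReal_lt_top)]
  refine integral_congr_ae (Eventually.of_forall fun x => ?_)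
  simp only
  rw [ENNReal.toReal_ofReal (Real.exp_pos _).le, Complex.real_smul, mul_comm]

theorem memLp_weightedVolume {E : Type*} [NormedAddCommGroup E] {Ω : Set (CSpace N)} {t : ℝ}
    (ht : 0 ≤ t) {f : CSpace N → E} (hf : Continuous f) (hc : HasCompactSupport f) :
    MemLp f 2 (weightedVolume Ω t) :=
  (hf.memLp_of_hasCompactSupport hc).mono_measure (weightedVolume_le ht)

theorem contDiff_coord {f : CSpace N → Forms N p} (hf : ContDiff ℝ ∞ f)
    (J : {J : Finset (Fin N) // J.card = p}) : ContDiff ℝ ∞ fun y => f y J :=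
  ((EuclideanSpace.proj J : Forms N p →L[ℂ] ℂ).restrictScalars ℝ).contDiff.comp hf

theorem tsupport_coord_subset (f : CSpace N → Forms N p)
    (J : {J : Finset (Fin N) // J.card = p}) : tsupport (fun y => f y J) ⊆ tsupport f := by
  refine closure_mono fun x hx h => hx ?_
  simp [h]

theorem hasCompactSupport_coord {f : CSpace N → Forms N p} (hc : HasCompactSupport f)
    (J : {J : Finset (Fin N) // J.card = p}) : HasCompactSupport fun y => f y J :=
  hc.mono' ((subset_tsupport _).trans (tsupport_coord_subset f J))

theorem continuous_toLp_forms {f : CSpace N → {J : Finset (Fin N) // J.card = p} → ℂ}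
    (hf : ∀ J, Continuous fun x => f x J) :
    Continuous fun x => (WithLp.toLp 2 (f x) : Forms N p) :=
  (PiLp.continuous_toLp 2 _).comp (continuous_pi hf)

theorem continuous_dbarForm {f : CSpace N → Forms N p} (hf : ContDiff ℝ ∞ f) :
    Continuous (dbarForm q f) :=
  continuous_toLp_forms fun _ => continuous_finsetSum _ fun J _ => continuous_finsetSum _
    fun k _ => continuous_const.mul (contDiff_dzbar (contDiff_coord hf J) k).continuous

theorem continuous_coordinate (k : Fin N) : Continuous fun x : CSpace N => x k :=
  (EuclideanSpace.proj k : CSpace N →L[ℂ] ℂ).continuous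

theorem continuous_dbarStarForm {f : CSpace N → Forms N q} (t : ℝ) (hf : ContDiff ℝ ∞ f) :
    Continuous (dbarStarForm p t f) := by
  refine continuous_toLp_forms fun _ => Continuous.neg ?_
  refine continuous_finsetSum _ fun J _ => continuous_finsetSum _ fun k _ => ?_
  exact continuous_const.mul ((contDiff_dz (contDiff_coord hf J) k).continuous.sub
    ((continuous_const.mul (Complex.continuous_conj.comp (continuous_coordinate k))).mul
      (contDiff_coord hf J).continuous))

theorem dbarForm_eq_zero_of_notMem_tsupport {f : CSpace N → Forms N p} {x : CSpace N}
    (hx : x ∉ tsupport f) : dbarForm q f x = 0 := by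
  ext K
  simp only [dbarForm, PiLp.zero_apply]
  refine Finset.sum_eq_zero fun J _ => Finset.sum_eq_zero fun k _ => ?_
  rw [dzbar_eq_zero_of_notMem_tsupport fun h => hx (tsupport_coord_subset f J h), mul_zero]

theorem dbarStarForm_eq_zero_of_notMem_tsupport {f : CSpace N → Forms N q} (t : ℝ) {x : CSpace N}
    (hx : x ∉ tsupport f) : dbarStarForm p t f x = 0 := by
  ext K
  refine neg_eq_zero.2 (Finset.sum_eq_zero fun J _ => Finset.sum_eq_zero fun k _ => ?_)
  rw [dz_eq_zero_of_notMem_tsupport fun h => hx (tsupport_coord_subset f J h),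
    image_eq_zero_of_notMem_tsupport hx]
  simp

theorem hasCompactSupport_dbarForm {f : CSpace N → Forms N p} (hc : HasCompactSupport f) :
    HasCompactSupport (dbarForm q f) :=
  HasCompactSupport.intro hc fun _ hx => dbarForm_eq_zero_of_notMem_tsupport hx

theorem hasCompactSupport_dbarStarForm {f : CSpace N → Forms N q} (t : ℝ)
    (hc : HasCompactSupport f) : HasCompactSupport (dbarStarForm p t f) :=
  HasCompactSupport.intro hc fun _ hx => dbarStarForm_eq_zero_of_notMem_tsupport t hx

/-- The maximal operator imposes no boundary condition: the test functions are supported in Ω, so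
the integration by parts takes place on the whole space. -/
theorem isDbar_dbarForm {Ω : Set (CSpace N)} {t : ℝ} (ht : 0 ≤ t) {f : CSpace N → Forms N p}
    (hf : ContDiff ℝ ∞ f) (hc : HasCompactSupport f) : IsDbar Ω t f (dbarForm q f) := by
  refine ⟨memLp_weightedVolume ht hf.continuous hc,
    memLp_weightedVolume ht (continuous_dbarForm hf) (hasCompactSupport_dbarForm hc), ?_⟩
  intro φ hφ hφc hφΩ K
  rw [setIntegral_eq_integral_of_forall_compl_eq_zero, setIntegral_eq_integral_of_forall_compl_eq_zero]
  rotate_left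
  · intro x hx
    refine Finset.sum_eq_zero fun J _ => Finset.sum_eq_zero fun k _ => ?_
    rw [dzbar_eq_zero_of_notMem_tsupport fun h => hx (hφΩ h), mul_zero]
  · intro x hx
    rw [image_eq_zero_of_notMem_tsupport fun h => hx (hφΩ h), mul_zero]
  have i1 : ∀ J k, Integrable fun x =>
      wedgeSign k J.1 K.1 * (dzbar k (fun y => f y J) x * φ x) := fun J k =>
    (((contDiff_dzbar (contDiff_coord hf J) k).continuous.mul
      hφ.continuous).integrable_of_hasCompactSupport hφc.mul_left).const_mul _
  have i2 : ∀ (J : {J : Finset (Fin N) // J.card = p}) k, Integrable fun x =>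
      wedgeSign k J.1 K.1 * (f x J * dzbar k φ x) := fun J k =>
    (((contDiff_coord hf J).continuous.mul
      (contDiff_dzbar hφ k).continuous).integrable_of_hasCompactSupport
        (hasCompactSupport_coord hc J).mul_right).const_mul _
  calc ∫ x, dbarForm q f x K * φ x
      = ∫ x, ∑ J, ∑ k, wedgeSign k J.1 K.1 * (dzbar k (fun y => f y J) x * φ x) := by
        refine integral_congr_ae (Eventually.of_forall fun x => ?_)
        simp only [dbarForm, Finset.sum_mul, mul_assoc]
    _ = ∑ J, ∑ k, ∫ x, wedgeSign k J.1 K.1 * (dzbar k (fun y => f y J) x * φ x) := by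
        rw [integral_finsetSum _ fun J _ => integrable_finsetSum _ fun k _ => i1 J k]
        exact Finset.sum_congr rfl fun J _ => integral_finsetSum _ fun k _ => i1 J k
    _ = -∑ J : {J : Finset (Fin N) // J.card = p}, ∑ k,
          ∫ x, wedgeSign k J.1 K.1 * (f x J * dzbar k φ x) := by
        rw [← Finset.sum_neg_distrib]
        refine Finset.sum_congr rfl fun J _ => ?_
        rw [← Finset.sum_neg_distrib]
        refine Finset.sum_congr rfl fun k _ => ?_
        rw [integral_const_mul, integral_const_mul, integral_dzbar_mul (contDiff_coord hf J) hφ hφc,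
          mul_neg]
    _ = -∫ x, ∑ J : {J : Finset (Fin N) // J.card = p}, ∑ k : Fin N,
            wedgeSign k J.1 K.1 * f x J * dzbar k φ x := by
        simp only [mul_assoc]
        rw [integral_finsetSum _ fun J _ => integrable_finsetSum _ fun k _ => i2 J k]
        congr 1
        exact Finset.sum_congr rfl fun J _ => (integral_finsetSum _ fun k _ => i2 J k).symm

theorem MemLp.coord {μ : Measure (CSpace N)} {f : CSpace N → Forms N p} (hf : MemLp f 2 μ)
    (J : {J : Finset (Fin N) // J.card = p}) : MemLp (fun x => f x J) 2 μ :=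
  (EuclideanSpace.proj J : Forms N p →L[ℂ] ℂ).comp_memLp' hf

theorem conj_wedgeSign (k : Fin N) (J K : Finset (Fin N)) :
    conj (wedgeSign k J K) = wedgeSign k J K := by
  unfold wedgeSign
  split_ifs <;> simp

/-- Differentiating the weight produces the zeroth-order term of the formal adjoint. -/
theorem dzbar_conj_mul_weight {F : CSpace N → ℂ} {x : CSpace N} (hF : DifferentiableAt ℝ F x)
    (t : ℝ) (k : Fin N) :
    dzbar k (fun y => conj (F y) * ((Real.exp (-t * ‖y‖ ^ 2) : ℝ) : ℂ)) x =
      conj (dz k F x - t * conj (x k) * F x) * (Real.exp (-t * ‖x‖ ^ 2) : ℝ) := by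
  have h1 : DifferentiableAt ℝ (fun y => conj (F y)) x :=
    ((Complex.conjCLE : ℂ →L[ℝ] ℂ).hasFDerivAt.comp x hF.hasFDerivAt).differentiableAt
  have h2 : DifferentiableAt ℝ (fun y : CSpace N => ((Real.exp (-t * ‖y‖ ^ 2) : ℝ) : ℂ)) x :=
    (Complex.ofRealCLM.hasFDerivAt.comp x
      (((hasFDerivAt_id x).norm_sq).const_mul (-t)).exp).differentiableAt
  rw [dzbar_mul h1 h2, dzbar_conj hF, dzbar_weight]
  simp only [map_sub, map_mul, Complex.conj_conj, Complex.conj_ofReal]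
  ring

/-- A smooth compactly supported form whose contraction with the gradient of a defining function
vanishes identically lies in the domain of the Hilbert space adjoint of `∂̄`. -/
theorem isDbarStar_dbarStarForm {Ω : Set (CSpace N)} {r : CSpace N → ℝ} (hr : ContDiff ℝ ∞ r)
    (hΩ : Ω = {x | r x < 0}) {t : ℝ} (ht : 0 ≤ t) {f : CSpace N → Forms N q}
    (hf : ContDiff ℝ ∞ f) (hc : HasCompactSupport f)
    (htan : ∀ x, ∀ J : {J : Finset (Fin N) // J.card = p},
      ∑ K : {K : Finset (Fin N) // K.card = q}, ∑ k : Fin N,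
        wedgeSign k J.1 K.1 * (dz k (fun y => (r y : ℂ)) x * f x K) = 0) :
    IsDbarStar Ω t f (dbarStarForm p t f) := by
  have hfL : MemLp f 2 (weightedVolume Ω t) := memLp_weightedVolume ht hf.continuous hc
  have hvL : MemLp (dbarStarForm p t f) 2 (weightedVolume Ω t) :=
    memLp_weightedVolume ht (continuous_dbarStarForm t hf) (hasCompactSupport_dbarStarForm t hc)
  refine ⟨hfL, hvL, ?_⟩
  intro g u hgu
  obtain ⟨hgL, huL, htest⟩ := hgu
  set μ := weightedVolume Ω t with hμ
  have hΩo : IsOpen Ω := by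
    rw [hΩ]
    exact isOpen_lt hr.continuous continuous_const
  -- cutoff functions that vanish near the boundary
  set θ : ℕ → ℝ → ℝ := fun m s => Real.smoothTransition (-(m + 1) * s - 1) with hθ
  have hθC : ∀ m, ContDiff ℝ ∞ (θ m) := fun m =>
    Real.smoothTransition.contDiff.comp ((contDiff_const.mul contDiff_id).sub contDiff_const)
  have hηC : ∀ m, ContDiff ℝ ∞ fun x => ((θ m (r x) : ℝ) : ℂ) := fun m =>
    Complex.ofRealCLM.contDiff.comp ((hθC m).comp hr)
  -- Adjointness with the cutoff inserted. It follows from the distributional definition of u, so no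
  -- approximation of g by smooth forms is needed.
  have hmain : ∀ m, ∫ x, (θ m (r x) : ℂ) * inner ℂ (f x) (u x) ∂μ =
      ∫ x, (θ m (r x) : ℂ) * inner ℂ (dbarStarForm p t f x) (g x) ∂μ := by
    intro m
    set F : {K : Finset (Fin N) // K.card = q} → CSpace N → ℂ :=
      fun K x => (θ m (r x) : ℂ) * f x K with hF
    have hFC : ∀ K, ContDiff ℝ ∞ (F K) := fun K => (hηC m).mul (contDiff_coord hf K)
    have hFc : ∀ K, HasCompactSupport (F K) := fun K => (hasCompactSupport_coord hc K).mul_left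
    set ψ : Fin N → {K : Finset (Fin N) // K.card = q} → CSpace N → ℂ :=
      fun k K x => dz k (F K) x - t * conj (x k) * F K x with hψ
    have hψc : ∀ k K, Continuous (ψ k K) := fun k K => (contDiff_dz (hFC K) k).continuous.sub
      ((continuous_const.mul (Complex.continuous_conj.comp (continuous_coordinate k))).mul
        (hFC K).continuous)
    have hψs : ∀ k K, HasCompactSupport (ψ k K) := fun k K =>
      HasCompactSupport.intro (hFc K) fun x hx => by
        simp only [hψ]
        rw [dz_eq_zero_of_notMem_tsupport hx, image_eq_zero_of_notMem_tsupport hx]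
        simp
    have hconj : ∀ {h : CSpace N → ℂ}, Continuous h → HasCompactSupport h →
        MemLp (fun x => conj (h x)) 2 μ := fun {h} h1 h2 =>
      memLp_weightedVolume ht (Complex.continuous_conj.comp h1) (h2.comp_left (map_zero _))
    have i1 : ∀ K, Integrable (fun x => u x K * conj (F K x)) μ := fun K =>
      (MemLp.coord huL K).integrable_mul (hconj (hFC K).continuous (hFc K))
    have i2 : ∀ K, Integrable (fun x => ∑ J : {J : Finset (Fin N) // J.card = p}, ∑ k : Fin N,
        wedgeSign k J.1 K.1 * (g x J * conj (ψ k K x))) μ := fun K =>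
      integrable_finsetSum _ fun J _ => integrable_finsetSum _ fun k _ =>
        ((MemLp.coord hgL J).integrable_mul (hconj (hψc k K) (hψs k K))).const_mul _
    have hK : ∀ K, ∫ x, u x K * conj (F K x) ∂μ =
        -∫ x, ∑ J : {J : Finset (Fin N) // J.card = p}, ∑ k : Fin N,
          wedgeSign k J.1 K.1 * (g x J * conj (ψ k K x)) ∂μ := by
      intro K
      have hwC : ContDiff ℝ ∞ fun x : CSpace N => ((Real.exp (-t * ‖x‖ ^ 2) : ℝ) : ℂ) :=
        Complex.ofRealCLM.contDiff.comp
          (Real.contDiff_exp.comp (contDiff_const.mul (contDiff_id.norm_sq ℝ)))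
      -- Admissible as a test function: f has compact support, and the cutoff confines the support
      -- to (m + 1) r ≤ -1, inside Ω.
      have h1 := htest (fun x => conj (F K x) * ((Real.exp (-t * ‖x‖ ^ 2) : ℝ) : ℂ))
        (((Complex.conjCLE : ℂ →L[ℝ] ℂ).contDiff.comp (hFC K)).mul hwC)
        (((hFc K).comp_left (g := fun z : ℂ => conj z) (map_zero _)).mul_right) ?_ K
      · rw [hμ, integral_weightedVolume, integral_weightedVolume]
        simp only [← mul_assoc] at h1 ⊢
        rw [h1]
        congr 1
        refine integral_congr_ae (Eventually.of_forall fun x => ?_)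
        simp only [Finset.sum_mul]
        refine Finset.sum_congr rfl fun J _ => Finset.sum_congr rfl fun k _ => ?_
        rw [dzbar_conj_mul_weight ((hFC K).differentiable (by simp) x)]
        simp only [hψ]
        ring
      · have hm : (0 : ℝ) < m + 1 := by positivity
        have hsub : tsupport (fun x => conj (F K x) * ((Real.exp (-t * ‖x‖ ^ 2) : ℝ) : ℂ)) ⊆
            {x | (m + 1) * r x ≤ -1} := by
          refine closure_minimal ?_ (isClosed_le (continuous_const.mul hr.continuous)
            continuous_const)
          intro x hx
          by_contra hcon
          apply hx
          have h2 : -((m : ℝ) + 1) * r x - 1 ≤ 0 := by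
            have : -1 < ((m : ℝ) + 1) * r x := not_le.1 hcon
            linarith
          have h3 : θ m (r x) = 0 := Real.smoothTransition.zero_of_nonpos h2
          simp [hF, h3]
        refine hsub.trans fun x hx => ?_
        rw [hΩ]
        have hx' : ((m : ℝ) + 1) * r x ≤ -1 := hx
        show r x < 0
        by_contra hcon
        nlinarith [mul_nonneg hm.le (not_lt.1 hcon)]
    calc ∫ x, (θ m (r x) : ℂ) * inner ℂ (f x) (u x) ∂μ
        = ∫ x, ∑ K, u x K * conj (F K x) ∂μ := by
          refine integral_congr_ae (Eventually.of_forall fun x => ?_)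
          simp only [PiLp.inner_apply, RCLike.inner_apply, Finset.mul_sum, hF, map_mul,
            Complex.conj_ofReal]
          exact Finset.sum_congr rfl fun K _ => by ring
      _ = ∑ K, ∫ x, u x K * conj (F K x) ∂μ := integral_finsetSum _ fun K _ => i1 K
      _ = -∫ x, ∑ K, ∑ J : {J : Finset (Fin N) // J.card = p}, ∑ k : Fin N,
            wedgeSign k J.1 K.1 * (g x J * conj (ψ k K x)) ∂μ := by
          rw [integral_finsetSum _ fun K _ => i2 K, ← Finset.sum_neg_distrib]
          exact Finset.sum_congr rfl fun K _ => hK K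
      _ = ∫ x, (θ m (r x) : ℂ) * inner ℂ (dbarStarForm p t f x) (g x) ∂μ := by
          rw [← integral_neg]
          refine integral_congr_ae (Eventually.of_forall fun x => ?_)
          simp only [PiLp.inner_apply, RCLike.inner_apply, Finset.mul_sum]
          rw [Finset.sum_comm, ← Finset.sum_neg_distrib]
          refine Finset.sum_congr rfl fun J _ => ?_
          -- Differentiating the cutoff gives θ'(r) times the contraction of f with ∂r. This is zero
          -- by `htan`, which is assumed at every point and not only on the boundary, so the growth
          -- of θ' with m does no harm.
          have hdzF : ∀ k K, dz k (F K) x = ((deriv (θ m) (r x) : ℝ) : ℂ) *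
              (dz k (fun y => (r y : ℂ)) x * f x K) + (θ m (r x) : ℂ) * dz k (fun y => f y K) x := by
            intro k K
            rw [dz_mul ((hηC m).differentiable (by simp) x)
              ((contDiff_coord hf K).differentiable (by simp) x),
              dz_ofReal_comp (hr.differentiable (by simp) x) ((hθC m).differentiable (by simp) _)]
            ring
          have hv : (θ m (r x) : ℂ) * dbarStarForm p t f x J =
              -∑ K, ∑ k, wedgeSign k J.1 K.1 * ψ k K x := by
            have e : ∑ K, ∑ k, wedgeSign k J.1 K.1 * ψ k K x =
                ((deriv (θ m) (r x) : ℝ) : ℂ) * (∑ K : {K : Finset (Fin N) // K.card = q},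
                  ∑ k : Fin N, wedgeSign k J.1 K.1 * (dz k (fun y => (r y : ℂ)) x * f x K)) +
                (θ m (r x) : ℂ) * ∑ K : {K : Finset (Fin N) // K.card = q}, ∑ k : Fin N,
                  wedgeSign k J.1 K.1 * (dz k (fun y => f y K) x - t * conj (x k) * f x K) := by
              simp only [Finset.mul_sum, ← Finset.sum_add_distrib]
              refine Finset.sum_congr rfl fun K _ => Finset.sum_congr rfl fun k _ => ?_
              simp only [hψ]
              rw [hdzF]
              simp only [hF]
              ring
            rw [e, htan, dbarStarForm]
            simp
          have hv' := congrArg conj hv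
          simp only [map_mul, map_neg, map_sum, Complex.conj_ofReal, conj_wedgeSign] at hv'
          rw [← mul_assoc, mul_comm (θ m (r x) : ℂ), mul_assoc, hv', mul_neg, Finset.mul_sum]
          congr 1
          refine Finset.sum_congr rfl fun K _ => ?_
          rw [Finset.mul_sum]
          refine Finset.sum_congr rfl fun k _ => ?_
          ring
  have hlim : ∀ {G : CSpace N → ℂ}, Integrable G μ →
      Tendsto (fun m : ℕ => ∫ x, (θ m (r x) : ℂ) * G x ∂μ) atTop (𝓝 (∫ x, G x ∂μ)) := by
    intro G hG
    refine tendsto_integral_of_dominated_convergence (fun x => ‖G x‖) (fun m => ?_) hG.norm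
      (fun m => Eventually.of_forall fun x => ?_) ?_
    · exact (hηC m).continuous.aestronglyMeasurable.mul hG.1
    · rw [norm_mul, Complex.norm_real, Real.norm_of_nonneg (Real.smoothTransition.nonneg _)]
      exact mul_le_of_le_one_left (norm_nonneg _) (Real.smoothTransition.le_one _)
    · have hae : ∀ᵐ x ∂μ, x ∈ Ω :=
        (withDensity_absolutelyContinuous _ _).ae_le (ae_restrict_mem hΩo.measurableSet)
      filter_upwards [hae] with x hx
      rw [hΩ] at hx
      have hx' : r x < 0 := hx
      refine tendsto_const_nhds.congr' ?_
      -- From this index on the argument of the smooth transition is at least 1, so the cutoff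
      -- equals 1 at x.
      obtain ⟨M, hM⟩ := exists_nat_gt (2 / (-r x))
      filter_upwards [eventually_ge_atTop M] with m hm
      have h1 : 2 < (M : ℝ) * (-r x) := (div_lt_iff₀ (by linarith)).1 hM
      have h2 : (M : ℝ) ≤ m := by exact_mod_cast hm
      have h3 : θ m (r x) = 1 := by
        refine Real.smoothTransition.one_of_one_le ?_
        nlinarith
      simp [h3]
  have j1 : Integrable (fun x => inner ℂ (f x) (u x)) μ := by
    simp only [PiLp.inner_apply, RCLike.inner_apply]
    exact integrable_finsetSum _ fun K _ => (MemLp.coord huL K).integrable_mul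
      ((Complex.conjCLE : ℂ →L[ℝ] ℂ).comp_memLp' (MemLp.coord hfL K))
  have j2 : Integrable (fun x => inner ℂ (dbarStarForm p t f x) (g x)) μ := by
    simp only [PiLp.inner_apply, RCLike.inner_apply]
    exact integrable_finsetSum _ fun K _ => (MemLp.coord hgL K).integrable_mul
      ((Complex.conjCLE : ℂ →L[ℝ] ℂ).comp_memLp' (MemLp.coord hvL K))
  exact tendsto_nhds_unique (hlim j1) (by simpa only [hmain] using hlim j2)

end SmoothForms

/-! ### Exterior algebra: contracting twice gives zero -/

section Contraction

variable {N p q : ℕ}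

theorem norm_wedgeSign_le (k : Fin N) (J K : Finset (Fin N)) : ‖wedgeSign k J K‖ ≤ 1 := by
  unfold wedgeSign
  split_ifs <;> simp

theorem wedgeSign_insert {k : Fin N} {J : Finset (Fin N)} (hk : k ∉ J) :
    wedgeSign k J (insert k J) = (-1) ^ (J.filter (· < k)).card := by
  simp [wedgeSign, hk]

/-- Only the intermediate multi-index K ∪ {k} contributes. -/
theorem sum_wedgeSign_mul_wedgeSign (k m : Fin N) {K : Finset (Fin N)} (hK : K.card = p)
    (hpq : q = p + 1) (K₀ : Finset (Fin N)) :
    ∑ J : {J : Finset (Fin N) // J.card = q}, wedgeSign k K J.1 * wedgeSign m J.1 K₀ =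
      if k ∉ K then wedgeSign k K (insert k K) * wedgeSign m (insert k K) K₀ else 0 := by
  by_cases hk : k ∉ K
  · rw [if_pos hk]
    have hcard : (insert k K).card = q := by rw [Finset.card_insert_of_notMem hk, hK, hpq]
    refine Finset.sum_eq_single (⟨insert k K, hcard⟩ : {J : Finset (Fin N) // J.card = q}) ?_
      (fun h => absurd (Finset.mem_univ _) h)
    intro J _ hJ
    have : insert k K ≠ J.1 := fun h => hJ (Subtype.ext h.symm)
    simp [wedgeSign, this]
  · rw [if_neg hk]
    refine Finset.sum_eq_zero fun J _ => ?_
    simp only [not_not] at hk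
    simp [wedgeSign, hk]

theorem card_filter_insert_lt {k m : Fin N} {K : Finset (Fin N)} (hk : k ∉ K) :
    ((insert k K).filter (· < m)).card = (K.filter (· < m)).card + if k < m then 1 else 0 := by
  rw [Finset.filter_insert]
  split_ifs with h
  · rw [Finset.card_insert_of_notMem (by simp [hk])]
  · simp

/-- This is dz̄_m ∧ dz̄_k = -dz̄_k ∧ dz̄_m in coordinates. Inserting the smaller index first shifts
the position of the larger one by one, and the opposite order causes no shift. -/
theorem wedgeSign_anticomm (k m : Fin N) {K : Finset (Fin N)} (hK : K.card = p)
    (hpq : q = p + 1) (K₀ : Finset (Fin N)) :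
    ∑ J : {J : Finset (Fin N) // J.card = q}, wedgeSign k K J.1 * wedgeSign m J.1 K₀ =
      -∑ J : {J : Finset (Fin N) // J.card = q}, wedgeSign m K J.1 * wedgeSign k J.1 K₀ := by
  rw [sum_wedgeSign_mul_wedgeSign k m hK hpq, sum_wedgeSign_mul_wedgeSign m k hK hpq]
  by_cases hk : k ∈ K
  · by_cases hm : m ∈ K
    · simp [hk, hm]
    · simp [hk, hm, wedgeSign]
  · by_cases hm : m ∈ K
    · simp [hk, hm, wedgeSign]
    · rw [if_pos hk, if_pos hm, wedgeSign_insert hk, wedgeSign_insert hm]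
      by_cases hkm : k = m
      · subst hkm
        simp [wedgeSign]
      · have h1 : m ∉ insert k K := by simp [hm, Ne.symm hkm]
        have h2 : k ∉ insert m K := by simp [hk, hkm]
        unfold wedgeSign
        rw [Finset.insert_comm k m K]
        by_cases h0 : insert m (insert k K) = K₀
        · rw [if_pos ⟨h1, h0⟩, if_pos ⟨h2, h0⟩, card_filter_insert_lt hk, card_filter_insert_lt hm]
          rcases lt_or_gt_of_ne hkm with h | h
          · simp only [h, h.not_gt, if_true, if_false]
            ring
          · simp only [h, h.not_gt, if_true, if_false]
            ring
        · rw [if_neg fun h => h0 h.2, if_neg fun h => h0 h.2]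
          simp

/-- The contraction of the constant form `dz̄_{K₀}` with the vector `a`. -/
def contractForm (q : ℕ) (a : Fin N → ℂ) (K₀ : Finset (Fin N)) : Forms N q :=
  WithLp.toLp 2 fun J => ∑ m, a m * wedgeSign m J.1 K₀

theorem contractForm_apply (a : Fin N → ℂ) (K₀ : Finset (Fin N))
    (J : {J : Finset (Fin N) // J.card = q}) :
    contractForm q a K₀ J = ∑ m, a m * wedgeSign m J.1 K₀ := rfl

/-- The identity ι_a ι_a = 0: the symmetric factor a_k a_m is summed against an antisymmetric
expression. -/
theorem sum_mul_contractForm (a : Fin N → ℂ) (K₀ : Finset (Fin N)) (hpq : q = p + 1)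
    (J : {J : Finset (Fin N) // J.card = p}) :
    ∑ k, a k * ∑ K : {K : Finset (Fin N) // K.card = q},
      wedgeSign k J.1 K.1 * contractForm q a K₀ K = 0 := by
  set S := ∑ k, a k * ∑ K : {K : Finset (Fin N) // K.card = q},
      wedgeSign k J.1 K.1 * contractForm q a K₀ K with hS
  have e : S = ∑ k, ∑ m, a k * a m * ∑ K : {K : Finset (Fin N) // K.card = q},
      wedgeSign k J.1 K.1 * wedgeSign m K.1 K₀ := by
    rw [hS]
    refine Finset.sum_congr rfl fun k _ => ?_
    simp only [contractForm_apply, Finset.mul_sum]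
    rw [Finset.sum_comm]
    refine Finset.sum_congr rfl fun m _ => Finset.sum_congr rfl fun K _ => ?_
    ring
  have e2 : S = -S := by
    conv_rhs => rw [e, Finset.sum_comm]
    rw [e, ← Finset.sum_neg_distrib]
    refine Finset.sum_congr rfl fun k _ => ?_
    rw [← Finset.sum_neg_distrib]
    refine Finset.sum_congr rfl fun m _ => ?_
    rw [wedgeSign_anticomm k m J.2 hpq]
    ring
  exact self_eq_neg.1 e2

theorem norm_contractForm_apply_le (a : Fin N → ℂ) (K₀ : Finset (Fin N)) {b : ℝ}
    (hb : ∀ m, ‖a m‖ ≤ b) (J : {J : Finset (Fin N) // J.card = q}) :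
    ‖contractForm q a K₀ J‖ ≤ N * b := by
  rw [contractForm_apply]
  refine (norm_sum_le _ _).trans ?_
  refine (Finset.sum_le_sum fun m _ => ?_).trans_eq (b := ∑ _m : Fin N, b) (by simp)
  rw [norm_mul]
  exact (mul_le_of_le_one_right (norm_nonneg _) (norm_wedgeSign_le _ _ _)).trans (hb m)

/-- The component along K₀ \ {m} is ±a_m. -/
theorem norm_le_norm_contractForm (a : Fin N → ℂ) {K₀ : Finset (Fin N)} (hK₀ : K₀.card = q + 1)
    {m : Fin N} (hm : m ∈ K₀) : ‖a m‖ ≤ ‖contractForm q a K₀‖ := by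
  have hcard : (K₀.erase m).card = q := by rw [Finset.card_erase_of_mem hm, hK₀]; rfl
  refine le_trans (le_of_eq ?_) (PiLp.norm_apply_le (contractForm q a K₀) ⟨K₀.erase m, hcard⟩)
  rw [contractForm_apply, Finset.sum_eq_single m]
  · have h : wedgeSign m (K₀.erase m) K₀ = (-1) ^ ((K₀.erase m).filter (· < m)).card := by
      have := wedgeSign_insert (Finset.notMem_erase m K₀)
      rwa [Finset.insert_erase hm] at this
    rw [h]
    simp
  · intro k _ hk
    have : ¬ (k ∉ K₀.erase m ∧ insert k (K₀.erase m) = K₀) := by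
      rintro ⟨-, h2⟩
      rw [← h2] at hm
      simp [hk.symm] at hm
    rw [wedgeSign, if_neg this, mul_zero]
  · simp

theorem norm_sq_forms_le {f : Forms N p} {b : ℝ} (hb : ∀ J, ‖f J‖ ≤ b) :
    ‖f‖ ^ 2 ≤ Fintype.card {J : Finset (Fin N) // J.card = p} * b ^ 2 := by
  rw [EuclideanSpace.norm_sq_eq]
  refine (Finset.sum_le_sum fun J _ => pow_le_pow_left₀ (norm_nonneg _) (hb J) 2).trans_eq ?_
  simp

end Contraction

/-! ### Tangential forms on the Siegel domain -/

section TangentialForms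

variable {n p q : ℕ}

/-- The coefficients `∂r/∂z_k` of `r = |z|² - Im w`. -/
def siegelNormal (x : CSpace (n + 1)) (k : Fin (n + 1)) : ℂ :=
  if k = Fin.last n then Complex.I / 2 else conj (x k)

theorem dz_siegelFun (k : Fin (n + 1)) (x : CSpace (n + 1)) :
    dz k (fun y => (siegelFun y : ℂ)) x = siegelNormal x k := by
  have hd := hasFDerivAt_siegelFun x
  rw [dz, fderiv_ofReal_apply hd.differentiableAt, fderiv_ofReal_apply hd.differentiableAt,
    hd.fderiv]
  simp only [sub_apply, smul_apply, innerSL_apply_apply, inner_imVec, inner_zPart_left]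
  refine Fin.lastCases ?_ (fun l => ?_) k
  · simp [siegelNormal]
    ring
  · have h : ∀ c : ℂ, ∑ i : Fin n, inner ℝ (x i.castSucc)
        ((EuclideanSpace.single l.castSucc c : CSpace (n + 1)) i.castSucc) =
          inner ℝ (x l.castSucc) c := by
      intro c
      rw [Finset.sum_eq_single l]
      · simp
      · intro i _ hi
        simp [hi]
      · simp
    rw [h, h]
    simp [siegelNormal, (Fin.castSucc_lt_last l).ne, (Fin.castSucc_lt_last l).ne', Complex.inner]
    apply Complex.ext <;> simp

theorem contDiff_coordinate {N : ℕ} (k : Fin N) : ContDiff ℝ ∞ fun x : CSpace N => x k :=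
  ((EuclideanSpace.proj k : CSpace N →L[ℂ] ℂ).restrictScalars ℝ).contDiff

theorem contDiff_siegelNormal (k : Fin (n + 1)) :
    ContDiff ℝ ∞ fun x : CSpace (n + 1) => siegelNormal x k := by
  unfold siegelNormal
  split_ifs
  · exact contDiff_const
  · exact (Complex.conjCLE : ℂ →L[ℝ] ℂ).contDiff.comp (contDiff_coordinate k)

theorem contDiff_contractForm_apply (K₀ : Finset (Fin (n + 1)))
    (J : {J : Finset (Fin (n + 1)) // J.card = q}) :
    ContDiff ℝ ∞ fun x : CSpace (n + 1) => contractForm q (siegelNormal x) K₀ J := by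
  simp only [contractForm_apply]
  exact ContDiff.sum fun m _ => (contDiff_siegelNormal m).mul contDiff_const

theorem hasFDerivAt_siegelNormal (m : Fin (n + 1)) (x : CSpace (n + 1)) :
    HasFDerivAt (fun y : CSpace (n + 1) => siegelNormal y m)
      (if m = Fin.last n then 0 else (Complex.conjCLE : ℂ →L[ℝ] ℂ).comp
        ((EuclideanSpace.proj m : CSpace (n + 1) →L[ℂ] ℂ).restrictScalars ℝ)) x := by
  unfold siegelNormal
  split_ifs
  · exact hasFDerivAt_const _ _
  · exact ((Complex.conjCLE : ℂ →L[ℝ] ℂ).comp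
      ((EuclideanSpace.proj m : CSpace (n + 1) →L[ℂ] ℂ).restrictScalars ℝ)).hasFDerivAt

/-- The components of ∂r are z̄_k and the constant i/2, all antiholomorphic. Hence the adjoint of ∂̄
never differentiates these coefficients. -/
theorem dz_contractForm (K₀ : Finset (Fin (n + 1)))
    (J : {J : Finset (Fin (n + 1)) // J.card = q}) (k : Fin (n + 1)) (x : CSpace (n + 1)) :
    dz k (fun y => contractForm q (siegelNormal y) K₀ J) x = 0 := by
  have h : HasFDerivAt (fun y => contractForm q (siegelNormal y) K₀ J) _ x :=
    HasFDerivAt.fun_sum fun m (_ : m ∈ Finset.univ) =>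
      (hasFDerivAt_siegelNormal m x).mul_const (wedgeSign m J.1 K₀)
  rw [h.dz_eq, mul_eq_zero]
  right
  simp only [sum_apply, Finset.mul_sum, ← Finset.sum_sub_distrib]
  refine Finset.sum_eq_zero fun m _ => ?_
  by_cases hm : m = Fin.last n
  · simp [hm]
  · by_cases hk : m = k
    · subst hk
      simp [hm]
      ring_nf
      simp
    · simp [hm, hk]

theorem norm_dzbar_contractForm_le (K₀ : Finset (Fin (n + 1)))
    (J : {J : Finset (Fin (n + 1)) // J.card = q}) (k : Fin (n + 1)) (x : CSpace (n + 1)) :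
    ‖dzbar k (fun y => contractForm q (siegelNormal y) K₀ J) x‖ ≤ 1 := by
  have h : HasFDerivAt (fun y => contractForm q (siegelNormal y) K₀ J) _ x :=
    HasFDerivAt.fun_sum fun m (_ : m ∈ Finset.univ) =>
      (hasFDerivAt_siegelNormal m x).mul_const (wedgeSign m J.1 K₀)
  rw [h.dzbar_eq]
  simp only [sum_apply, Finset.mul_sum, ← Finset.sum_add_distrib]
  rw [Finset.sum_eq_single k]
  · by_cases hm : k = Fin.last n
    · simp [hm]
    · have e : wedgeSign k J.1 K₀ + -(Complex.I * (wedgeSign k J.1 K₀ * Complex.I)) =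
          2 * wedgeSign k J.1 K₀ := by
        ring_nf
        simp only [Complex.I_sq]
        ring
      simp [hm]
      rw [e, norm_mul]
      have := norm_wedgeSign_le k J.1 K₀
      simp
      linarith
  · intro m _ hk
    by_cases hm : m = Fin.last n
    · simp [hm]
    · simp [hm, hk]
  · simp

/-- The tangential form `g (∂r ⌟ dz̄_{K₀})`. -/
def tangForm (q : ℕ) (K₀ : Finset (Fin (n + 1))) (g : CSpace (n + 1) → ℂ) (x : CSpace (n + 1)) :
    Forms (n + 1) q :=
  g x • contractForm q (siegelNormal x) K₀

theorem tangForm_apply (K₀ : Finset (Fin (n + 1))) (g : CSpace (n + 1) → ℂ) (x : CSpace (n + 1))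
    (J : {J : Finset (Fin (n + 1)) // J.card = q}) :
    tangForm q K₀ g x J = g x * contractForm q (siegelNormal x) K₀ J := rfl

theorem contDiff_tangForm {K₀ : Finset (Fin (n + 1))} {g : CSpace (n + 1) → ℂ}
    (hg : ContDiff ℝ ∞ g) : ContDiff ℝ ∞ (tangForm q K₀ g) :=
  hg.smul (contDiff_piLp' 2 fun J => contDiff_contractForm_apply K₀ J)

theorem hasCompactSupport_tangForm {K₀ : Finset (Fin (n + 1))} {g : CSpace (n + 1) → ℂ}
    (hg : HasCompactSupport g) : HasCompactSupport (tangForm q K₀ g) :=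
  hg.smul_right

theorem isDbarStar_tangForm (hpq : q = p + 1) {t : ℝ} (ht : 0 ≤ t) {K₀ : Finset (Fin (n + 1))}
    {g : CSpace (n + 1) → ℂ} (hg : ContDiff ℝ ∞ g) (hc : HasCompactSupport g) :
    IsDbarStar (siegel n) t (tangForm q K₀ g) (dbarStarForm p t (tangForm q K₀ g)) := by
  refine isDbarStar_dbarStarForm contDiff_siegelFun ?_ ht (contDiff_tangForm hg)
    (hasCompactSupport_tangForm hc) ?_
  · ext x
    exact mem_siegel_iff x
  · intro x J
    have h := sum_mul_contractForm (siegelNormal x) K₀ hpq J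
    rw [Finset.sum_comm]
    calc _ = g x * ∑ k, siegelNormal x k * ∑ K : {K : Finset (Fin (n + 1)) // K.card = q},
          wedgeSign k J.1 K.1 * contractForm q (siegelNormal x) K₀ K := by
          simp only [Finset.mul_sum]
          refine Finset.sum_congr rfl fun k _ => Finset.sum_congr rfl fun K _ => ?_
          rw [dz_siegelFun, tangForm_apply]
          ring
      _ = 0 := by rw [h, mul_zero]

/-- A derivative falls either on g or on a coefficient. The coefficients have size at most (n + 1)b
and, being affine in z̄, derivatives bounded by 1. -/
theorem norm_dbarForm_tangForm_apply_le {K₀ : Finset (Fin (n + 1))} {g : CSpace (n + 1) → ℂ}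
    (hg : ContDiff ℝ ∞ g) {x : CSpace (n + 1)} {b D G : ℝ} (hb : ∀ m, ‖siegelNormal x m‖ ≤ b)
    (hD : ∀ k, ‖dzbar k g x‖ ≤ D) (hG : ‖g x‖ ≤ G)
    (K : {K : Finset (Fin (n + 1)) // K.card = p}) :
    ‖dbarForm p (tangForm q K₀ g) x K‖ ≤
      Fintype.card {J : Finset (Fin (n + 1)) // J.card = q} *
        ((n + 1) * (D * ((n + 1) * b) + G)) := by
  have hD0 : 0 ≤ D := (norm_nonneg _).trans (hD 0)
  have hG0 : 0 ≤ G := (norm_nonneg _).trans hG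
  simp only [dbarForm]
  refine (norm_sum_le _ _).trans ?_
  refine (Finset.sum_le_sum fun J _ => (norm_sum_le _ _).trans
    (Finset.sum_le_sum fun k _ => ?_)).trans_eq
    (b := ∑ _J : {J : Finset (Fin (n + 1)) // J.card = q}, ∑ _k : Fin (n + 1),
      (D * ((n + 1) * b) + G)) (by simp; ring)
  rw [norm_mul]
  refine (mul_le_of_le_one_left (norm_nonneg _) (norm_wedgeSign_le _ _ _)).trans ?_
  have e : dzbar k (fun y => tangForm q K₀ g y J) x =
      dzbar k g x * contractForm q (siegelNormal x) K₀ J +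
        g x * dzbar k (fun y => contractForm q (siegelNormal y) K₀ J) x :=
    dzbar_mul (hg.differentiable (by simp) x)
      ((contDiff_contractForm_apply K₀ J).differentiable (by simp) x) k
  rw [e]
  refine (norm_add_le _ _).trans ?_
  rw [norm_mul, norm_mul]
  have h1 := norm_contractForm_apply_le (siegelNormal x) K₀ hb J
  have h2 := norm_dzbar_contractForm_le K₀ J k x
  push_cast at h1
  refine add_le_add (mul_le_mul (hD k) h1 (norm_nonneg _) hD0) ?_
  calc _ ≤ G * 1 := mul_le_mul hG h2 (norm_nonneg _) hG0
    _ = G := mul_one G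

/-- Tangentiality eliminates the last coefficient, and the first-order part regroups into the n
fields ∂_{z_l} + 2i z̄_l ∂_w. They yield n of the 2n + 1 terms in the bound; the weight yields the
other n + 1. -/
theorem norm_dbarStarForm_tangForm_apply_le (hpq : q = p + 1) {K₀ : Finset (Fin (n + 1))}
    {g : CSpace (n + 1) → ℂ} (hg : ContDiff ℝ ∞ g) {x : CSpace (n + 1)} {t b D : ℝ}
    (hb : ∀ m, ‖siegelNormal x m‖ ≤ b)
    (hD : ∀ l : Fin n, ‖dz l.castSucc g x +
      2 * Complex.I * conj (x l.castSucc) * dz (Fin.last n) g x‖ ≤ D)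
    (ht : ∀ k, ‖t * conj (x k) * g x‖ ≤ D)
    (J : {J : Finset (Fin (n + 1)) // J.card = p}) :
    ‖dbarStarForm p t (tangForm q K₀ g) x J‖ ≤
      Fintype.card {K : Finset (Fin (n + 1)) // K.card = q} * ((n + 1) * b) * ((2 * n + 1) * D) := by
  have hD0 : 0 ≤ D := (norm_nonneg _).trans (ht 0)
  have hb0 : 0 ≤ b := (norm_nonneg _).trans (hb 0)
  set coef : Fin (n + 1) → ℂ := fun k => ∑ K : {K : Finset (Fin (n + 1)) // K.card = q},
    wedgeSign k J.1 K.1 * contractForm q (siegelNormal x) K₀ K with hcoef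
  set B : ℝ := Fintype.card {K : Finset (Fin (n + 1)) // K.card = q} * ((n + 1) * b) with hB
  have hB0 : 0 ≤ B := by positivity
  have hcoefB : ∀ k, ‖coef k‖ ≤ B := by
    intro k
    refine (norm_sum_le _ _).trans ?_
    refine (Finset.sum_le_sum fun K _ => ?_).trans_eq
      (b := ∑ _K : {K : Finset (Fin (n + 1)) // K.card = q}, (((n : ℝ) + 1) * b))
      (by simp [hB])
    rw [norm_mul]
    have h1 := norm_contractForm_apply_le (siegelNormal x) K₀ hb K
    push_cast at h1
    exact (mul_le_of_le_one_left (norm_nonneg _) (norm_wedgeSign_le _ _ _)).trans h1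
  have htan : ∑ k, siegelNormal x k * coef k = 0 := sum_mul_contractForm (siegelNormal x) K₀ hpq J
  -- The tangency relation solved for its w-coefficient, using ∂r/∂w = i/2.
  have hlast : coef (Fin.last n) =
      2 * Complex.I * ∑ l : Fin n, conj (x l.castSucc) * coef l.castSucc := by
    rw [Fin.sum_univ_castSucc] at htan
    have e : ∀ l : Fin n, siegelNormal x l.castSucc = conj (x l.castSucc) := by
      intro l
      simp [siegelNormal, (Fin.castSucc_lt_last l).ne]
    have e' : siegelNormal x (Fin.last n) = Complex.I / 2 := by simp [siegelNormal]
    simp only [e, e'] at htan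
    rw [eq_neg_of_add_eq_zero_left htan]
    ring_nf
    simp only [Complex.I_sq]
    ring
  have e : dbarStarForm p t (tangForm q K₀ g) x J =
      -(∑ l : Fin n, coef l.castSucc * (dz l.castSucc g x +
        2 * Complex.I * conj (x l.castSucc) * dz (Fin.last n) g x)) +
      ∑ k, coef k * (t * conj (x k) * g x) := by
    have h1 : dbarStarForm p t (tangForm q K₀ g) x J =
        -∑ k, coef k * (dz k g x - t * conj (x k) * g x) := by
      simp only [dbarStarForm]
      rw [Finset.sum_comm]
      congr 1
      refine Finset.sum_congr rfl fun k _ => ?_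
      rw [hcoef, Finset.sum_mul]
      refine Finset.sum_congr rfl fun K _ => ?_
      have h2 : dz k (fun y => tangForm q K₀ g y K) x =
          dz k g x * contractForm q (siegelNormal x) K₀ K +
            g x * dz k (fun y => contractForm q (siegelNormal y) K₀ K) x :=
        dz_mul (hg.differentiable (by simp) x)
          ((contDiff_contractForm_apply K₀ K).differentiable (by simp) x) k
      rw [h2, dz_contractForm, tangForm_apply]
      ring
    have h3 : ∑ k, coef k * dz k g x = ∑ l : Fin n, coef l.castSucc * (dz l.castSucc g x +
        2 * Complex.I * conj (x l.castSucc) * dz (Fin.last n) g x) := by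
      rw [Fin.sum_univ_castSucc, hlast, Finset.mul_sum, Finset.sum_mul, ← Finset.sum_add_distrib]
      refine Finset.sum_congr rfl fun l _ => ?_
      ring
    rw [h1, ← h3]
    simp only [mul_sub, Finset.sum_sub_distrib]
    ring
  rw [e]
  have b1 : ‖∑ l : Fin n, coef l.castSucc * (dz l.castSucc g x +
        2 * Complex.I * conj (x l.castSucc) * dz (Fin.last n) g x)‖ ≤ n * (B * D) := by
    refine (norm_sum_le _ _).trans ((Finset.sum_le_sum fun l _ => ?_).trans_eq
      (b := ∑ _l : Fin n, B * D) (by simp))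
    rw [norm_mul]
    exact mul_le_mul (hcoefB _) (hD l) (norm_nonneg _) hB0
  have b2 : ‖∑ k, coef k * (t * conj (x k) * g x)‖ ≤ (n + 1) * (B * D) := by
    refine (norm_sum_le _ _).trans ((Finset.sum_le_sum fun k _ => ?_).trans_eq
      (b := ∑ _k : Fin (n + 1), B * D) (by simp))
    rw [norm_mul]
    exact mul_le_mul (hcoefB _) (ht k) (norm_nonneg _) hB0
  refine (norm_add_le _ _).trans ?_
  rw [norm_neg]
  linarith

end TangentialForms

/-! ### Wirtinger derivatives: holomorphic functions and size bounds -/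

section Holomorphic

variable {N : ℕ}

theorem HasFDerivAt.dz_eq_of_complex {h : CSpace N → ℂ} {h' : CSpace N →L[ℂ] ℂ} {x : CSpace N}
    (hh : HasFDerivAt h h' x) (k : Fin N) : dz k h x = h' (EuclideanSpace.single k 1) := by
  rw [(hh.restrictScalars ℝ).dz_eq, ← I_smul_single]
  simp
  ring_nf
  simp
  ring

theorem HasFDerivAt.dzbar_eq_zero_of_complex {h : CSpace N → ℂ} {h' : CSpace N →L[ℂ] ℂ}
    {x : CSpace N} (hh : HasFDerivAt h h' x) (k : Fin N) : dzbar k h x = 0 := by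
  rw [(hh.restrictScalars ℝ).dzbar_eq, ← I_smul_single]
  simp
  ring_nf
  simp

theorem norm_dz_le {f : CSpace N → ℂ} {x : CSpace N} {b : ℝ} {k : Fin N}
    (hb : ∀ a : ℂ, ‖a‖ = 1 → ‖fderiv ℝ f x (EuclideanSpace.single k a)‖ ≤ b) :
    ‖dz k f x‖ ≤ b := by
  rw [dz, norm_mul]
  have h1 := hb 1 (by simp)
  have h2 := hb Complex.I (by simp)
  have h3 := norm_sub_le (fderiv ℝ f x (EuclideanSpace.single k 1))
    (Complex.I * fderiv ℝ f x (EuclideanSpace.single k Complex.I))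
  rw [norm_mul, Complex.norm_I, one_mul] at h3
  have h4 : ‖(1 / 2 : ℂ)‖ = 1 / 2 := by simp
  rw [h4]
  linarith

theorem norm_dzbar_le {f : CSpace N → ℂ} {x : CSpace N} {b : ℝ} {k : Fin N}
    (hb : ∀ a : ℂ, ‖a‖ = 1 → ‖fderiv ℝ f x (EuclideanSpace.single k a)‖ ≤ b) :
    ‖dzbar k f x‖ ≤ b := by
  rw [dzbar, norm_mul]
  have h1 := hb 1 (by simp)
  have h2 := hb Complex.I (by simp)
  have h3 := norm_add_le (fderiv ℝ f x (EuclideanSpace.single k 1))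
    (Complex.I * fderiv ℝ f x (EuclideanSpace.single k Complex.I))
  rw [norm_mul, Complex.norm_I, one_mul] at h3
  have h4 : ‖(1 / 2 : ℂ)‖ = 1 / 2 := by simp
  rw [h4]
  linarith

end Holomorphic

/-! ### Heisenberg translations and the peaking test functions -/

section TestFunctions

variable {n : ℕ}

/-- The linear part of the Heisenberg translation to the boundary point `heisCenter`, with the
`z`-variables dilated by `1/ε`. -/
def heisLin (i₀ : Fin n) (R ε : ℝ) : CSpace (n + 1) →L[ℂ] CSpace (n + 1) :=
  LinearMap.toContinuousLinearMap
    { toFun := fun v => WithLp.toLp 2 fun k => if k = Fin.last n then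
        v (Fin.last n) - 2 * Complex.I * R * v i₀.castSucc else v k / ε
      map_add' := by
        intro v w
        ext k
        by_cases hk : k = Fin.last n
        · simp [hk]
          ring
        · simp [hk]
          ring
      map_smul' := by
        intro c v
        ext k
        by_cases hk : k = Fin.last n
        · simp [hk]
          ring
        · simp [hk]
          ring }

theorem heisLin_last (i₀ : Fin n) (R ε : ℝ) (v : CSpace (n + 1)) :
    heisLin i₀ R ε v (Fin.last n) = v (Fin.last n) - 2 * Complex.I * R * v i₀.castSucc := by
  simp [heisLin]

theorem heisLin_castSucc (i₀ : Fin n) (R ε : ℝ) (v : CSpace (n + 1)) (l : Fin n) :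
    heisLin i₀ R ε v l.castSucc = v l.castSucc / ε := by
  simp [heisLin, (Fin.castSucc_lt_last l).ne]

/-- The boundary point `(R e_{i₀}, i R²)`. -/
def heisCenter (i₀ : Fin n) (R : ℝ) : CSpace (n + 1) :=
  EuclideanSpace.single i₀.castSucc (R : ℂ) + EuclideanSpace.single (Fin.last n) (Complex.I * R ^ 2)

theorem heisCenter_last (i₀ : Fin n) (R : ℝ) :
    heisCenter i₀ R (Fin.last n) = Complex.I * R ^ 2 := by
  simp [heisCenter, (Fin.castSucc_lt_last i₀).ne']

theorem heisCenter_castSucc (i₀ : Fin n) (R : ℝ) (l : Fin n) :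
    heisCenter i₀ R l.castSucc = if l = i₀ then (R : ℂ) else 0 := by
  by_cases h : l = i₀
  · simp [heisCenter, h, (Fin.castSucc_lt_last i₀).ne]
  · simp [heisCenter, h, (Fin.castSucc_lt_last l).ne]

/-- The affine map `x ↦ (z'/ε, w')`, `(z', w')` being the Heisenberg translate of `x`. -/
def heisMap (i₀ : Fin n) (R ε : ℝ) (x : CSpace (n + 1)) : CSpace (n + 1) :=
  heisLin i₀ R ε (x - heisCenter i₀ R)

theorem heisMap_castSucc (i₀ : Fin n) (R ε : ℝ) (x : CSpace (n + 1)) (l : Fin n) :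
    heisMap i₀ R ε x l.castSucc = (x l.castSucc - if l = i₀ then (R : ℂ) else 0) / ε := by
  rw [heisMap, heisLin_castSucc, PiLp.sub_apply, heisCenter_castSucc]

theorem heisMap_last (i₀ : Fin n) (R ε : ℝ) (x : CSpace (n + 1)) :
    heisMap i₀ R ε x (Fin.last n) =
      x (Fin.last n) - 2 * Complex.I * R * x i₀.castSucc + Complex.I * R ^ 2 := by
  rw [heisMap, heisLin_last, PiLp.sub_apply, PiLp.sub_apply, heisCenter_castSucc, heisCenter_last]
  simp
  ring

/-- The Heisenberg translation preserves the defining function. -/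
theorem heisMap_last_im (i₀ : Fin n) (R : ℝ) {ε : ℝ} (hε : 0 < ε) (x : CSpace (n + 1)) :
    (heisMap i₀ R ε x (Fin.last n)).im = ε ^ 2 * zNormSq (heisMap i₀ R ε x) - siegelFun x := by
  have h : ε ^ 2 * zNormSq (heisMap i₀ R ε x) =
      zNormSq x - 2 * R * (x i₀.castSucc).re + R ^ 2 := by
    have h1 : ∀ l : Fin n, ε ^ 2 * ‖heisMap i₀ R ε x l.castSucc‖ ^ 2 = ‖x l.castSucc‖ ^ 2 +
        if l = i₀ then (- 2 * R * (x i₀.castSucc).re + R ^ 2) else 0 := by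
      intro l
      rw [heisMap_castSucc, norm_div, Complex.norm_real, Real.norm_of_nonneg hε.le, div_pow,
        mul_div_cancel₀ _ (by positivity)]
      by_cases hl : l = i₀
      · subst hl
        simp only [if_true, Complex.sq_norm, Complex.normSq_apply, Complex.sub_re, Complex.sub_im,
          Complex.ofReal_re, Complex.ofReal_im]
        ring
      · simp [hl]
    rw [zNormSq, Finset.mul_sum, zNormSq]
    simp only [h1, Finset.sum_add_distrib]
    simp
    ring
  rw [h, heisMap_last, siegelFun]
  simp [← Complex.ofReal_pow]
  ring

theorem hasFDerivAt_heisMap (i₀ : Fin n) (R ε : ℝ) (x : CSpace (n + 1)) :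
    HasFDerivAt (heisMap i₀ R ε) (heisLin i₀ R ε) x :=
  (heisLin i₀ R ε).hasFDerivAt.comp x ((hasFDerivAt_id x).sub_const _)

theorem norm_heisLin_single_last (i₀ : Fin n) (R ε : ℝ) {a : ℂ} (ha : ‖a‖ = 1) :
    ‖heisLin i₀ R ε (EuclideanSpace.single (Fin.last n) a)‖ = 1 := by
  have : heisLin i₀ R ε (EuclideanSpace.single (Fin.last n) a) =
      EuclideanSpace.single (Fin.last n) a := by
    ext k
    refine Fin.lastCases ?_ (fun l => ?_) k
    · rw [heisLin_last]
      simp [(Fin.castSucc_lt_last i₀).ne]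
    · rw [heisLin_castSucc]
      simp [(Fin.castSucc_lt_last l).ne]
  rw [this]
  simp [ha]

/-- A z-direction contributes 1/ε through the dilation and at most 2R ≤ 2/ε through the shear of w.
-/
theorem norm_heisLin_single_le (i₀ : Fin n) {R ε : ℝ} (hR : 1 ≤ R) (hε : 0 < ε)
    (h1 : 100 * R ^ 3 * ε ≤ 1) (k : Fin (n + 1)) {a : ℂ} (ha : ‖a‖ = 1) :
    ‖heisLin i₀ R ε (EuclideanSpace.single k a)‖ ≤ 3 / ε := by
  have hRε : R * ε ≤ 1 := by nlinarith [mul_pos (by linarith : 0 < R) hε, pow_le_pow_right₀ hR (by norm_num : 1 ≤ 3)]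
  have hε1 : ε ≤ 1 := by nlinarith
  refine Fin.lastCases ?_ (fun l => ?_) k
  · rw [norm_heisLin_single_last i₀ R ε ha, le_div_iff₀ hε]
    linarith
  · have : heisLin i₀ R ε (EuclideanSpace.single l.castSucc a) =
        EuclideanSpace.single l.castSucc (a / ε) + EuclideanSpace.single (Fin.last n)
          (if l = i₀ then -(2 * Complex.I * R * a) else 0) := by
      ext k
      refine Fin.lastCases ?_ (fun m => ?_) k
      · rw [heisLin_last]
        by_cases hl : l = i₀
        · simp [hl, (Fin.castSucc_lt_last i₀).ne']
        · simp [hl, Ne.symm hl, (Fin.castSucc_lt_last l).ne']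
      · rw [heisLin_castSucc]
        by_cases hm : m = l
        · simp [hm, (Fin.castSucc_lt_last l).ne]
        · simp [hm, (Fin.castSucc_lt_last m).ne]
    rw [this]
    refine (norm_add_le _ _).trans ?_
    rw [PiLp.norm_single, PiLp.norm_single, norm_div, ha, Complex.norm_real,
      Real.norm_of_nonneg hε.le]
    have h2 : ‖(if l = i₀ then -(2 * Complex.I * R * a) else 0 : ℂ)‖ ≤ 2 / ε := by
      have : 2 * R ≤ 2 / ε := by
        rw [le_div_iff₀ hε]
        linarith
      split_ifs
      · simp [ha, abs_of_pos (by linarith : 0 < R)]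
        exact this
      · simp
        positivity
    calc 1 / ε + _ ≤ 1 / ε + 2 / ε := by gcongr
      _ = 3 / ε := by ring

/-- A fixed smooth cutoff function. -/
def heisBump (n : ℕ) : ContDiffBump (0 : CSpace (n + 1)) := ⟨1, 2, by norm_num, by norm_num⟩

theorem exists_bound_fderiv_heisBump (n : ℕ) :
    ∃ B : ℝ, 0 < B ∧ ∀ y, ‖fderiv ℝ (heisBump n) y‖ ≤ B := by
  have h1 : Continuous (fderiv ℝ (heisBump n)) :=
    ((heisBump n).contDiff (n := 1)).continuous_fderiv (by norm_num)
  obtain ⟨B, hB⟩ := h1.bounded_above_of_compact_support ((heisBump n).hasCompactSupport.fderiv ℝ)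
  exact ⟨max B 1, by positivity, fun y => (hB y).trans (le_max_left _ _)⟩

/-- The peaking factor `exp(i w'/ε²)`. -/
def heisPeak (i₀ : Fin n) (R ε : ℝ) (x : CSpace (n + 1)) : ℂ :=
  Complex.exp (Complex.I / ε ^ 2 * heisMap i₀ R ε x (Fin.last n))

/-- The test function `χ(z'/ε, w') exp(i w'/ε²)`. -/
def heisTest (i₀ : Fin n) (R ε : ℝ) (x : CSpace (n + 1)) : ℂ :=
  (heisBump n (heisMap i₀ R ε x) : ℂ) * heisPeak i₀ R ε x

theorem norm_heisPeak (i₀ : Fin n) (R ε : ℝ) (x : CSpace (n + 1)) :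
    ‖heisPeak i₀ R ε x‖ = Real.exp (-(heisMap i₀ R ε x (Fin.last n)).im / ε ^ 2) := by
  rw [heisPeak, Complex.norm_exp]
  congr 1
  have : Complex.I / (ε : ℂ) ^ 2 = ((ε ^ 2)⁻¹ : ℝ) * Complex.I := by
    push_cast
    ring
  rw [this, mul_assoc, Complex.re_ofReal_mul]
  simp
  ring

theorem hasFDerivAt_heisPeak (i₀ : Fin n) (R ε : ℝ) (x : CSpace (n + 1)) :
    HasFDerivAt (heisPeak i₀ R ε) (heisPeak i₀ R ε x • (Complex.I / (ε : ℂ) ^ 2) •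
      (EuclideanSpace.proj (Fin.last n) : CSpace (n + 1) →L[ℂ] ℂ).comp (heisLin i₀ R ε)) x := by
  have h1 : HasFDerivAt (fun x => heisMap i₀ R ε x (Fin.last n))
      ((EuclideanSpace.proj (Fin.last n) : CSpace (n + 1) →L[ℂ] ℂ).comp (heisLin i₀ R ε)) x :=
    (EuclideanSpace.proj (Fin.last n) : CSpace (n + 1) →L[ℂ] ℂ).hasFDerivAt.comp x
      (hasFDerivAt_heisMap i₀ R ε x)
  exact (h1.const_mul (Complex.I / (ε : ℂ) ^ 2)).cexp

theorem contDiff_heisMap (i₀ : Fin n) (R ε : ℝ) : ContDiff ℝ ∞ (heisMap i₀ R ε) :=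
  ((heisLin i₀ R ε).restrictScalars ℝ).contDiff.comp (contDiff_id.sub contDiff_const)

theorem contDiff_heisCutoff (i₀ : Fin n) (R ε : ℝ) :
    ContDiff ℝ ∞ fun x => (heisBump n (heisMap i₀ R ε x) : ℂ) :=
  Complex.ofRealCLM.contDiff.comp ((heisBump n).contDiff.comp (contDiff_heisMap i₀ R ε))

theorem contDiff_heisTest (i₀ : Fin n) (R ε : ℝ) : ContDiff ℝ ∞ (heisTest i₀ R ε) := by
  refine (contDiff_heisCutoff i₀ R ε).mul ?_
  refine ContDiff.cexp (contDiff_const.mul ?_)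
  exact (contDiff_coordinate (Fin.last n)).comp (contDiff_heisMap i₀ R ε)

theorem norm_coord_of_norm_heisMap_le {i₀ : Fin n} {R ε : ℝ} (hε : 0 < ε)
    {x : CSpace (n + 1)} {c : ℝ} (hx : ‖heisMap i₀ R ε x‖ ≤ c) (l : Fin n) :
    ‖x l.castSucc - if l = i₀ then (R : ℂ) else 0‖ ≤ c * ε := by
  have h := (PiLp.norm_apply_le (heisMap i₀ R ε x) l.castSucc).trans hx
  rwa [heisMap_castSucc, norm_div, Complex.norm_real, Real.norm_of_nonneg hε.le,
    div_le_iff₀ hε] at h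

theorem norm_castSucc_le {i₀ : Fin n} {R ε : ℝ} (hR : 1 ≤ R) (hε : 0 < ε)
    {x : CSpace (n + 1)} (hx : ‖heisMap i₀ R ε x‖ ≤ 2) (l : Fin n) :
    ‖x l.castSucc‖ ≤ R + 2 * ε := by
  have h := norm_coord_of_norm_heisMap_le hε hx l
  have h2 : ‖(if l = i₀ then (R : ℂ) else 0)‖ ≤ R := by
    split_ifs
    · simp [abs_of_pos (by linarith : 0 < R)]
    · simp
      linarith
  calc ‖x l.castSucc‖ = ‖(x l.castSucc - if l = i₀ then (R : ℂ) else 0) +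
        (if l = i₀ then (R : ℂ) else 0)‖ := by rw [sub_add_cancel]
    _ ≤ 2 * ε + R := (norm_add_le _ _).trans (add_le_add h h2)
    _ = R + 2 * ε := add_comm _ _

theorem norm_coordinate_le {i₀ : Fin n} {R ε : ℝ} (hR : 1 ≤ R) (hε : 0 < ε)
    (h1 : 100 * R ^ 3 * ε ≤ 1) {x : CSpace (n + 1)} (hx : ‖heisMap i₀ R ε x‖ ≤ 2)
    (k : Fin (n + 1)) : ‖x k‖ ≤ 9 * R ^ 2 := by
  have hR3 : 1 ≤ R ^ 3 := one_le_pow₀ hR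
  have hε1 : ε ≤ 1 / 100 := by nlinarith
  refine Fin.lastCases ?_ (fun l => ?_) k
  · have h2 := (PiLp.norm_apply_le (heisMap i₀ R ε x) (Fin.last n)).trans hx
    have h3 := norm_castSucc_le hR hε hx i₀
    have e : x (Fin.last n) = heisMap i₀ R ε x (Fin.last n) + 2 * Complex.I * R * x i₀.castSucc
        - Complex.I * R ^ 2 := by
      rw [heisMap_last]
      ring
    rw [e]
    refine (norm_sub_le _ _).trans ((add_le_add_left (norm_add_le _ _) _).trans ?_)
    have h4 : ‖2 * Complex.I * (R : ℂ) * x i₀.castSucc‖ ≤ 2 * R * (R + 2 * ε) := by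
      simp only [norm_mul, Complex.norm_I, Complex.norm_real, Complex.norm_ofNat,
        Real.norm_of_nonneg (by linarith : 0 ≤ R), mul_one]
      gcongr
    have h5 : ‖Complex.I * (R : ℂ) ^ 2‖ = R ^ 2 := by simp
    rw [h5]
    nlinarith
  · have h3 := norm_castSucc_le hR hε hx l
    nlinarith

theorem hasCompactSupport_heisTest (i₀ : Fin n) {R ε : ℝ} (hR : 1 ≤ R) (hε : 0 < ε)
    (h1 : 100 * R ^ 3 * ε ≤ 1) : HasCompactSupport (heisTest i₀ R ε) := by
  refine HasCompactSupport.intro (isCompact_closedBall (0 : CSpace (n + 1))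
    (√(n + 1) * (9 * R ^ 2))) fun x hx => ?_
  have h2 : 2 < ‖heisMap i₀ R ε x‖ := by
    by_contra hcon
    apply hx
    rw [mem_closedBall_zero_iff]
    refine le_of_sq_le_sq ?_ (by positivity)
    rw [EuclideanSpace.norm_sq_eq, mul_pow, Real.sq_sqrt (by positivity)]
    refine (Finset.sum_le_sum fun k _ => pow_le_pow_left₀ (norm_nonneg _)
      (norm_coordinate_le hR hε h1 (not_lt.1 hcon) k) 2).trans_eq ?_
    simp
  have h3 : heisBump n (heisMap i₀ R ε x) = 0 := by
    refine (heisBump n).zero_of_le_dist ?_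
    rw [dist_zero_right]
    exact h2.le
  simp [heisTest, h3]

end TestFunctions

/-! ### Pointwise bounds for the test forms -/

section TestFunctionBounds

variable {n : ℕ}

theorem fderiv_heisCutoff_apply (i₀ : Fin n) (R ε : ℝ) (x v : CSpace (n + 1)) :
    fderiv ℝ (fun y => (heisBump n (heisMap i₀ R ε y) : ℂ)) x v =
      (fderiv ℝ (heisBump n) (heisMap i₀ R ε x) (heisLin i₀ R ε v) : ℂ) := by
  have h1 : HasFDerivAt (fun y => heisBump n (heisMap i₀ R ε y))
      ((fderiv ℝ (heisBump n) (heisMap i₀ R ε x)).comp ((heisLin i₀ R ε).restrictScalars ℝ)) x :=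
    (((heisBump n).contDiff (n := 1)).differentiable (by norm_num) _).hasFDerivAt.comp x
      ((hasFDerivAt_heisMap i₀ R ε x).restrictScalars ℝ)
  rw [fderiv_ofReal_apply h1.differentiableAt, h1.fderiv]
  rfl

theorem norm_fderiv_heisCutoff_le {B : ℝ} (hB : ∀ y, ‖fderiv ℝ (heisBump n) y‖ ≤ B)
    (i₀ : Fin n) (R ε : ℝ) (x v : CSpace (n + 1)) :
    ‖fderiv ℝ (fun y => (heisBump n (heisMap i₀ R ε y) : ℂ)) x v‖ ≤ B * ‖heisLin i₀ R ε v‖ := by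
  rw [fderiv_heisCutoff_apply, Complex.norm_real]
  exact ((fderiv ℝ (heisBump n) _).le_opNorm _).trans
    (mul_le_mul_of_nonneg_right (hB _) (norm_nonneg _))

theorem heisTest_eq_zero {i₀ : Fin n} {R ε : ℝ} {x : CSpace (n + 1)}
    (hx : 2 < ‖heisMap i₀ R ε x‖) : heisTest i₀ R ε x = 0 := by
  have h3 : heisBump n (heisMap i₀ R ε x) = 0 := by
    refine (heisBump n).zero_of_le_dist ?_
    rw [dist_zero_right]
    exact hx.le
  simp [heisTest, h3]

theorem notMem_tsupport_heisTest {i₀ : Fin n} {R ε : ℝ} {x : CSpace (n + 1)}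
    (hx : 2 < ‖heisMap i₀ R ε x‖) : x ∉ tsupport (heisTest i₀ R ε) := by
  have hsub : tsupport (heisTest i₀ R ε) ⊆ {x | ‖heisMap i₀ R ε x‖ ≤ 2} := by
    refine closure_minimal (fun y hy => ?_)
      (isClosed_le (contDiff_heisMap i₀ R ε).continuous.norm continuous_const)
    by_contra hcon
    exact hy (heisTest_eq_zero (not_le.1 hcon))
  exact fun h => not_lt.2 (hsub h) hx

theorem norm_heisTest_le (i₀ : Fin n) (R ε : ℝ) (x : CSpace (n + 1)) :
    ‖heisTest i₀ R ε x‖ ≤ ‖heisPeak i₀ R ε x‖ := by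
  rw [heisTest, norm_mul, Complex.norm_real, Real.norm_of_nonneg (heisBump n).nonneg]
  exact mul_le_of_le_one_left (norm_nonneg _) (heisBump n).le_one

/-- The peak is holomorphic, so the large factor 1/ε² never appears; only the cutoff is
differentiated. -/
theorem norm_dzbar_heisTest_le {B : ℝ} (hB : ∀ y, ‖fderiv ℝ (heisBump n) y‖ ≤ B)
    (i₀ : Fin n) {R ε : ℝ} (hR : 1 ≤ R) (hε : 0 < ε) (h1 : 100 * R ^ 3 * ε ≤ 1)
    (x : CSpace (n + 1)) (k : Fin (n + 1)) :
    ‖dzbar k (heisTest i₀ R ε) x‖ ≤ 3 * B / ε * ‖heisPeak i₀ R ε x‖ := by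
  have hB0 : 0 ≤ B := (norm_nonneg _).trans (hB 0)
  have hp := hasFDerivAt_heisPeak i₀ R ε x
  have e : dzbar k (heisTest i₀ R ε) x =
      dzbar k (fun y => (heisBump n (heisMap i₀ R ε y) : ℂ)) x * heisPeak i₀ R ε x +
        (heisBump n (heisMap i₀ R ε x) : ℂ) * dzbar k (heisPeak i₀ R ε) x :=
    dzbar_mul ((contDiff_heisCutoff i₀ R ε).differentiable (by simp) x)
      (hp.restrictScalars ℝ).differentiableAt k
  rw [e, hp.dzbar_eq_zero_of_complex, mul_zero, add_zero, norm_mul]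
  gcongr
  refine norm_dzbar_le fun a ha => ?_
  calc _ ≤ B * ‖heisLin i₀ R ε (EuclideanSpace.single k a)‖ :=
        norm_fderiv_heisCutoff_le hB i₀ R ε x _
    _ ≤ B * (3 / ε) := by
        gcongr
        exact norm_heisLin_single_le i₀ hR hε h1 k ha
    _ = 3 * B / ε := by ring

/-- On the peak each single derivative costs 1/ε², but the tangential combination applied to w' is
2i z̄'_l, of size O(ε) on the support. -/
theorem norm_tangential_heisTest_le {B : ℝ} (hB : ∀ y, ‖fderiv ℝ (heisBump n) y‖ ≤ B)
    (i₀ : Fin n) {R ε : ℝ} (hR : 1 ≤ R) (hε : 0 < ε) (h1 : 100 * R ^ 3 * ε ≤ 1)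
    {x : CSpace (n + 1)} (hx : ‖heisMap i₀ R ε x‖ ≤ 2) (l : Fin n) :
    ‖dz l.castSucc (heisTest i₀ R ε) x +
      2 * Complex.I * conj (x l.castSucc) * dz (Fin.last n) (heisTest i₀ R ε) x‖ ≤
        (4 * B + 4) / ε * ‖heisPeak i₀ R ε x‖ := by
  have hB0 : 0 ≤ B := (norm_nonneg _).trans (hB 0)
  have hR3 : 1 ≤ R ^ 3 := one_le_pow₀ hR
  have hR13 : R ≤ R ^ 3 := le_self_pow₀ hR (by norm_num)
  have hε1 : ε ≤ 1 / 100 := by nlinarith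
  have hRε : R * ε ≤ 1 / 100 := by nlinarith
  have hp := hasFDerivAt_heisPeak i₀ R ε x
  set χ : CSpace (n + 1) → ℂ := fun y => (heisBump n (heisMap i₀ R ε y) : ℂ) with hχ
  set E := heisPeak i₀ R ε x with hE
  have e : ∀ k, dz k (heisTest i₀ R ε) x = dz k χ x * E + χ x * dz k (heisPeak i₀ R ε) x :=
    fun k => dz_mul ((contDiff_heisCutoff i₀ R ε).differentiable (by simp) x)
      (hp.restrictScalars ℝ).differentiableAt k
  have e1 : dz l.castSucc (heisPeak i₀ R ε) x =
      E * (Complex.I / (ε : ℂ) ^ 2 * (-(2 * Complex.I * R * if l = i₀ then 1 else 0))) := by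
    rw [hp.dz_eq_of_complex]
    simp only [smul_apply, ContinuousLinearMap.comp_apply, smul_eq_mul]
    congr 2
    show heisLin i₀ R ε _ (Fin.last n) = _
    rw [heisLin_last]
    by_cases h : l = i₀
    · simp [h, (Fin.castSucc_lt_last i₀).ne']
    · simp [h, Ne.symm h, (Fin.castSucc_lt_last l).ne']
  have e2 : dz (Fin.last n) (heisPeak i₀ R ε) x = E * (Complex.I / (ε : ℂ) ^ 2) := by
    rw [hp.dz_eq_of_complex]
    simp only [smul_apply, ContinuousLinearMap.comp_apply, smul_eq_mul]
    have : (EuclideanSpace.proj (Fin.last n) : CSpace (n + 1) →L[ℂ] ℂ)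
        (heisLin i₀ R ε (EuclideanSpace.single (Fin.last n) 1)) = 1 := by
      show heisLin i₀ R ε _ (Fin.last n) = _
      rw [heisLin_last]
      simp [(Fin.castSucc_lt_last i₀).ne]
    rw [this, mul_one]
  have hsplit : dz l.castSucc (heisTest i₀ R ε) x +
      2 * Complex.I * conj (x l.castSucc) * dz (Fin.last n) (heisTest i₀ R ε) x =
      dz l.castSucc χ x * E + 2 * Complex.I * conj (x l.castSucc) * dz (Fin.last n) χ x * E +
        χ x * E * (-2 / (ε : ℂ) ^ 2 * conj (x l.castSucc - if l = i₀ then (R : ℂ) else 0)) := by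
    rw [e, e, e1, e2]
    have : conj (x l.castSucc - if l = i₀ then (R : ℂ) else 0) =
        conj (x l.castSucc) - R * if l = i₀ then 1 else 0 := by
      split_ifs <;> simp
    rw [this]
    ring_nf
    simp only [Complex.I_sq]
    ring
  have b1 : ‖dz l.castSucc χ x‖ ≤ 3 * B / ε := by
    refine norm_dz_le fun a ha => ?_
    calc _ ≤ B * ‖heisLin i₀ R ε (EuclideanSpace.single l.castSucc a)‖ :=
          norm_fderiv_heisCutoff_le hB i₀ R ε x _
      _ ≤ B * (3 / ε) := by
          gcongr
          exact norm_heisLin_single_le i₀ hR hε h1 _ ha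
      _ = 3 * B / ε := by ring
  have b2 : ‖dz (Fin.last n) χ x‖ ≤ B := by
    refine norm_dz_le fun a ha => ?_
    have := norm_fderiv_heisCutoff_le hB i₀ R ε x (EuclideanSpace.single (Fin.last n) a)
    rwa [norm_heisLin_single_last i₀ R ε ha, mul_one] at this
  have b3 : ‖χ x‖ ≤ 1 := by
    simp only [hχ, Complex.norm_real, Real.norm_of_nonneg (heisBump n).nonneg]
    exact (heisBump n).le_one
  have b4 := norm_coord_of_norm_heisMap_le hε hx l
  have b5 := norm_castSucc_le hR hε hx l
  have hE0 := norm_nonneg E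
  rw [hsplit]
  -- The variable w' is not dilated, so ∂_w χ stays bounded, and the factor 2|z_l|, of order R, is
  -- at most 1/ε.
  have c2 : ‖2 * Complex.I * conj (x l.castSucc) * dz (Fin.last n) χ x * E‖ ≤ B / ε * ‖E‖ := by
    rw [norm_mul]
    gcongr
    simp only [norm_mul, Complex.norm_I, Complex.norm_ofNat, mul_one, RCLike.norm_conj]
    calc 2 * ‖x l.castSucc‖ * ‖dz (Fin.last n) χ x‖ ≤ 2 * (R + 2 * ε) * B := by gcongr
      _ ≤ 1 / ε * B := by
          gcongr
          rw [le_div_iff₀ hε]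
          nlinarith
      _ = B / ε := by ring
  have c3 : ‖χ x * E * (-2 / (ε : ℂ) ^ 2 * conj (x l.castSucc - if l = i₀ then (R : ℂ) else 0))‖ ≤
      4 / ε * ‖E‖ := by
    rw [norm_mul, norm_mul, norm_mul, RCLike.norm_conj]
    have : ‖(-2 / (ε : ℂ) ^ 2)‖ = 2 / ε ^ 2 := by simp
    rw [this]
    calc _ ≤ 1 * ‖E‖ * (2 / ε ^ 2 * (2 * ε)) := by gcongr
      _ = 4 / ε * ‖E‖ := by
          field_simp
          ring
  calc _ ≤ ‖dz l.castSucc χ x * E‖ +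
        ‖2 * Complex.I * conj (x l.castSucc) * dz (Fin.last n) χ x * E‖ + _ := norm_add₃_le
    _ ≤ 3 * B / ε * ‖E‖ + B / ε * ‖E‖ + 4 / ε * ‖E‖ := by
        rw [norm_mul]
        gcongr
    _ = (4 * B + 4) / ε * ‖E‖ := by ring

/-- The pointwise bound of `∂̄f` and `∂̄*_t f` for the test forms. -/
theorem exists_bound_heisTest (n q : ℕ) (hq : 1 ≤ q) : ∃ C : ℝ, 0 < C ∧
    ∀ (i₀ : Fin n) (K₀ : Finset (Fin (n + 1))) (R ε t : ℝ), 1 ≤ R → 0 < ε → 0 ≤ t →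
      100 * R ^ 3 * ε ≤ 1 → 9 * t * R ^ 2 * ε ≤ 1 → ∀ x : CSpace (n + 1),
        ‖dbarForm (q + 1) (tangForm q K₀ (heisTest i₀ R ε)) x‖ ^ 2 +
          ‖dbarStarForm (q - 1) t (tangForm q K₀ (heisTest i₀ R ε)) x‖ ^ 2 ≤
        {y | ‖heisMap i₀ R ε y‖ ≤ 2}.indicator
          (fun y => C * (R / ε) ^ 2 * ‖heisPeak i₀ R ε y‖ ^ 2) x := by
  obtain ⟨B, hB0, hB⟩ := exists_bound_fderiv_heisBump n
  set c : ℝ := ((Fintype.card {J : Finset (Fin (n + 1)) // J.card = q} : ℕ) : ℝ) with hc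
  set c₁ : ℝ := ((Fintype.card {J : Finset (Fin (n + 1)) // J.card = q + 1} : ℕ) : ℝ) with hc₁
  set c₂ : ℝ := ((Fintype.card {J : Finset (Fin (n + 1)) // J.card = q - 1} : ℕ) : ℝ) with hc₂
  have hc0 : 0 ≤ c := Nat.cast_nonneg _
  have hc10 : 0 ≤ c₁ := Nat.cast_nonneg _
  have hc20 : 0 ≤ c₂ := Nat.cast_nonneg _
  set A₁ : ℝ := c * ((n + 1) * ((4 * B + 4) * ((n + 1) * 3) + 1)) with hA₁
  set A₂ : ℝ := c * ((n + 1) * 3) * ((2 * n + 1) * (4 * B + 4)) with hA₂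
  refine ⟨c₁ * A₁ ^ 2 + c₂ * A₂ ^ 2 + 1, by positivity, ?_⟩
  intro i₀ K₀ R ε t hR hε ht h1 h2 x
  have hR3 : 1 ≤ R ^ 3 := one_le_pow₀ hR
  have hε1 : ε ≤ 1 / 100 := by nlinarith
  have hR0 : 0 < R := by linarith
  by_cases hx : ‖heisMap i₀ R ε x‖ ≤ 2
  · rw [Set.indicator_of_mem (show x ∈ {y | ‖heisMap i₀ R ε y‖ ≤ 2} from hx)]
    set E := ‖heisPeak i₀ R ε x‖ with hE
    have hE0 : 0 ≤ E := norm_nonneg _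
    -- The size of ∂r is of order R; this is the source of the factor R in the bound.
    have hb : ∀ m, ‖siegelNormal x m‖ ≤ 3 * R := by
      intro m
      unfold siegelNormal
      refine Fin.lastCases ?_ (fun l => ?_) m
      · simp
        linarith
      · rw [if_neg (Fin.castSucc_lt_last l).ne, RCLike.norm_conj]
        have := norm_castSucc_le hR hε hx l
        linarith
    have hdzb : ∀ k, ‖dzbar k (heisTest i₀ R ε) x‖ ≤ (4 * B + 4) / ε * E := fun k =>
      (norm_dzbar_heisTest_le hB i₀ hR hε h1 x k).trans (by gcongr; linarith)
    -- The condition 9tR²ε ≤ 1 makes the zeroth-order term of the weighted adjoint no larger than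
    -- the derivative terms.
    have hxt : ∀ k, ‖t * conj (x k) * heisTest i₀ R ε x‖ ≤ (4 * B + 4) / ε * E := by
      intro k
      rw [norm_mul, norm_mul, RCLike.norm_conj, Complex.norm_real, Real.norm_of_nonneg ht]
      calc t * ‖x k‖ * ‖heisTest i₀ R ε x‖ ≤ t * (9 * R ^ 2) * E := by
            gcongr
            · exact norm_coordinate_le hR hε h1 hx k
            · exact norm_heisTest_le i₀ R ε x
        _ ≤ 1 / ε * E := by
            gcongr
            rw [le_div_iff₀ hε]
            linarith
        _ ≤ (4 * B + 4) / ε * E := by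
            gcongr
            linarith
    have hu : ∀ K, ‖dbarForm (q + 1) (tangForm q K₀ (heisTest i₀ R ε)) x K‖ ≤ A₁ * (R / ε * E) := by
      intro K
      refine (norm_dbarForm_tangForm_apply_le (contDiff_heisTest i₀ R ε) hb hdzb
        (norm_heisTest_le i₀ R ε x) K).trans ?_
      have h3 : E ≤ R / ε * E := by
        refine le_mul_of_one_le_left hE0 ?_
        rw [le_div_iff₀ hε]
        linarith
      calc c * ((n + 1) * ((4 * B + 4) / ε * E * ((n + 1) * (3 * R)) + E))
          ≤ c * ((n + 1) * ((4 * B + 4) / ε * E * ((n + 1) * (3 * R)) + R / ε * E)) := by gcongr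
        _ = A₁ * (R / ε * E) := by
            rw [hA₁]
            ring
    have hv : ∀ J, ‖dbarStarForm (q - 1) t (tangForm q K₀ (heisTest i₀ R ε)) x J‖ ≤
        A₂ * (R / ε * E) := by
      intro J
      refine (norm_dbarStarForm_tangForm_apply_le (by omega) (contDiff_heisTest i₀ R ε) hb
        (norm_tangential_heisTest_le hB i₀ hR hε h1 hx) hxt J).trans_eq ?_
      rw [hA₂]
      ring
    calc _ ≤ c₁ * (A₁ * (R / ε * E)) ^ 2 + c₂ * (A₂ * (R / ε * E)) ^ 2 :=
          add_le_add (norm_sq_forms_le hu) (norm_sq_forms_le hv)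
      _ = (c₁ * A₁ ^ 2 + c₂ * A₂ ^ 2) * (R / ε) ^ 2 * E ^ 2 := by ring
      _ ≤ _ := mul_le_mul_of_nonneg_right
          (mul_le_mul_of_nonneg_right (le_add_of_nonneg_right zero_le_one) (sq_nonneg _))
          (sq_nonneg _)
  · rw [Set.indicator_of_notMem (show x ∉ {y | ‖heisMap i₀ R ε y‖ ≤ 2} from hx)]
    have hx' := notMem_tsupport_heisTest (not_le.1 hx)
    have hf : x ∉ tsupport (tangForm q K₀ (heisTest i₀ R ε)) := fun h =>
      hx' (closure_mono (Function.support_smul_subset_left _ _) h)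
    rw [dbarForm_eq_zero_of_notMem_tsupport hf, dbarStarForm_eq_zero_of_notMem_tsupport t hf]
    simp

end TestFunctionBounds

/-! ### The L² size of the peak -/

section VolumeBound

variable {n : ℕ}

/-- Integration over `ℂ^{n+1}` as an iterated integral, up to a universal constant. -/
theorem exists_lintegral_eq_prod (n : ℕ) : ∃ c : NNReal,
    ∀ f : ℂ × (Fin n → ℂ) → ℝ≥0∞, Measurable f →
      ∫⁻ x : CSpace (n + 1), f (x (Fin.last n), fun j => x j.castSucc) =
        c * ∫⁻ z : Fin n → ℂ, ∫⁻ w : ℂ, f (w, z) := by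
  set e := EuclideanSpace.equiv (Fin (n + 1)) ℂ with he
  have : (Measure.map e (volume : Measure (CSpace (n + 1)))).IsAddHaarMeasure :=
    e.isAddHaarMeasure_map volume
  -- Uniqueness of Haar measure gives proportionality to the product measure; the value of the
  -- constant is irrelevant.
  have hmap := Measure.isAddLeftInvariant_eq_smul
    (Measure.map e (volume : Measure (CSpace (n + 1)))) (volume : Measure (Fin (n + 1) → ℂ))
  refine ⟨(Measure.map e (volume : Measure (CSpace (n + 1)))).addHaarScalarFactor volume,
    fun f hf => ?_⟩
  have hpres := volume_preserving_piFinSuccAbove (fun _ : Fin (n + 1) => ℂ) (Fin.last n)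
  have e1 : ∀ y : Fin (n + 1) → ℂ,
      MeasurableEquiv.piFinSuccAbove (fun _ : Fin (n + 1) => ℂ) (Fin.last n) y =
        (y (Fin.last n), fun j => y j.castSucc) := by
    intro y
    refine Prod.ext rfl (funext fun j => ?_)
    show y ((Fin.last n).succAbove j) = _
    rw [Fin.succAbove_last]
  have hF : Measurable fun y : Fin (n + 1) → ℂ => f (y (Fin.last n), fun j => y j.castSucc) := by
    refine hf.comp ?_
    fun_prop
  calc ∫⁻ x : CSpace (n + 1), f (x (Fin.last n), fun j => x j.castSucc)
      = ∫⁻ y, f (y (Fin.last n), fun j => y j.castSucc)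
          ∂(Measure.map e (volume : Measure (CSpace (n + 1)))) :=
        (lintegral_map hF e.continuous.measurable).symm
    _ = _ * ∫⁻ y : Fin (n + 1) → ℂ, f (y (Fin.last n), fun j => y j.castSucc) := by
        conv_lhs => rw [hmap, ENNReal.smul_def, lintegral_smul_measure, smul_eq_mul]
    _ = _ * ∫⁻ z : Fin n → ℂ, ∫⁻ w : ℂ, f (w, z) := by
        congr 1
        rw [← lintegral_prod_symm f hf.aemeasurable, ← Measure.volume_eq_prod]
        rw [← hpres.lintegral_comp hf]
        simp only [e1]

theorem lintegral_halfPlane {a : ℝ} (ha : 0 < a) :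
    ∫⁻ w : ℂ, (Set.Icc (-2 : ℝ) 2).indicator 1 w.re *
      (Set.Ioi (0 : ℝ)).indicator (fun y => ENNReal.ofReal (Real.exp (-a * y))) w.im =
        ENNReal.ofReal (4 / a) := by
  set f : ℝ → ℝ≥0∞ := (Set.Icc (-2 : ℝ) 2).indicator 1 with hf
  set g : ℝ → ℝ≥0∞ :=
    (Set.Ioi (0 : ℝ)).indicator (fun y => ENNReal.ofReal (Real.exp (-a * y))) with hg
  have hfm : Measurable f := measurable_one.indicator measurableSet_Icc
  have hgm : Measurable g := (by fun_prop : Measurable fun y : ℝ =>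
    ENNReal.ofReal (Real.exp (-a * y))).indicator measurableSet_Ioi
  have h1 : ∫⁻ w : ℂ, f w.re * g w.im = ∫⁻ z : ℝ × ℝ, f z.1 * g z.2 := by
    exact Complex.volume_preserving_equiv_real_prod.lintegral_comp
      (f := fun z : ℝ × ℝ => f z.1 * g z.2)
      ((hfm.comp measurable_fst).mul (hgm.comp measurable_snd))
  rw [h1, Measure.volume_eq_prod, lintegral_prod_mul hfm.aemeasurable hgm.aemeasurable, hf, hg,
    lintegral_indicator_one measurableSet_Icc, lintegral_indicator measurableSet_Ioi,
    ← ofReal_integral_eq_lintegral_ofReal (integrableOn_exp_mul_Ioi (by linarith) 0)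
      (Eventually.of_forall fun y => (Real.exp_pos _).le),
    integral_exp_mul_Ioi (by linarith), Real.volume_Icc, ← ENNReal.ofReal_mul (by norm_num)]
  congr 1
  simp
  field_simp
  norm_num

/-- Each z_l ranges over a disc of radius 2ε, which gives ε^(2n). For fixed z, w ↦ w' is a
translation; in the domain Im w' > 0, and the squared peak exp(-2 Im w'/ε²) over the strip |Re w'| ≤
2 gives 2ε². Translation invariance makes the bound independent of R. -/
theorem exists_lintegral_heisPeak_le (n : ℕ) : ∃ C : ℝ, 0 < C ∧
    ∀ (i₀ : Fin n) (R ε : ℝ), 0 < ε →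
      ∫⁻ x in siegel n, {y | ‖heisMap i₀ R ε y‖ ≤ 2}.indicator
        (fun y => ENNReal.ofReal (‖heisPeak i₀ R ε y‖ ^ 2)) x ≤
          ENNReal.ofReal (C * ε ^ (2 * n + 2)) := by
  obtain ⟨c, hc⟩ := exists_lintegral_eq_prod n
  refine ⟨(c + 1) * ((4 * Real.pi) ^ n * 2), by positivity, fun i₀ R ε hε => ?_⟩
  set f : ℝ → ℝ≥0∞ := (Set.Icc (-2 : ℝ) 2).indicator 1 with hf
  set g : ℝ → ℝ≥0∞ :=
    (Set.Ioi (0 : ℝ)).indicator (fun y => ENNReal.ofReal (Real.exp (-(2 / ε ^ 2) * y))) with hg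
  have hfm : Measurable f := measurable_one.indicator measurableSet_Icc
  have hgm : Measurable g := (by fun_prop : Measurable fun y : ℝ =>
    ENNReal.ofReal (Real.exp (-(2 / ε ^ 2) * y))).indicator measurableSet_Ioi
  set ctr : Fin n → ℂ := fun l => if l = i₀ then (R : ℂ) else 0 with hctr
  set b : (Fin n → ℂ) → ℝ≥0∞ := (Metric.closedBall ctr (2 * ε)).indicator 1 with hb
  have hbm : Measurable b := measurable_one.indicator Metric.isClosed_closedBall.measurableSet
  set s : (Fin n → ℂ) → ℂ := fun z => 2 * Complex.I * R * z i₀ - Complex.I * R ^ 2 with hs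
  have hsm : Measurable s := by fun_prop
  set Φ : ℂ × (Fin n → ℂ) → ℝ≥0∞ := fun p =>
    b p.2 * (f (p.1 - s p.2).re * g (p.1 - s p.2).im) with hΦ
  have hΦm : Measurable Φ := by
    refine (hbm.comp measurable_snd).mul ((hfm.comp ?_).mul (hgm.comp ?_))
    · exact Complex.measurable_re.comp (measurable_fst.sub (hsm.comp measurable_snd))
    · exact Complex.measurable_im.comp (measurable_fst.sub (hsm.comp measurable_snd))
  have hle : ∀ x ∈ siegel n, {y | ‖heisMap i₀ R ε y‖ ≤ 2}.indicator
        (fun y => ENNReal.ofReal (‖heisPeak i₀ R ε y‖ ^ 2)) x ≤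
        Φ (x (Fin.last n), fun j => x j.castSucc) := by
    intro x hx
    by_cases hx2 : ‖heisMap i₀ R ε x‖ ≤ 2
    · rw [Set.indicator_of_mem (show x ∈ {y | ‖heisMap i₀ R ε y‖ ≤ 2} from hx2)]
      have hw : x (Fin.last n) - s (fun j => x j.castSucc) = heisMap i₀ R ε x (Fin.last n) := by
        rw [heisMap_last, hs]
        ring
      have hz : (fun j : Fin n => x j.castSucc) ∈ Metric.closedBall ctr (2 * ε) := by
        rw [Metric.mem_closedBall, dist_pi_le_iff (by positivity)]
        intro l
        rw [dist_eq_norm]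
        exact norm_coord_of_norm_heisMap_le hε hx2 l
      have hwn := (PiLp.norm_apply_le (heisMap i₀ R ε x) (Fin.last n)).trans hx2
      have hre : (heisMap i₀ R ε x (Fin.last n)).re ∈ Set.Icc (-2 : ℝ) 2 :=
        abs_le.1 ((Complex.abs_re_le_norm _).trans hwn)
      have him : (heisMap i₀ R ε x (Fin.last n)).im ∈ Set.Ioi (0 : ℝ) := by
        rw [heisMap_last_im i₀ R hε x]
        have h1 := (mem_siegel_iff x).1 hx
        have h2 := zNormSq_nonneg (heisMap i₀ R ε x)
        have h3 : 0 ≤ ε ^ 2 * zNormSq (heisMap i₀ R ε x) := by positivity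
        show (0 : ℝ) < _
        linarith
      simp only [hΦ, hw]
      rw [hb, hf, hg, Set.indicator_of_mem hz, Set.indicator_of_mem hre, Set.indicator_of_mem him,
        norm_heisPeak, ← Real.exp_nat_mul]
      simp only [Pi.one_apply, one_mul]
      refine ENNReal.ofReal_le_ofReal (Real.exp_le_exp.2 (le_of_eq ?_))
      push_cast
      ring
    · rw [Set.indicator_of_notMem (show x ∉ {y | ‖heisMap i₀ R ε y‖ ≤ 2} from hx2)]
      exact zero_le
  calc _ ≤ ∫⁻ x in siegel n, Φ (x (Fin.last n), fun j => x j.castSucc) :=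
        setLIntegral_mono' isOpen_siegel.measurableSet hle
    _ ≤ ∫⁻ x : CSpace (n + 1), Φ (x (Fin.last n), fun j => x j.castSucc) :=
        setLIntegral_le_lintegral _ _
    _ = c * ∫⁻ z : Fin n → ℂ, ∫⁻ w : ℂ, Φ (w, z) := hc Φ hΦm
    _ = c * ∫⁻ z : Fin n → ℂ, b z * ENNReal.ofReal (4 / (2 / ε ^ 2)) := by
        congr 1
        refine lintegral_congr fun z => ?_
        simp only [hΦ]
        rw [lintegral_const_mul' _ _ (by
          rw [hb]
          by_cases h : z ∈ Metric.closedBall ctr (2 * ε) <;> simp [h]),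
          lintegral_sub_right_eq_self (fun w : ℂ => f w.re * g w.im) (s z), hf, hg,
          lintegral_halfPlane (by positivity)]
    _ = c * (((ENNReal.ofReal (2 * ε) ^ 2 * NNReal.pi) ^ n) * ENNReal.ofReal (2 * ε ^ 2)) := by
        rw [lintegral_mul_const _ hbm, hb,
          lintegral_indicator_one Metric.isClosed_closedBall.measurableSet,
          volume_pi_closedBall _ (by positivity)]
        simp only [Complex.volume_closedBall]
        rw [Finset.prod_const, Finset.card_univ, Fintype.card_fin]
        congr 3
        field_simp
        norm_num
    _ ≤ _ := by
        have hpi : (NNReal.pi : ℝ≥0∞) = ENNReal.ofReal Real.pi := by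
          rw [← NNReal.coe_real_pi, ENNReal.ofReal_coe_nnreal]
        have hcc : (c : ℝ≥0∞) = ENNReal.ofReal (c : ℝ) := by rw [ENNReal.ofReal_coe_nnreal]
        rw [hpi, hcc, ← ENNReal.ofReal_pow (by positivity), ← ENNReal.ofReal_mul (by positivity),
          ← ENNReal.ofReal_pow (by positivity), ← ENNReal.ofReal_mul (by positivity),
          ← ENNReal.ofReal_mul (by positivity)]
        refine ENNReal.ofReal_le_ofReal ?_
        have e : (c : ℝ) * (((2 * ε) ^ 2 * Real.pi) ^ n * (2 * ε ^ 2)) =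
            c * ((4 * Real.pi) ^ n * 2) * ε ^ (2 * n + 2) := by
          rw [show (2 * ε) ^ 2 * Real.pi = (4 * Real.pi) * ε ^ 2 by ring, mul_pow, ← pow_mul, pow_add]
          ring
        rw [e]
        gcongr
        linarith

end VolumeBound

/-! ### Lower bound for the boundary area -/

section SurfaceBound

variable {n : ℕ}

/-- The orthogonal projection of `ℂ^{n+1}` that forgets `Re z_{i₀}`; the slot of `Re z_{i₀}` holds
`Im w`. -/
def forgetRe (i₀ : Fin n) (x : CSpace (n + 1)) : (Fin n ⊕ Fin n) ⊕ Unit → ℝ :=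
  Sum.elim (Sum.elim (fun j => (x j.castSucc).im)
    (fun j => if j = i₀ then (x (Fin.last n)).im else (x j.castSucc).re))
    (fun _ => (x (Fin.last n)).re)

theorem lipschitzWith_forgetRe (i₀ : Fin n) : LipschitzWith 1 (forgetRe i₀) := by
  refine LipschitzWith.of_dist_le_mul fun x y => ?_
  rw [NNReal.coe_one, one_mul, dist_pi_le_iff dist_nonneg]
  have hre : ∀ k, dist (x k).re (y k).re ≤ dist x y := fun k => by
    rw [Real.dist_eq, ← Complex.sub_re, dist_eq_norm]
    exact (Complex.abs_re_le_norm _).trans (PiLp.norm_apply_le (x - y) k)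
  have him : ∀ k, dist (x k).im (y k).im ≤ dist x y := fun k => by
    rw [Real.dist_eq, ← Complex.sub_im, dist_eq_norm]
    exact (Complex.abs_im_le_norm _).trans (PiLp.norm_apply_le (x - y) k)
  rintro ((j | j) | j)
  · exact him _
  · simp only [forgetRe, Sum.elim_inl, Sum.elim_inr]
    split_ifs
    · exact him _
    · exact hre _
  · exact hre _

/-- A 1-Lipschitz map does not increase Hausdorff measure. On ℝ^(2n+1) with the sup norm the measure
of this dimension is Lebesgue measure. -/
theorem volume_le_hausdorff_of_subset_forgetRe (i₀ : Fin n) {E : Set (CSpace (n + 1))}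
    {S : Set ((Fin n ⊕ Fin n) ⊕ Unit → ℝ)} (h : S ⊆ forgetRe i₀ '' E) :
    volume S ≤ Measure.hausdorffMeasure ((2 * (n + 1) - 1 : ℕ) : ℝ) E := by
  have h1 := (lipschitzWith_forgetRe i₀).hausdorffMeasure_image_le
    (d := ((2 * (n + 1) - 1 : ℕ) : ℝ)) (by positivity) E
  have hcard : Fintype.card ((Fin n ⊕ Fin n) ⊕ Unit) = 2 * (n + 1) - 1 := by
    simp
    omega
  rw [← hcard, hausdorffMeasure_pi_real, hcard] at h1
  simpa using (measure_mono h).trans h1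

/-- Lower corner of the box in the image of `forgetRe`. -/
def boxLow (i₀ : Fin n) (R κ : ℝ) : (Fin n ⊕ Fin n) ⊕ Unit → ℝ :=
  Sum.elim (Sum.elim (fun _ => -κ) (fun j => if j = i₀ then R ^ 2 + 2 * n * κ ^ 2 else -κ))
    (fun _ => -(1 / 4))

/-- Upper corner of the box in the image of `forgetRe`. -/
def boxHigh (i₀ : Fin n) (R κ : ℝ) : (Fin n ⊕ Fin n) ⊕ Unit → ℝ :=
  Sum.elim (Sum.elim (fun _ => κ) (fun j => if j = i₀ then R ^ 2 + 2 * R * κ else κ))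
    (fun _ => 1 / 4)

/-- The factor R comes from the side in the direction of Im w, whose length 2Rκ - 2nκ² is at least
Rκ. -/
theorem le_volume_box (i₀ : Fin n) {R κ : ℝ} (hR : 1 ≤ R) (hκ : 0 < κ) (h : 2 * n * κ ≤ 1) :
    ENNReal.ofReal (R * κ ^ (2 * n) / 2) ≤
      volume (Set.Icc (boxLow i₀ R κ) (boxHigh i₀ R κ)) := by
  have hR0 : 0 < R := by linarith
  rw [Real.volume_Icc_pi, Fintype.prod_sum_type, Fintype.prod_sum_type]
  have e : ENNReal.ofReal (R * κ ^ (2 * n) / 2) =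
      ((∏ _j : Fin n, ENNReal.ofReal κ) *
        ∏ j : Fin n, ENNReal.ofReal (κ * if j = i₀ then R else 1)) *
          ∏ _j : Unit, ENNReal.ofReal (1 / 2) := by
    rw [← ENNReal.ofReal_prod_of_nonneg (fun _ _ => hκ.le),
      ← ENNReal.ofReal_prod_of_nonneg (fun j _ => by split_ifs <;> positivity),
      ← ENNReal.ofReal_prod_of_nonneg (fun _ _ => by positivity),
      ← ENNReal.ofReal_mul (Finset.prod_nonneg fun _ _ => hκ.le),
      ← ENNReal.ofReal_mul (mul_nonneg (Finset.prod_nonneg fun _ _ => hκ.le)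
        (Finset.prod_nonneg fun j _ => by split_ifs <;> positivity))]
    congr 1
    rw [Finset.prod_mul_distrib, Finset.prod_ite_eq']
    simp
    ring
  rw [e]
  gcongr with j _ j _ j _
  · simp only [boxLow, boxHigh, Sum.elim_inl]
    linarith
  · simp only [boxLow, boxHigh, Sum.elim_inl, Sum.elim_inr]
    split_ifs
    · nlinarith
    · linarith
  · simp only [boxLow, boxHigh, Sum.elim_inr]
    norm_num

/-- Near Re z_{i₀} = R the boundary is a graph over the remaining coordinates: Im w = |z|² is solved
for Re z_{i₀}. As Re z_{i₀} moves by κ, Im w moves by about 2Rκ, which is why this projection sees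
the large area. -/
theorem box_subset (hn : 1 ≤ n) (i₀ : Fin n) {R ε : ℝ} (hR : 1 ≤ R) (hε : 0 < ε)
    (h1 : 100 * R ^ 3 * ε ≤ 1) :
    Set.Icc (boxLow i₀ R (ε / (4 * n))) (boxHigh i₀ R (ε / (4 * n))) ⊆
      forgetRe i₀ '' (frontier (siegel n) ∩ {x | ‖heisMap i₀ R ε x‖ ≤ 1}) := by
  have hn' : (1 : ℝ) ≤ n := by exact_mod_cast hn
  have hn0 : (0 : ℝ) < n := by linarith
  have hR0 : 0 < R := by linarith
  have hR3 : 1 ≤ R ^ 3 := one_le_pow₀ hR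
  have hR13 : R ≤ R ^ 3 := le_self_pow₀ hR (by norm_num)
  have hε1 : ε ≤ 1 / 100 := by nlinarith
  have hRε : R * ε ≤ 1 / 100 := by nlinarith
  set κ := ε / (4 * n) with hκ
  have hκ0 : 0 < κ := by positivity
  have hnκ : n * κ = ε / 4 := by
    rw [hκ]
    field_simp
  have hκε : κ ≤ ε / 4 := by nlinarith
  rintro y ⟨hlo, hhi⟩
  have him : ∀ j : Fin n, |y (Sum.inl (Sum.inl j))| ≤ κ := fun j =>
    abs_le.2 ⟨hlo (Sum.inl (Sum.inl j)), hhi (Sum.inl (Sum.inl j))⟩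
  have hre : ∀ j : Fin n, j ≠ i₀ → |y (Sum.inl (Sum.inr j))| ≤ κ := fun j hj => by
    have a := hlo (Sum.inl (Sum.inr j))
    have b := hhi (Sum.inl (Sum.inr j))
    simp only [boxLow, boxHigh, Sum.elim_inl, Sum.elim_inr, if_neg hj] at a b
    exact abs_le.2 ⟨a, b⟩
  have hv : R ^ 2 + 2 * n * κ ^ 2 ≤ y (Sum.inl (Sum.inr i₀)) ∧
      y (Sum.inl (Sum.inr i₀)) ≤ R ^ 2 + 2 * R * κ := by
    have a := hlo (Sum.inl (Sum.inr i₀))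
    have b := hhi (Sum.inl (Sum.inr i₀))
    simp only [boxLow, boxHigh, Sum.elim_inl, Sum.elim_inr, if_true] at a b
    exact ⟨a, b⟩
  have hu : |y (Sum.inr ())| ≤ 1 / 4 :=
    abs_le.2 ⟨hlo (Sum.inr ()), hhi (Sum.inr ())⟩
  set v := y (Sum.inl (Sum.inr i₀)) with hvdef
  set S : ℝ := ∑ j : Fin n, (y (Sum.inl (Sum.inl j)) ^ 2 +
    if j = i₀ then 0 else y (Sum.inl (Sum.inr j)) ^ 2) with hS
  have hS0 : 0 ≤ S := Finset.sum_nonneg fun j _ => by split_ifs <;> positivity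
  have hS1 : S ≤ 2 * n * κ ^ 2 := by
    refine (Finset.sum_le_sum fun j _ => ?_).trans_eq (b := ∑ _j : Fin n, 2 * κ ^ 2) (by simp; ring)
    have a := sq_le_sq' (abs_le.1 (him j)).1 (abs_le.1 (him j)).2
    split_ifs with hj
    · linarith [sq_nonneg κ]
    · have b := sq_le_sq' (abs_le.1 (hre j hj)).1 (abs_le.1 (hre j hj)).2
      linarith
  -- The forgotten coordinate Re z_{i₀}. The range of v is chosen so that R² ≤ v - S ≤ (R + κ)².
  set s := √(v - S) with hs
  have hs2 : s ^ 2 = v - S := Real.sq_sqrt (by linarith [sq_nonneg R])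
  have hs0 : 0 ≤ s := Real.sqrt_nonneg _
  have hsR : R ≤ s := by
    refine le_of_sq_le_sq ?_ hs0
    linarith
  have hsR' : s ≤ R + κ := by
    refine le_of_sq_le_sq ?_ (by positivity)
    linarith [sq_nonneg κ, add_sq R κ]
  set x : CSpace (n + 1) := WithLp.toLp 2 (Fin.snoc (α := fun _ => ℂ)
    (fun j : Fin n => (⟨if j = i₀ then s else y (Sum.inl (Sum.inr j)), y (Sum.inl (Sum.inl j))⟩ : ℂ))
    (⟨y (Sum.inr ()), v⟩ : ℂ)) with hx
  have hxc : ∀ j : Fin n, x j.castSucc =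
      ⟨if j = i₀ then s else y (Sum.inl (Sum.inr j)), y (Sum.inl (Sum.inl j))⟩ := by
    intro j
    simp [hx]
  have hxl : x (Fin.last n) = ⟨y (Sum.inr ()), v⟩ := by simp [hx]
  have hzn : zNormSq x = s ^ 2 + S := by
    rw [zNormSq, hS]
    have : ∀ j : Fin n, ‖x j.castSucc‖ ^ 2 = (if j = i₀ then s ^ 2 else 0) +
        (y (Sum.inl (Sum.inl j)) ^ 2 + if j = i₀ then 0 else y (Sum.inl (Sum.inr j)) ^ 2) := by
      intro j
      rw [hxc, Complex.sq_norm, Complex.normSq_mk]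
      split_ifs <;> ring
    simp only [this]
    rw [Finset.sum_add_distrib]
    simp
  have hfr : siegelFun x = 0 := by
    rw [siegelFun, hzn, hxl, hs2]
    simp
  refine ⟨x, ⟨?_, ?_⟩, ?_⟩
  · rw [frontier_siegel]
    exact hfr
  · have him' : (heisMap i₀ R ε x (Fin.last n)).im = (s - R) ^ 2 + S := by
      rw [heisMap_last, hxl, hxc]
      simp [← Complex.ofReal_pow]
      linarith [sub_sq s R]
    have hzh : ε ^ 2 * zNormSq (heisMap i₀ R ε x) = (s - R) ^ 2 + S := by
      have := heisMap_last_im i₀ R hε x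
      rw [hfr, him'] at this
      linarith
    have hre' : (heisMap i₀ R ε x (Fin.last n)).re =
        y (Sum.inr ()) + 2 * R * y (Sum.inl (Sum.inl i₀)) := by
      rw [heisMap_last, hxl, hxc]
      simp [← Complex.ofReal_pow]
    -- The left side is |z'|², at most κ² + 2nκ². With nκ = ε/4 the two terms are at most ε²/16 and
    -- ε²/8.
    have hb1 : (s - R) ^ 2 + S ≤ 3 / 16 * ε ^ 2 := by
      have a : (s - R) ^ 2 ≤ κ ^ 2 := pow_le_pow_left₀ (sub_nonneg.2 hsR) (by linarith) 2
      have k1 : κ ^ 2 ≤ (ε / 4) ^ 2 := pow_le_pow_left₀ hκ0.le hκε 2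
      have k2 : κ * ε ≤ ε / 4 * ε := mul_le_mul_of_nonneg_right hκε hε.le
      have b : 2 * n * κ ^ 2 = κ * ε / 2 := by
        calc 2 * n * κ ^ 2 = 2 * (n * κ) * κ := by ring
          _ = κ * ε / 2 := by rw [hnκ]; ring
      linarith
    have hz1 : zNormSq (heisMap i₀ R ε x) ≤ 3 / 16 := by
      by_contra hcon
      have : ε ^ 2 * (3 / 16) < ε ^ 2 * zNormSq (heisMap i₀ R ε x) := by
        gcongr
        exact not_le.1 hcon
      linarith
    have hre1 : |(heisMap i₀ R ε x (Fin.last n)).re| ≤ 1 / 2 := by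
      rw [hre']
      refine (abs_add_le _ _).trans ?_
      rw [abs_mul, abs_of_pos (by linarith : 0 < 2 * R)]
      have := him i₀
      have c : 2 * R * |y (Sum.inl (Sum.inl i₀))| ≤ 2 * R * (ε / 4) := by
        gcongr
        linarith
      linarith
    have hre2 : (heisMap i₀ R ε x (Fin.last n)).re ^ 2 ≤ 1 / 4 := by
      have := sq_le_sq' (abs_le.1 hre1).1 (abs_le.1 hre1).2
      linarith
    have him1 : (heisMap i₀ R ε x (Fin.last n)).im ^ 2 ≤ 1 / 4 := by
      rw [him']
      have a : 0 ≤ (s - R) ^ 2 + S := by positivity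
      have b : (s - R) ^ 2 + S ≤ 1 / 2 := by linarith [pow_le_one₀ (n := 2) hε.le (by linarith : ε ≤ 1)]
      have c := pow_le_pow_left₀ a b 2
      norm_num at c ⊢
      exact c
    show ‖heisMap i₀ R ε x‖ ≤ 1
    refine le_of_sq_le_sq ?_ zero_le_one
    rw [EuclideanSpace.norm_sq_eq, Fin.sum_univ_castSucc, Complex.sq_norm, Complex.normSq_apply]
    have hzn' : ∑ i : Fin n, ‖heisMap i₀ R ε x i.castSucc‖ ^ 2 = zNormSq (heisMap i₀ R ε x) := rfl
    rw [hzn', ← pow_two, ← pow_two]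
    linarith
  · funext k
    rcases k with (j | j) | j
    · simp [forgetRe, hxc]
    · by_cases hj : j = i₀
      · simp [forgetRe, hj, hxl, hvdef]
      · simp [forgetRe, hj, hxc]
    · simp [forgetRe, hxl]

theorem exists_surface_lower_bound (hn : 1 ≤ n) : ∃ c : ℝ, 0 < c ∧
    ∀ (i₀ : Fin n) (R ε : ℝ), 1 ≤ R → 0 < ε → 100 * R ^ 3 * ε ≤ 1 →
      ENNReal.ofReal (c * R * ε ^ (2 * n)) ≤
        (Measure.euclideanHausdorffMeasure (2 * (n + 1) - 1) : Measure (CSpace (n + 1)))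
          (frontier (siegel n) ∩ {x | ‖heisMap i₀ R ε x‖ ≤ 1}) := by
  have hn0 : (0 : ℝ) < n := by exact_mod_cast hn
  set a := Measure.addHaarScalarFactor
    (volume : Measure (EuclideanSpace ℝ (Fin (2 * (n + 1) - 1))))
    (Measure.hausdorffMeasure ((2 * (n + 1) - 1 : ℕ) : ℝ)) with ha
  have ha0 : 0 < (a : ℝ) := by
    have := Measure.addHaarScalarFactor_volume_hausdorffMeasure_ne_zero (2 * (n + 1) - 1)
    exact_mod_cast pos_iff_ne_zero.2 this
  refine ⟨a * ((4 * n : ℝ)⁻¹ ^ (2 * n) / 2), by positivity, fun i₀ R ε hR hε h1 => ?_⟩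
  have hR3 : 1 ≤ R ^ 3 := one_le_pow₀ hR
  have hε1 : ε ≤ 1 / 100 := by nlinarith
  have hκ : 2 * n * (ε / (4 * n)) ≤ 1 := by
    have : 2 * n * (ε / (4 * n)) = ε / 2 := by
      field_simp
      norm_num
    linarith
  have h2 := (le_volume_box i₀ hR (by positivity : 0 < ε / (4 * n)) hκ).trans
    (volume_le_hausdorff_of_subset_forgetRe i₀ (box_subset hn i₀ hR hε h1))
  rw [Measure.euclideanHausdorffMeasure_def, ENNReal.smul_def, Measure.smul_apply, smul_eq_mul]
  have hac : (a : ℝ≥0∞) = ENNReal.ofReal (a : ℝ) := by rw [ENNReal.ofReal_coe_nnreal]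
  calc ENNReal.ofReal (a * ((4 * n : ℝ)⁻¹ ^ (2 * n) / 2) * R * ε ^ (2 * n))
      = (a : ℝ≥0∞) * ENNReal.ofReal (R * (ε / (4 * n)) ^ (2 * n) / 2) := by
        rw [hac, ← ENNReal.ofReal_mul ha0.le, div_eq_mul_inv ε, mul_pow]
        congr 1
        ring
    _ ≤ _ := by gcongr

end SurfaceBound

/-! ### Comparison of the two sides of the basic estimate -/

section FailureOfBasicEstimate

variable {n q : ℕ}

theorem norm_sq_eq_zNormSq_add (x : CSpace (n + 1)) :
    ‖x‖ ^ 2 = zNormSq x + ((x (Fin.last n)).re ^ 2 + (x (Fin.last n)).im ^ 2) := by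
  rw [EuclideanSpace.norm_sq_eq, Fin.sum_univ_castSucc, Complex.sq_norm, Complex.normSq_apply,
    ← pow_two, ← pow_two, zNormSq]

theorem le_norm_castSucc {i₀ : Fin n} {R ε : ℝ} (hR : 1 ≤ R) (hε : 0 < ε) {x : CSpace (n + 1)}
    (hx : ‖heisMap i₀ R ε x‖ ≤ 2) : R - 2 * ε ≤ ‖x i₀.castSucc‖ := by
  have h := norm_coord_of_norm_heisMap_le hε hx i₀
  rw [if_pos rfl] at h
  have h2 := norm_sub_norm_le (R : ℂ) (x i₀.castSucc)
  rw [norm_sub_rev, Complex.norm_real, Real.norm_of_nonneg (by linarith)] at h2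
  linarith

/-- In the domain Im w > |z|² ≥ R² - 4Rε, so (Im w)² loses at most 8R³ε from R⁴. This error is why
R³ε must be small. -/
theorem le_norm_sq_of_mem_siegel {i₀ : Fin n} {R ε : ℝ} (hR : 1 ≤ R) (hε : 0 < ε)
    (h1 : 100 * R ^ 3 * ε ≤ 1) {x : CSpace (n + 1)} (hx : ‖heisMap i₀ R ε x‖ ≤ 2)
    (hxΩ : x ∈ siegel n) : R ^ 2 + R ^ 4 - 1 ≤ ‖x‖ ^ 2 := by
  have hR3 : 1 ≤ R ^ 3 := one_le_pow₀ hR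
  have hR13 : R ≤ R ^ 3 := le_self_pow₀ hR (by norm_num)
  have hε1 : ε ≤ 1 / 100 := by nlinarith
  have hRε : R * ε ≤ 1 / 100 := by nlinarith
  have ha := le_norm_castSucc hR hε hx
  have ha2 : (R - 2 * ε) ^ 2 ≤ ‖x i₀.castSucc‖ ^ 2 := pow_le_pow_left₀ (by linarith) ha 2
  have hz : ‖x i₀.castSucc‖ ^ 2 ≤ zNormSq x :=
    Finset.single_le_sum (f := fun i : Fin n => ‖x i.castSucc‖ ^ 2) (fun _ _ => by positivity)
      (Finset.mem_univ i₀)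
  have hz1 : R ^ 2 - 4 * (R * ε) ≤ zNormSq x := by nlinarith [sq_nonneg ε]
  have hz0 : 0 ≤ R ^ 2 - 4 * (R * ε) := by nlinarith
  have him : zNormSq x < (x (Fin.last n)).im := hxΩ
  have hsq : (R ^ 2 - 4 * (R * ε)) ^ 2 ≤ (x (Fin.last n)).im ^ 2 :=
    pow_le_pow_left₀ hz0 (hz1.trans him.le) 2
  have hexp : (R ^ 2 - 4 * (R * ε)) ^ 2 = R ^ 4 - 8 * (R ^ 3 * ε) + 16 * (R * ε) ^ 2 := by ring
  rw [norm_sq_eq_zNormSq_add]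
  linarith [sq_nonneg (x (Fin.last n)).re, sq_nonneg (R * ε)]

/-- On the patch Im w = |z|² ≤ R² + 3Rε and |Re w| ≤ 3/2; the cross term of the square is again of
order R³ε. -/
theorem norm_sq_le_of_mem_frontier {i₀ : Fin n} {R ε : ℝ} (hR : 1 ≤ R) (hε : 0 < ε)
    (h1 : 100 * R ^ 3 * ε ≤ 1) {x : CSpace (n + 1)} (hx : ‖heisMap i₀ R ε x‖ ≤ 1)
    (hfr : siegelFun x = 0) : ‖x‖ ^ 2 ≤ R ^ 2 + R ^ 4 + 5 := by
  have hR3 : 1 ≤ R ^ 3 := one_le_pow₀ hR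
  have hR13 : R ≤ R ^ 3 := le_self_pow₀ hR (by norm_num)
  have hR23 : R ^ 2 ≤ R ^ 3 := pow_le_pow_right₀ hR (by norm_num)
  have hε1 : ε ≤ 1 / 100 := by nlinarith
  have hRε : R * ε ≤ 1 / 100 := by nlinarith
  have hR2ε : R ^ 2 * ε ≤ 1 / 100 := by nlinarith
  have hc := norm_coord_of_norm_heisMap_le hε hx i₀
  rw [if_pos rfl, one_mul] at hc
  have hre : |(x i₀.castSucc).re - R| ≤ ε := by
    have := (Complex.abs_re_le_norm _).trans hc
    simpa using this
  have him : |(x i₀.castSucc).im| ≤ ε := by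
    have := (Complex.abs_im_le_norm _).trans hc
    simpa using this
  have hn2 : ‖heisMap i₀ R ε x‖ ^ 2 ≤ 1 := pow_le_one₀ (norm_nonneg _) hx
  have hzh : zNormSq (heisMap i₀ R ε x) ≤ 1 := by
    rw [norm_sq_eq_zNormSq_add] at hn2
    linarith [sq_nonneg (heisMap i₀ R ε x (Fin.last n)).re,
      sq_nonneg (heisMap i₀ R ε x (Fin.last n)).im]
  have himw := heisMap_last_im i₀ R hε x
  have hwre : |(heisMap i₀ R ε x (Fin.last n)).re| ≤ 1 :=
    (Complex.abs_re_le_norm _).trans ((PiLp.norm_apply_le _ _).trans hx)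
  rw [hfr, heisMap_last] at himw
  rw [heisMap_last] at hwre
  simp [← Complex.ofReal_pow] at himw hwre
  have hzx : zNormSq x = (x (Fin.last n)).im := by
    rw [siegelFun] at hfr
    linarith
  have hv : (x (Fin.last n)).im ≤ R ^ 2 + 3 * (R * ε) := by
    have a : ε ^ 2 * zNormSq (heisMap i₀ R ε x) ≤ ε ^ 2 := mul_le_of_le_one_right (sq_nonneg _) hzh
    have b : R * ((x i₀.castSucc).re - R) ≤ R * ε :=
      mul_le_mul_of_nonneg_left (abs_le.1 hre).2 (by linarith)
    have c : ε ^ 2 ≤ R * ε := by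
      rw [pow_two]
      exact mul_le_mul_of_nonneg_right (by linarith) hε.le
    nlinarith
  have hv0 : 0 ≤ (x (Fin.last n)).im := by
    rw [← hzx]
    exact zNormSq_nonneg x
  have hv2 : (x (Fin.last n)).im ^ 2 ≤ (R ^ 2 + 3 * (R * ε)) ^ 2 := pow_le_pow_left₀ hv0 hv 2
  have hu : |(x (Fin.last n)).re| ≤ 3 / 2 := by
    have a : |2 * R * (x i₀.castSucc).im| ≤ 2 * (R * ε) := by
      rw [abs_mul, abs_of_pos (by linarith : 0 < 2 * R), mul_assoc]
      gcongr
    have a' := abs_le.1 a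
    have b' := abs_le.1 hwre
    rw [abs_le]
    constructor <;> linarith
  have hu2 : (x (Fin.last n)).re ^ 2 ≤ (3 / 2) ^ 2 := by
    rw [← sq_abs]
    exact pow_le_pow_left₀ (abs_nonneg _) hu 2
  have hexp : (R ^ 2 + 3 * (R * ε)) ^ 2 = R ^ 4 + 6 * (R ^ 3 * ε) + 9 * (R * ε) ^ 2 := by ring
  have hRε2 : (R * ε) ^ 2 ≤ (1 / 100) ^ 2 := pow_le_pow_left₀ (by positivity) hRε 2
  rw [norm_sq_eq_zNormSq_add, hzx]
  linarith

/-- On the patch the cutoff is 1. The peak is at least 1/e because Im w' = |z'|² ≤ ε² on the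
boundary, and the contraction has a component ±z̄_{i₀} of modulus at least R/2. -/
theorem le_norm_sq_tangForm {i₀ : Fin n} {K₀ : Finset (Fin (n + 1))} (hK₀ : K₀.card = q + 1)
    (hi₀ : i₀.castSucc ∈ K₀) {R ε : ℝ} (hR : 1 ≤ R) (hε : 0 < ε) (h1 : 100 * R ^ 3 * ε ≤ 1)
    {x : CSpace (n + 1)} (hx : ‖heisMap i₀ R ε x‖ ≤ 1) (hfr : siegelFun x = 0) :
    Real.exp (-2) * (R / 2) ^ 2 ≤ ‖tangForm q K₀ (heisTest i₀ R ε) x‖ ^ 2 := by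
  have hR3 : 1 ≤ R ^ 3 := one_le_pow₀ hR
  have hε1 : ε ≤ 1 / 100 := by nlinarith
  have hbump : heisBump n (heisMap i₀ R ε x) = 1 :=
    (heisBump n).one_of_mem_closedBall (by simpa [heisBump] using hx)
  have hn2 : ‖heisMap i₀ R ε x‖ ^ 2 ≤ 1 := pow_le_one₀ (norm_nonneg _) hx
  have hzh : zNormSq (heisMap i₀ R ε x) ≤ 1 := by
    rw [norm_sq_eq_zNormSq_add] at hn2
    linarith [sq_nonneg (heisMap i₀ R ε x (Fin.last n)).re,
      sq_nonneg (heisMap i₀ R ε x (Fin.last n)).im]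
  have hpeak : Real.exp (-1) ≤ ‖heisPeak i₀ R ε x‖ := by
    rw [norm_heisPeak, Real.exp_le_exp, heisMap_last_im i₀ R hε x, hfr, sub_zero, neg_div,
      neg_le_neg_iff, mul_div_cancel_left₀ _ (by positivity)]
    exact hzh
  have hA : R / 2 ≤ ‖contractForm q (siegelNormal x) K₀‖ := by
    refine le_trans ?_ (norm_le_norm_contractForm (siegelNormal x) hK₀ hi₀)
    rw [siegelNormal, if_neg (Fin.castSucc_lt_last i₀).ne, RCLike.norm_conj]
    have := le_norm_castSucc hR hε (hx.trans (by norm_num))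
    linarith
  rw [tangForm, norm_smul, heisTest, hbump, Complex.ofReal_one, one_mul, mul_pow]
  have e : Real.exp (-2) = Real.exp (-1) ^ 2 := by
    rw [← Real.exp_nat_mul]
    norm_num
  rw [e]
  gcongr

theorem enorm_sq_eq_ofReal {E : Type*} [NormedAddCommGroup E] (a : E) :
    ‖a‖ₑ ^ 2 = ENNReal.ofReal (‖a‖ ^ 2) := by
  rw [← ofReal_norm, ENNReal.ofReal_pow (norm_nonneg _)]

theorem not_basicEstimateOn_siegel (hq : 1 ≤ q) (hqn : q ≤ n) {t : ℝ} (ht : 0 ≤ t) :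
    ¬ BasicEstimateOn {f : CSpace (n + 1) → Forms (n + 1) q | ContDiff ℝ ∞ f ∧ HasCompactSupport f}
      (siegel n) t := by
  rintro ⟨C, hC, hest⟩
  obtain ⟨C₁, hC₁, hpt⟩ := exists_bound_heisTest n q hq
  obtain ⟨C₂, hC₂, hvol⟩ := exists_lintegral_heisPeak_le n
  obtain ⟨c, hc, hsurf⟩ := exists_surface_lower_bound (n := n) (hq.trans hqn)
  set i₀ : Fin n := ⟨0, hq.trans hqn⟩
  -- There is room for q + 1 of the n + 1 indices exactly because q ≤ n.
  obtain ⟨K₀, hsub, hK₀⟩ : ∃ K₀ : Finset (Fin (n + 1)), {i₀.castSucc} ⊆ K₀ ∧ K₀.card = q + 1 :=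
    Finset.exists_superset_card_eq (by simp) (by simp; omega)
  have hi₀ : i₀.castSucc ∈ K₀ := hsub (Finset.mem_singleton_self _)
  -- the parameters of the test form
  set R : ℝ := 1 + C * (C₁ * C₂) * Real.exp (6 * t) * (4 * Real.exp 2 / c) with hRdef
  have hR : 1 ≤ R := by
    rw [hRdef, le_add_iff_nonneg_right]
    positivity
  have hR0 : 0 < R := by linarith
  -- Small enough for both smallness conditions, on R³ε and on tR²ε.
  set ε : ℝ := (100 * R ^ 3 * (1 + t))⁻¹ with hεdef
  have hε : 0 < ε := by positivity
  have hεR : 100 * R ^ 3 * (1 + t) * ε = 1 := mul_inv_cancel₀ (by positivity)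
  have h1 : 100 * R ^ 3 * ε ≤ 1 := by
    have : 0 ≤ 100 * R ^ 3 * ε * t := by positivity
    linarith
  have h2 : 9 * t * R ^ 2 * ε ≤ 1 := by
    have hR23 : R ^ 2 ≤ R ^ 3 := pow_le_pow_right₀ hR (by norm_num)
    calc 9 * t * R ^ 2 * ε ≤ 100 * (1 + t) * R ^ 3 * ε := by gcongr <;> linarith
      _ = 1 := by linarith
  set g := heisTest i₀ R ε with hg
  have hgC : ContDiff ℝ ∞ g := contDiff_heisTest i₀ R ε
  have hgc : HasCompactSupport g := hasCompactSupport_heisTest i₀ hR hε h1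
  set f := tangForm q K₀ g with hf
  set u := dbarForm (q + 1) f with hu
  set v := dbarStarForm (q - 1) t f with hv
  have hmain := hest f ⟨contDiff_tangForm hgC, hasCompactSupport_tangForm hgc⟩ u v
    (isDbar_dbarForm ht (contDiff_tangForm hgC) (hasCompactSupport_tangForm hgc))
    (isDbarStar_tangForm (by omega) ht hgC hgc)
  set P := R ^ 2 + R ^ 4 with hP
  -- upper bound of the right-hand side
  have hum : Measurable fun x => ‖u x‖ₑ ^ 2 :=
    (continuous_dbarForm (contDiff_tangForm hgC)).measurable.enorm.pow_const 2
  have hvm : Measurable fun x => ‖v x‖ₑ ^ 2 :=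
    (continuous_dbarStarForm t (contDiff_tangForm hgC)).measurable.enorm.pow_const 2
  have hupper : ∫⁻ x, ‖u x‖ₑ ^ 2 ∂weightedVolume (siegel n) t +
      ∫⁻ x, ‖v x‖ₑ ^ 2 ∂weightedVolume (siegel n) t ≤
      ENNReal.ofReal (Real.exp (-t * (P - 1)) * (C₁ * (R / ε) ^ 2)) *
        ENNReal.ofReal (C₂ * ε ^ (2 * n + 2)) := by
    have hsum : Measurable fun x => ‖u x‖ₑ ^ 2 + ‖v x‖ₑ ^ 2 := hum.add hvm
    rw [← lintegral_add_left hum, weightedVolume,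
      lintegral_withDensity_eq_lintegral_mul _ (measurable_weight t) hsum]
    refine le_trans ?_ (mul_le_mul_right (hvol i₀ R ε hε) _)
    rw [← lintegral_const_mul' _ _ ENNReal.ofReal_ne_top]
    refine setLIntegral_mono' isOpen_siegel.measurableSet fun x hx => ?_
    simp only [Pi.mul_apply]
    have hptx := hpt i₀ K₀ R ε t hR hε ht h1 h2 x
    rw [enorm_sq_eq_ofReal, enorm_sq_eq_ofReal,
      ← ENNReal.ofReal_add (sq_nonneg _) (sq_nonneg _), ← ENNReal.ofReal_mul (Real.exp_pos _).le]
    by_cases hx2 : ‖heisMap i₀ R ε x‖ ≤ 2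
    · rw [Set.indicator_of_mem (show x ∈ {y | ‖heisMap i₀ R ε y‖ ≤ 2} from hx2)] at hptx ⊢
      rw [← ENNReal.ofReal_mul (by positivity)]
      refine ENNReal.ofReal_le_ofReal ?_
      have hw : Real.exp (-t * ‖x‖ ^ 2) ≤ Real.exp (-t * (P - 1)) := by
        rw [Real.exp_le_exp]
        have := mul_le_mul_of_nonneg_left (le_norm_sq_of_mem_siegel hR hε h1 hx2 hx) ht
        linarith
      calc Real.exp (-t * ‖x‖ ^ 2) * (‖u x‖ ^ 2 + ‖v x‖ ^ 2)
          ≤ Real.exp (-t * (P - 1)) * (C₁ * (R / ε) ^ 2 * ‖heisPeak i₀ R ε x‖ ^ 2) := by gcongr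
        _ = _ := by ring
    · rw [Set.indicator_of_notMem (show x ∉ {y | ‖heisMap i₀ R ε y‖ ≤ 2} from hx2)] at hptx ⊢
      have h0 : ‖u x‖ ^ 2 + ‖v x‖ ^ 2 = 0 := le_antisymm hptx (by positivity)
      rw [h0]
      simp
  -- lower bound of the left-hand side
  have hlower : ENNReal.ofReal (Real.exp (-t * (P + 5)) * (Real.exp (-2) * (R / 2) ^ 2)) *
      ENNReal.ofReal (c * R * ε ^ (2 * n)) ≤ ∫⁻ x, ‖f x‖ₑ ^ 2 ∂weightedSurface (siegel n) t := by
    have hEm : MeasurableSet {x | ‖heisMap i₀ R ε x‖ ≤ 1} :=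
      (isClosed_le (contDiff_heisMap i₀ R ε).continuous.norm continuous_const).measurableSet
    have hfm : Measurable fun x => ‖f x‖ₑ ^ 2 :=
      (contDiff_tangForm hgC).continuous.measurable.enorm.pow_const 2
    rw [weightedSurface, lintegral_withDensity_eq_lintegral_mul _ (measurable_weight t) hfm]
    refine (mul_le_mul_right (hsurf i₀ R ε hR hε h1) _).trans ?_
    rw [Set.inter_comm, ← Measure.restrict_apply hEm, ← setLIntegral_const]
    refine le_trans ?_ (setLIntegral_le_lintegral {x | ‖heisMap i₀ R ε x‖ ≤ 1} _)
    rw [Measure.restrict_restrict hEm]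
    refine setLIntegral_mono' (hEm.inter isClosed_frontier.measurableSet) fun x hx => ?_
    have hfr : siegelFun x = 0 := by
      have := hx.2
      rwa [frontier_siegel] at this
    simp only [Pi.mul_apply]
    rw [enorm_sq_eq_ofReal, ← ENNReal.ofReal_mul (Real.exp_pos _).le]
    refine ENNReal.ofReal_le_ofReal ?_
    refine mul_le_mul ?_ (le_norm_sq_tangForm hK₀ hi₀ hR hε h1 hx.1 hfr) (by positivity)
      (Real.exp_pos _).le
    rw [Real.exp_le_exp]
    have := mul_le_mul_of_nonneg_left (norm_sq_le_of_mem_frontier hR hε h1 hx.1 hfr) ht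
    linarith
  have hall := hlower.trans (hmain.trans (mul_le_mul_right hupper _))
  rw [← ENNReal.ofReal_mul (by positivity), ← ENNReal.ofReal_mul (by positivity),
    ← ENNReal.ofReal_mul (by positivity), ENNReal.ofReal_le_ofReal_iff (by positivity)] at hall
  -- The upper and lower bounds of the weight differ only by e^(6t), independently of R.
  have hexp : Real.exp (-t * (P - 1)) = Real.exp (-t * (P + 5)) * Real.exp (6 * t) := by
    rw [← Real.exp_add]
    congr 1
    ring
  set W := Real.exp (-t * (P + 5)) with hW
  have hW0 : 0 < W := Real.exp_pos _
  -- The common factor of both sides; after division the left side keeps one power of R, coming from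
  -- the surface area.
  have hfac : 0 < W * R ^ 2 * ε ^ (2 * n) := by positivity
  have e1 : W * (Real.exp (-2) * (R / 2) ^ 2) * (c * R * ε ^ (2 * n)) =
      (Real.exp (-2) * c / 4 * R) * (W * R ^ 2 * ε ^ (2 * n)) := by ring
  have e2 : C * (Real.exp (-t * (P - 1)) * (C₁ * (R / ε) ^ 2) * (C₂ * ε ^ (2 * n + 2))) =
      (C * (C₁ * C₂) * Real.exp (6 * t)) * (W * R ^ 2 * ε ^ (2 * n)) := by
    rw [hexp, pow_add ε, div_pow]
    field_simp
  rw [e1, e2] at hall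
  have hfin := le_of_mul_le_mul_right hall hfac
  have e3 : Real.exp (-2) * c / 4 * R =
      Real.exp (-2) * c / 4 + C * (C₁ * C₂) * Real.exp (6 * t) := by
    rw [hRdef, Real.exp_neg]
    have := (Real.exp_pos 2).ne'
    field_simp
  have : 0 < Real.exp (-2) * c / 4 := by positivity
  linarith

theorem BasicEstimateOn.mono {N q : ℕ} {S T : Set (CSpace N → Forms N q)} {Ω : Set (CSpace N)}
    {t : ℝ} (hST : S ⊆ T) (h : BasicEstimateOn T Ω t) : BasicEstimateOn S Ω t := by
  obtain ⟨C, hC, h⟩ := h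
  exact ⟨C, hC, fun f hf => h f (hST hf)⟩

theorem not_follandKohnBasicEstimate_siegel (hq : 1 ≤ q) (hqn : q ≤ n) {t : ℝ} (ht : 0 ≤ t) :
    ¬ FollandKohnBasicEstimate q (siegel n) t := fun h =>
  not_basicEstimateOn_siegel hq hqn ht
    (BasicEstimateOn.mono (fun _ hf => hf.1.continuous.continuousOn) h)

end FailureOfBasicEstimate

end

/-! ### Assembly of the four assertions -/

theorem mainTheorem4 (n : ℕ) (hn : 1 ≤ n) :
    -- a domain with a uniformly smooth (normalized) defining function
    (IsOpen (siegel n) ∧ IsConnected (siegel n) ∧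
      ∃ U ρ, IsUniformlySmoothDefiningFunction (siegel n) U ρ ∧ IsNormalizedOn (siegel n) ρ) ∧
    StrictlyPseudoconvex (siegel n) ∧
    ¬ UniformlyStrictlyPseudoconvex (siegel n) ∧
    -- the eigenvalues of the normalized Levi form
    (∀ U ρ, IsDefiningFunction 2 (siegel n) U ρ → IsNormalizedOn (siegel n) ρ →
      (∀ p ∈ frontier (siegel n),
        leviEigenvalues ρ p =
            {(1 + 4 * zNormSq p) ^ (-(3 / 2) : ℝ)} ∪
              {μ | 2 ≤ n ∧ μ = (1 + 4 * zNormSq p) ^ (-(1 / 2) : ℝ)} ∧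
          IsLeast (leviEigenvalues ρ p) ((1 + 4 * zNormSq p) ^ (-(3 / 2) : ℝ))) ∧
      Tendsto (fun p : frontier (siegel n) => sInf (leviEigenvalues ρ p.1))
        (comap (fun p : frontier (siegel n) => zNormSq p.1) atTop) (𝓝 0)) ∧
    -- failure of the basic estimate, even on smooth compactly supported forms
    (∀ q : ℕ, 1 ≤ q → q ≤ n → ∀ t : ℝ, 0 ≤ t →
      ¬ FollandKohnBasicEstimate q (siegel n) t ∧
      ¬ BasicEstimateOn
          {f : CSpace (n + 1) → Forms (n + 1) q | ContDiff ℝ ∞ f ∧ HasCompactSupport f}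
          (siegel n) t) := by
  refine ⟨⟨isOpen_siegel, isConnected_siegel, _, _,
      isUniformlySmoothDefiningFunction_siegelNormalized, isNormalizedOn_siegelNormalized⟩,
    strictlyPseudoconvex_siegel hn, not_uniformlyStrictlyPseudoconvex_siegel hn, ?_, ?_⟩
  · intro U ρ h hρ
    refine ⟨fun p hp => ?_, tendsto_sInf_leviEigenvalues_siegel hn h hρ⟩
    rw [siegelScale_cube_eq_rpow, siegelScale_eq_rpow]
    exact ⟨leviEigenvalues_siegel hn h hρ hp, isLeast_leviEigenvalues_siegel hn h hρ hp⟩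
  · intro q hq hqn t ht
    exact ⟨not_follandKohnBasicEstimate_siegel hq hqn ht, not_basicEstimateOn_siegel hq hqn ht⟩
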